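/- Let $J=\begin{pmatrix}0&I_3\\-I_3&0\end{pmatrix}$ and let $\mathrm{USp}(6)$ be the compact group of unitary $6\times 6$ complex matrices preserving the symplectic form with matrix $J$. Embed $\mathrm{U}(3)$ in $\mathrm{USp}(6)$ by $A\mapsto\begin{pmatrix}A&0\\0&\overline{A}\end{pmatrix}$, and let $N(\mathrm{U}(3))$ denote the normalizer of (the image of) $\mathrm{U}(3)$ in $\mathrm{USp}(6)$. Weights are taken with respect to the maximal torus of matrices $\mathrm{diag}(t_1,t_2,t_3,t_1^{-1},t_2^{-1},t_3^{-1})$ with $|t_i|=1$: the weight $(\mu_1,\mu_2,\mu_3)\in\mathbb{Z}^3$ is the character $t_1^{\mu_1}t_2^{\mu_2}t_3^{\mu_3}$, and the simple roots are $(1,-1,0)$, $(0,1,-1)$, $(0,0,2)$. Let $a\ge b\ge c\ge 0$ be integers, put $\lambda=(a,b,c)$, and let $\chi_\lambda$ be the character of the irreducible (continuous, finite-dimensional, complex) representation $V_\lambda$ of $\mathrm{USp}(6)$ with highest weight $\lambda$. For a closed subgroup $G$ of $\mathrm{USp}(6)$ let $\mathfrak{m}_G(\chi_\lambda)=\dim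 V_\lambda^{G}$ be the multiplicity of the trivial representation in the restriction of $V_\lambda$ to $G$. Then: (a) $\mathfrak{m}_{\mathrm{U}(3)}(\chi_\lambda)$ is $1$ if $a,b,c$ are all even, and it is $0$ otherwise. (b) $\mathfrak{m}_{N(\mathrm{U}(3))}(\chi_\lambda)$ is $1$ if $a,b,c$ are all even and $a+b+c\equiv 0\pmod 4$, and it is $0$ otherwise. -/

import Mathlib

noncomputable section

/-- The compact symplectic group `USp(6)`: the unitary `6 × 6` complex matrices `A` with
`A * J * Aᵀ = J`, where `J` is the standard block symplectic form on `ℂ³ ⊕ ℂ³`.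
It carries the topology of a subspace of the space of matrices. -/
def USp6 : Subgroup (Matrix.unitaryGroup (Fin 3 ⊕ Fin 3) ℂ) where
  carrier := {A | (A : Matrix (Fin 3 ⊕ Fin 3) (Fin 3 ⊕ Fin 3) ℂ) ∈ Matrix.symplecticGroup (Fin 3) ℂ}
  mul_mem' := by
    intro A B hA hB
    exact (Matrix.symplecticGroup (Fin 3) ℂ).mul_mem hA hB
  one_mem' := one_mem (Matrix.symplecticGroup (Fin 3) ℂ)
  inv_mem' := by
    intro A hA
    have h : (A⁻¹ : Matrix.unitaryGroup (Fin 3 ⊕ Fin 3) ℂ).1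
        = ((⟨A.1, hA⟩ : Matrix.symplecticGroup (Fin 3) ℂ)⁻¹).1 := by
      have h1 : (A⁻¹ : Matrix.unitaryGroup (Fin 3 ⊕ Fin 3) ℂ).1 * A.1 = 1 :=
        congrArg Subtype.val (inv_mul_cancel A)
      have h2 : A.1 * ((⟨A.1, hA⟩ : Matrix.symplecticGroup (Fin 3) ℂ)⁻¹).1 = 1 :=
        congrArg Subtype.val (mul_inv_cancel (⟨A.1, hA⟩ : Matrix.symplecticGroup (Fin 3) ℂ))
      exact left_inv_eq_right_inv h1 h2
    change (A⁻¹ : Matrix.unitaryGroup (Fin 3 ⊕ Fin 3) ℂ).1 ∈ Matrix.symplecticGroup (Fin 3) ℂ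
    rw [h]
    exact ((⟨A.1, hA⟩ : Matrix.symplecticGroup (Fin 3) ℂ)⁻¹).2

/-- The block diagonal matrix with blocks `A` and the entrywise conjugate of `A`. -/
def conjBlock (A : Matrix (Fin 3) (Fin 3) ℂ) : Matrix (Fin 3 ⊕ Fin 3) (Fin 3 ⊕ Fin 3) ℂ :=
  Matrix.fromBlocks A 0 0 (A.map star)

theorem conjBlock_mul (A B : Matrix (Fin 3) (Fin 3) ℂ) :
    conjBlock (A * B) = conjBlock A * conjBlock B := by
  have h : (A * B).map star = A.map star * B.map star :=
    Matrix.map_mul (f := starRingEnd ℂ)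
  rw [conjBlock, h]
  simp [conjBlock, Matrix.fromBlocks_multiply]

theorem conjBlock_one : conjBlock 1 = 1 := by
  simp [conjBlock, Matrix.map_one]

theorem conjBlock_star (A : Matrix (Fin 3) (Fin 3) ℂ) :
    star (conjBlock A) = conjBlock (star A) := by
  simp only [conjBlock, Matrix.star_eq_conjTranspose, Matrix.fromBlocks_conjTranspose,
    Matrix.conjTranspose_zero]
  congr 1

theorem conjBlock_mem_unitaryGroup {A : Matrix (Fin 3) (Fin 3) ℂ}
    (hA : A ∈ Matrix.unitaryGroup (Fin 3) ℂ) :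
    conjBlock A ∈ Matrix.unitaryGroup (Fin 3 ⊕ Fin 3) ℂ := by
  rw [Matrix.mem_unitaryGroup_iff] at hA ⊢
  rw [conjBlock_star, ← conjBlock_mul, hA, conjBlock_one]

theorem conjBlock_mem_symplecticGroup {A : Matrix (Fin 3) (Fin 3) ℂ}
    (hA : A ∈ Matrix.unitaryGroup (Fin 3) ℂ) :
    conjBlock A ∈ Matrix.symplecticGroup (Fin 3) ℂ := by
  rw [Matrix.mem_unitaryGroup_iff] at hA
  have h1 : A * (A.map star).transpose = 1 := hA
  have h2 : A.map star * A.transpose = 1 := by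
    have h := congrArg Matrix.transpose h1
    simpa [Matrix.transpose_mul] using h
  rw [SymplecticGroup.mem_iff]
  rw [conjBlock, Matrix.J, Matrix.fromBlocks_transpose, Matrix.fromBlocks_multiply,
    Matrix.fromBlocks_multiply]
  simp only [Matrix.mul_zero, Matrix.zero_mul, Matrix.mul_neg, Matrix.neg_mul, Matrix.mul_one,
    add_zero, zero_add, neg_zero, Matrix.transpose_zero, h1, h2]

/-- The embedding `A ↦ diag(A, conj A)` of `U(3)` into `USp(6)`. -/
def embedU3 : Matrix.unitaryGroup (Fin 3) ℂ →* USp6 where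
  toFun A := ⟨⟨conjBlock A.1, conjBlock_mem_unitaryGroup A.2⟩, conjBlock_mem_symplecticGroup A.2⟩
  map_one' := Subtype.ext (Subtype.ext conjBlock_one)
  map_mul' A B := Subtype.ext (Subtype.ext (conjBlock_mul A.1 B.1))

/-- `U(3)` as a subgroup of `USp(6)`. -/
def U3 : Subgroup USp6 := embedU3.range

/-- `N(U(3))`, the normalizer of `U(3)` in `USp(6)`. -/
def NU3 : Subgroup USp6 := Subgroup.normalizer (U3 : Set USp6)

/-- The diagonal unitary matrix with diagonal entries `t₁, t₂, t₃` on the unit circle. -/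
def diagU3 (t : Fin 3 → Circle) : Matrix.unitaryGroup (Fin 3) ℂ :=
  ⟨Matrix.diagonal fun i => (t i : ℂ), by
    rw [Matrix.mem_unitaryGroup_iff, Matrix.star_eq_conjTranspose, Matrix.diagonal_conjTranspose,
      Matrix.diagonal_mul_diagonal, ← Matrix.diagonal_one]
    congr 1
    funext i
    simp [Complex.mul_conj]⟩

/-- The element `diag(t₁, t₂, t₃, t₁⁻¹, t₂⁻¹, t₃⁻¹)` of the standard maximal torus of `USp(6)`. -/
def torusElt (t : Fin 3 → Circle) : USp6 := embedU3 (diagU3 t)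

section Representations

variable {V : Type*} [AddCommGroup V] [Module ℂ V]

/-- Continuity of a representation of `USp(6)` on a finite-dimensional complex space: all matrix
coefficients are continuous functions on the group. -/
def IsContinuousRep (ρ : Representation ℂ USp6 V) : Prop :=
  ∀ (φ : Module.Dual ℂ V) (v : V), Continuous fun g : USp6 => φ (ρ g v)

/-- `μ = (μ₁, μ₂, μ₃) ∈ ℤ³` is a weight of `ρ`: some nonzero vector is multiplied by
`t₁^μ₁ t₂^μ₂ t₃^μ₃` under the torus element `diag(t₁, t₂, t₃, t₁⁻¹, t₂⁻¹, t₃⁻¹)`, for all `t`. -/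
def IsWeight (ρ : Representation ℂ USp6 V) (μ : Fin 3 → ℤ) : Prop :=
  ∃ v : V, v ≠ 0 ∧ ∀ t : Fin 3 → Circle, ρ (torusElt t) v = (∏ i, (t i : ℂ) ^ μ i) • v

/-- `lam` is the highest weight of `ρ`: it is a weight, and it exceeds every weight `μ` by a
nonnegative integral combination of the simple roots `e₁ - e₂`, `e₂ - e₃`, `2e₃`. -/
def HasHighestWeight (ρ : Representation ℂ USp6 V) (lam : Fin 3 → ℤ) : Prop :=
  IsWeight ρ lam ∧ ∀ μ : Fin 3 → ℤ, IsWeight ρ μ →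
    ∃ n₁ n₂ n₃ : ℕ, lam - μ = n₁ • ![1, -1, 0] + n₂ • ![0, 1, -1] + n₃ • ![0, 0, 2]

/-- The multiplicity of the trivial representation in the restriction of `ρ` to the subgroup `G`:
the dimension of the space of `G`-invariant vectors. -/
def trivialMultiplicity (G : Subgroup USp6) (ρ : Representation ℂ USp6 V) : ℕ :=
  Module.finrank ℂ (Representation.invariants (ρ.comp G.subtype))

end Representations

end

/-! This is the Cartan–Helgason theorem for the symmetric pair (`USp6`, `U3`), proved by hand on
matrix coefficients. A Cayley transform conjugates U(3) to the group `realU3` of real matrices in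
USp(6). The complexified Lie algebra of `realU3` and the upper Borel subalgebra together span sp(6,
ℂ), as in the Iwasawa decomposition.

The engine is `IsInfinitesimal.apply_eq_zero`. Suppose sp(6, ℂ) = 𝔨 + 𝔟, a functional φ kills the
image of 𝔨, and 𝔟 preserves the line of x. Then φ(x) = 0 forces φ to vanish on the whole orbit of x.
It is applied twice to a highest weight vector v. With 𝔨 the complexified Lie algebra of `realU3`,
an invariant functional on an irreducible V is determined by its value at v. Hence the invariants
are spanned by the average Pv of v over `realU3`. With 𝔨 spanned by the negative root vectors, the
coefficient φ(ρ(g)v), for φ the functional of the same weight with φ(v) = 1, depends only on λ.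
Comparison with an explicit model (`highest_coeff_eq_minorProd`) shows that it is Δ₁^p Δ₂^q Δ₃^r,
where Δₖ are the leading principal minors of g and p = a − b, q = b − c, r = c.

The condition Pv ≠ 0 is decided as follows. The diagonal sign matrices lie in `realU3` and act on v
by the signs (−1)^λᵢ, so Pv ≠ 0 forces a, b, c to be even. Conversely, if they are even, so are p,
q, r; the coefficient is then nonnegative on real matrices and equals 1 at the identity, so φ(Pv) is
a positive integral. This gives (a).

For (b), N(U(3)) is the union of U(3) and its coset by J (`mem_NU3_iff`). The Cayley transform
carries J to the torus element with all tᵢ = i. This element normalizes `realU3` and acts on v by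
i^(a+b+c), so it acts on Pv by the same scalar, which is 1 exactly when 4 divides a + b + c.

Lie algebra methods require that ρ be differentiable and that derivatives determine ρ. The first
comes from `matrixCoeff_extendsHolomorphically`, a Peter–Weyl argument, and the second from
`closure_exp_eq_top`. -/

noncomputable section

/-- Functionals on a module over a field separate points. -/
theorem eq_of_forall_dual_eq {V : Type*} [AddCommGroup V] [Module ℂ V] {x y : V}
    (h : ∀ ψ : Module.Dual ℂ V, ψ x = ψ y) : x = y := by
  rw [← sub_eq_zero, ← Module.forall_dual_apply_eq_zero_iff ℂ]
  intro ψ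
  rw [map_sub, h ψ, sub_self]

/-! ### Averaging over compact groups. -/

section Averaging

open MeasureTheory

variable {V : Type*} [AddCommGroup V] [Module ℂ V] [FiniteDimensional ℂ V]

/-- The integral of the operators is assembled from scalar integrals in a basis, so V needs no norm;
testing against functionals then characterizes it. -/
theorem exists_weak_integral {H : Type*} [TopologicalSpace H] [CompactSpace H]
    [MeasurableSpace H] [BorelSpace H] (m : Measure H) [IsFiniteMeasure m]
    (A : H → V →ₗ[ℂ] V) (hA : ∀ (ψ : Module.Dual ℂ V) (w : V), Continuous fun h => ψ (A h w)) :
    ∃ P : V →ₗ[ℂ] V, ∀ (ψ : Module.Dual ℂ V) (w : V), ψ (P w) = ∫ h, ψ (A h w) ∂m := by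
  have hint : ∀ (ψ : Module.Dual ℂ V) (w : V), Integrable (fun h => ψ (A h w)) m := fun ψ w =>
    (hA ψ w).integrable_of_hasCompactSupport (HasCompactSupport.of_compactSpace _)
  let b := Module.finBasis ℂ V
  refine ⟨∑ i, LinearMap.smulRight
    { toFun := fun w => ∫ h, b.coord i (A h w) ∂m
      map_add' := fun x y => by
        simp only [map_add]
        exact integral_add (hint _ _) (hint _ _)
      map_smul' := fun c x => by
        simp only [map_smul, RingHom.id_apply, smul_eq_mul]
        exact integral_const_mul _ _ } (b i), fun ψ w => ?_⟩
  have h1 : ∀ h, ψ (A h w) = ∑ i, b.coord i (A h w) * ψ (b i) := by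
    intro h
    conv_lhs => rw [← b.sum_repr (A h w)]
    simp only [map_sum, map_smul, smul_eq_mul, Module.Basis.coord_apply]
  simp only [h1]
  rw [integral_finsetSum _ fun i _ => (hint (b.coord i) w).mul_const _]
  simp only [LinearMap.sum_apply, map_sum, LinearMap.smulRight_apply, LinearMap.coe_mk,
    AddHom.coe_mk, map_smul, smul_eq_mul, integral_mul_const]

/-- The averaging projection of a continuous representation of a compact group onto its
invariants. -/
theorem exists_averaging {H : Type*} [Group H] [TopologicalSpace H] [IsTopologicalGroup H]
    [CompactSpace H] (τ : Representation ℂ H V)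
    (hτ : ∀ (ψ : Module.Dual ℂ V) (w : V), Continuous fun h => ψ (τ h w)) :
    ∃ P : V →ₗ[ℂ] V, (∀ h w, τ h (P w) = P w) ∧ (∀ h w, P (τ h w) = P w) ∧
      (∀ w, (∀ h, τ h w = w) → P w = w) ∧
      (∀ ψ : Module.Dual ℂ V, (∀ h w, ψ (τ h w) = ψ w) → ∀ w, ψ (P w) = ψ w) ∧
      ∀ (ψ : Module.Dual ℂ V) (w : V), (∀ h, ∃ r : ℝ, 0 ≤ r ∧ ψ (τ h w) = r) → ψ w ≠ 0 →
        ψ (P w) ≠ 0 := by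
  let _ : MeasurableSpace H := borel H
  have : BorelSpace H := ⟨rfl⟩
  let m : Measure H := Measure.haarMeasure ⊤
  have : IsProbabilityMeasure m := ⟨by
    simpa using Measure.haarMeasure_self (G := H) (K₀ := ⊤)⟩
  obtain ⟨P, hP⟩ := exists_weak_integral m τ hτ
  -- Left invariance of Haar measure makes the image of P invariant. Averaging over inverses makes Q
  -- absorb τ on the right. Then P = QP = Q has both properties, without appeal to unimodularity.
  obtain ⟨Q, hQ⟩ := exists_weak_integral m (fun h => τ h⁻¹)
    fun ψ w => (hτ ψ w).comp continuous_inv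
  have hPinv : ∀ h w, τ h (P w) = P w := by
    intro h w
    refine eq_of_forall_dual_eq fun ψ => ?_
    have h1 := hP (ψ ∘ₗ τ h) w
    simp only [LinearMap.comp_apply] at h1
    rw [h1, hP, ← integral_mul_left_eq_self (fun x => ψ (τ x w)) h]
    simp only [map_mul, Module.End.mul_apply]
  have hQinv : ∀ h w, Q (τ h w) = Q w := by
    intro h w
    refine eq_of_forall_dual_eq fun ψ => ?_
    rw [hQ, hQ, ← integral_mul_left_eq_self (fun x => ψ (τ x⁻¹ (τ h w))) h]
    refine integral_congr_ae (Filter.Eventually.of_forall fun x => ?_)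
    simp only [← Module.End.mul_apply, ← map_mul]
    simp
  have hQfix : ∀ w, (∀ h, τ h w = w) → Q w = w := by
    intro w hw
    refine eq_of_forall_dual_eq fun ψ => ?_
    rw [hQ]
    simp [hw]
  have hPQ : ∀ w, P w = Q w := by
    intro w
    rw [← hQfix (P w) fun h => hPinv h w]
    refine eq_of_forall_dual_eq fun ψ => ?_
    have h1 := hP (ψ ∘ₗ Q) w
    simp only [LinearMap.comp_apply, hQinv] at h1
    rw [h1]
    simp
  refine ⟨P, hPinv, fun h w => by rw [hPQ, hPQ, hQinv], fun w hw => by rw [hPQ, hQfix w hw],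
    fun ψ hψ w => by rw [hP]; simp [hψ], fun ψ w hr hw => ?_⟩
  choose r hr0 hr1 using hr
  have hrc : Continuous r := by
    have : r = fun h => (ψ (τ h w)).re := by
      funext h
      rw [hr1, Complex.ofReal_re]
    rw [this]
    exact Complex.continuous_re.comp (hτ ψ w)
  -- A continuous nonnegative function that is nonzero at the identity has positive Haar integral.
  have hpos : 0 < ∫ h, r h ∂m := by
    refine hrc.integral_pos_of_hasCompactSupport_nonneg_nonzero (x := 1)
      (HasCompactSupport.of_compactSpace _) hr0 fun h => hw ?_
    have := hr1 1
    rw [h] at this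
    simpa using this
  rw [hP]
  simp only [hr1]
  rw [integral_complex_ofReal]
  exact_mod_cast hpos.ne'

/-- The averaging projection onto the isotypic component of a character of a compact group. -/
theorem exists_averaging_char {H : Type*} [Group H] [TopologicalSpace H] [IsTopologicalGroup H]
    [CompactSpace H] (τ : Representation ℂ H V)
    (hτ : ∀ (ψ : Module.Dual ℂ V) (w : V), Continuous fun h => ψ (τ h w))
    (χ : H →* ℂˣ) (hχ : Continuous fun h => (χ h : ℂ)) :
    ∃ P : V →ₗ[ℂ] V, (∀ h w, τ h (P w) = (χ h : ℂ) • P w) ∧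
      (∀ h w, P (τ h w) = (χ h : ℂ) • P w) ∧
      (∀ w, (∀ h, τ h w = (χ h : ℂ) • w) → P w = w) ∧
      (∀ ψ : Module.Dual ℂ V, (∀ h w, ψ (τ h w) = (χ h : ℂ) * ψ w) → ∀ w, ψ (P w) = ψ w) := by
  -- Twisting by the inverse character turns the isotypic component of χ into the invariants.
  let σ : Representation ℂ H V :=
    { toFun := fun h => ((χ h)⁻¹ : ℂˣ).val • τ h
      map_one' := by simp
      map_mul' := fun x y => by
        rw [smul_mul_smul_comm, ← map_mul, map_mul χ, mul_inv, Units.val_mul] }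
  have hσ : ∀ h w, σ h w = ((χ h)⁻¹ : ℂˣ).val • τ h w := fun _ _ => rfl
  have hτσ : ∀ h w, τ h w = (χ h : ℂ) • σ h w := by
    intro h w
    rw [hσ, smul_smul]
    simp
  obtain ⟨P, h1, h2, h3, h4, -⟩ := exists_averaging σ fun ψ w => by
    simp only [hσ, map_smul, smul_eq_mul, Units.val_inv_eq_inv_val]
    exact (hχ.inv₀ fun h => (χ h).ne_zero).mul (hτ ψ w)
  refine ⟨P, fun h w => by rw [hτσ, h1], fun h w => by rw [hτσ, map_smul, h2],
    fun w hw => h3 w fun h => ?_, fun ψ hψ w => h4 ψ (fun h w => ?_) w⟩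
  · rw [hσ, hw, smul_smul]
    simp
  · rw [hσ, map_smul, hψ, smul_eq_mul, ← mul_assoc]
    simp

end Averaging
end

/-! ### Compactness of USp(6) and holomorphic extension of matrix coefficients. -/

noncomputable section

/-- Square matrices of size six in block form. -/
abbrev Mat6 : Type := Matrix (Fin 3 ⊕ Fin 3) (Fin 3 ⊕ Fin 3) ℂ

/-- The underlying matrix of an element of `USp(6)`. -/
abbrev umat (g : USp6) : Mat6 := g.1.1

namespace USp6

theorem mat_mul (g h : USp6) : umat (g * h) = umat g * umat h := rfl

theorem mat_one : umat (1 : USp6) = 1 := rfl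

theorem continuous_mat : Continuous fun g : USp6 => umat g :=
  continuous_subtype_val.comp continuous_subtype_val

theorem mat_injective : Function.Injective fun g : USp6 => umat g := fun _ _ h =>
  Subtype.ext (Subtype.ext h)

theorem mat_mul_star (g : USp6) : umat g * star (umat g) = 1 :=
  Matrix.mem_unitaryGroup_iff.1 g.1.2

theorem star_mul_mat (g : USp6) : star (umat g) * umat g = 1 :=
  Matrix.mem_unitaryGroup_iff'.1 g.1.2

theorem mat_J (g : USp6) : umat g * Matrix.J (Fin 3) ℂ * (umat g).transpose = Matrix.J (Fin 3) ℂ :=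
  SymplecticGroup.mem_iff.1 g.2

/-- The element of `USp(6)` given by a matrix. -/
def ofMat (A : Mat6) (h1 : A * star A = 1)
    (h2 : A * Matrix.J (Fin 3) ℂ * A.transpose = Matrix.J (Fin 3) ℂ) : USp6 :=
  ⟨⟨A, Matrix.mem_unitaryGroup_iff.2 h1⟩, SymplecticGroup.mem_iff.2 h2⟩

end USp6

theorem J_mul_J : Matrix.J (Fin 3) ℂ * Matrix.J (Fin 3) ℂ = -1 := Matrix.J_squared _ _

theorem transpose_J : (Matrix.J (Fin 3) ℂ).transpose = -Matrix.J (Fin 3) ℂ :=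
  Matrix.J_transpose _ _

/-- Entrywise conjugation of a matrix in `USp(6)` is conjugation by `J`. -/
theorem USp6.map_star_mat (g : USp6) :
    (umat g).map star = -(Matrix.J (Fin 3) ℂ * umat g * Matrix.J (Fin 3) ℂ) := by
  have h1 : (umat g).transpose * (umat g).map star = 1 := by
    have h := congrArg Matrix.transpose (star_mul_mat g)
    rw [Matrix.transpose_mul, Matrix.transpose_one] at h
    exact h
  have h2 := mat_J g
  calc (umat g).map star = -(Matrix.J (Fin 3) ℂ * Matrix.J (Fin 3) ℂ) * (umat g).map star := by
        rw [J_mul_J, neg_neg, one_mul]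
    _ = -(Matrix.J (Fin 3) ℂ * (umat g * Matrix.J (Fin 3) ℂ * (umat g).transpose)
          * (umat g).map star) := by rw [h2, neg_mul]
    _ = -(Matrix.J (Fin 3) ℂ * umat g * Matrix.J (Fin 3) ℂ
          * ((umat g).transpose * (umat g).map star)) := by simp only [Matrix.mul_assoc]
    _ = _ := by rw [h1, mul_one]

instance unitaryGroup_compactSpace {n : Type*} [Fintype n] [DecidableEq n] :
    CompactSpace (Matrix.unitaryGroup n ℂ) := by
  suffices hK : IsCompact ((Matrix.unitaryGroup n ℂ : Submonoid (Matrix n n ℂ)) :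
      Set (Matrix n n ℂ)) from isCompact_iff_compactSpace.1 hK
  have hb : IsCompact (Set.univ.pi fun _ : n => Set.univ.pi fun _ : n =>
      Metric.closedBall (0 : ℂ) 1) :=
    isCompact_univ_pi fun _ => isCompact_univ_pi fun _ => isCompact_closedBall _ _
  refine hb.of_isClosed_subset ?_ fun U hU i _ j _ => ?_
  · have h : ((Matrix.unitaryGroup n ℂ : Submonoid (Matrix n n ℂ)) : Set (Matrix n n ℂ))
        = {A : Matrix n n ℂ | A * star A = 1} := by
      ext A
      exact Matrix.mem_unitaryGroup_iff
    rw [h]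
    exact isClosed_eq (continuous_id.matrix_mul continuous_star) continuous_const
  · rw [mem_closedBall_zero_iff]
    exact entry_norm_bound_of_unitary hU i j

instance USp6.compactSpace : CompactSpace USp6 := by
  suffices hK : IsCompact (USp6 : Set (Matrix.unitaryGroup (Fin 3 ⊕ Fin 3) ℂ)) from
    isCompact_iff_compactSpace.1 hK
  refine IsClosed.isCompact ?_
  have h : (USp6 : Set (Matrix.unitaryGroup (Fin 3 ⊕ Fin 3) ℂ)) =
      {A | A.1 * Matrix.J (Fin 3) ℂ * A.1.transpose = Matrix.J (Fin 3) ℂ} := by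
    ext A
    exact SymplecticGroup.mem_iff
  rw [h]
  exact isClosed_eq ((continuous_subtype_val.mul continuous_const).mul
    continuous_subtype_val.matrix_transpose) continuous_const

attribute [local instance] Matrix.linftyOpNormedRing Matrix.linftyOpNormedAlgebra

/-- A function on `USp(6)` that extends to a holomorphic function of the matrix. -/
def ExtendsHolomorphically (f : USp6 → ℂ) : Prop :=
  ∃ F : Mat6 → ℂ, Differentiable ℂ F ∧ ∀ g : USp6, f g = F (umat g)

/-- The coordinate functions of `USp(6)`. -/
def coordFun (i j : Fin 3 ⊕ Fin 3) : C(USp6, ℂ) :=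
  ⟨fun g => umat g i j, (USp6.continuous_mat.matrix_elem i j)⟩

/-- The algebra generated by the coordinate functions. -/
def coordAlgebra : Subalgebra ℂ C(USp6, ℂ) :=
  Algebra.adjoin ℂ (Set.range fun p : (Fin 3 ⊕ Fin 3) × (Fin 3 ⊕ Fin 3) => coordFun p.1 p.2)

theorem coordFun_mem (i j : Fin 3 ⊕ Fin 3) : coordFun i j ∈ coordAlgebra :=
  Algebra.subset_adjoin ⟨(i, j), rfl⟩

theorem differentiable_entry (i j : Fin 3 ⊕ Fin 3) : Differentiable ℂ fun A : Mat6 => A i j := by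
  have h : (fun A : Mat6 => A i j) = fun A => LinearMap.toContinuousLinearMap
    (Matrix.entryLinearMap ℂ ℂ i j : Mat6 →ₗ[ℂ] ℂ) A := rfl
  rw [h]
  exact ContinuousLinearMap.differentiable _

theorem extendsHolomorphically_of_mem {p : C(USp6, ℂ)} (hp : p ∈ coordAlgebra) :
    ExtendsHolomorphically p := by
  refine Algebra.adjoin_induction ?_ ?_ ?_ ?_ hp
  · rintro _ ⟨⟨i, j⟩, rfl⟩
    exact ⟨fun A => A i j, differentiable_entry i j, fun g => rfl⟩
  · intro r
    exact ⟨fun _ => r, differentiable_const r, fun g => rfl⟩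
  · rintro x y - - ⟨F, hF, hx⟩ ⟨F', hF', hy⟩
    exact ⟨fun A => F A + F' A, hF.add hF', fun g => by simp [hx, hy]⟩
  · rintro x y - - ⟨F, hF, hx⟩ ⟨F', hF', hy⟩
    exact ⟨fun A => F A * F' A, hF.mul hF', fun g => by simp [hx, hy]⟩

/-- This is the comultiplication: an entry of xy is a sum of products of entries, and the property
passes to sums and products. Only the factors in x have to stay in the algebra for the later use. -/
theorem exists_decomposition_of_mem {p : C(USp6, ℂ)} (hp : p ∈ coordAlgebra) :
    ∃ (ι : Type) (_ : Fintype ι) (P Q : ι → C(USp6, ℂ)), (∀ i, P i ∈ coordAlgebra) ∧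
      ∀ x y, p (x * y) = ∑ i, P i x * Q i y := by
  refine Algebra.adjoin_induction ?_ ?_ ?_ ?_ hp
  · rintro _ ⟨⟨i, j⟩, rfl⟩
    refine ⟨Fin 3 ⊕ Fin 3, inferInstance, fun k => coordFun i k, fun k => coordFun k j,
      fun k => coordFun_mem i k, fun x y => ?_⟩
    simp only [coordFun, ContinuousMap.coe_mk, USp6.mat_mul, Matrix.mul_apply]
  · intro r
    exact ⟨Unit, inferInstance, fun _ => algebraMap ℂ _ r, fun _ => 1,
      fun _ => coordAlgebra.algebraMap_mem r, fun x y => by simp⟩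
  · rintro x y - - ⟨ι, _, P, Q, hP, hPQ⟩ ⟨ι', _, P', Q', hP', hPQ'⟩
    refine ⟨ι ⊕ ι', inferInstance, Sum.elim P P', Sum.elim Q Q', ?_, fun s t => ?_⟩
    · rintro (i | i)
      exacts [hP i, hP' i]
    · simp [hPQ, hPQ']
  · rintro x y - - ⟨ι, _, P, Q, hP, hPQ⟩ ⟨ι', _, P', Q', hP', hPQ'⟩
    refine ⟨ι × ι', inferInstance, fun k => P k.1 * P' k.2, fun k => Q k.1 * Q' k.2,
      fun k => coordAlgebra.mul_mem (hP _) (hP' _), fun s t => ?_⟩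
    simp only [ContinuousMap.mul_apply, hPQ, hPQ', Finset.sum_mul_sum, Fintype.sum_prod_type]
    refine Finset.sum_congr rfl fun i _ => Finset.sum_congr rfl fun j _ => by ring

/-- On USp(6) the conjugate of g is −JgJ, so conjugate entries are linear combinations of entries.
-/
theorem coordAlgebra_star_mem {p : C(USp6, ℂ)} (hp : p ∈ coordAlgebra) :
    star p ∈ coordAlgebra := by
  refine Algebra.adjoin_induction (p := fun x _ => star x ∈ coordAlgebra) ?_ ?_ ?_ ?_ hp
  · rintro _ ⟨⟨i, j⟩, rfl⟩
    have h : star (coordFun i j) = -∑ k, ∑ l, (Matrix.J (Fin 3) ℂ i l * Matrix.J (Fin 3) ℂ k j) •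
        coordFun l k := by
      ext g
      have h1 := congrFun (congrFun (USp6.map_star_mat g) i) j
      simp only [Matrix.map_apply, Matrix.neg_apply, Matrix.mul_apply] at h1
      simp only [coordFun, ContinuousMap.star_apply, ContinuousMap.coe_mk, h1,
        ContinuousMap.neg_apply, ContinuousMap.sum_apply, ContinuousMap.smul_apply, smul_eq_mul,
        Finset.sum_mul]
      congr 1
      refine Finset.sum_congr rfl fun k _ => Finset.sum_congr rfl fun l _ => by ring
    change star (coordFun i j) ∈ coordAlgebra
    rw [h]
    exact coordAlgebra.neg_mem (coordAlgebra.sum_mem fun k _ => coordAlgebra.sum_mem fun l _ =>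
      coordAlgebra.smul_mem (coordFun_mem l k) _)
  · intro r
    rw [← algebraMap_star_comm]
    exact coordAlgebra.algebraMap_mem _
  · intro x y _ _ hx hy
    rw [star_add]
    exact coordAlgebra.add_mem hx hy
  · intro x y _ _ hx hy
    rw [star_mul]
    exact coordAlgebra.mul_mem hy hx

/-- Stone–Weierstrass: the algebra is closed under conjugation, and the entries separate points. -/
theorem coordAlgebra_dense (q : C(USp6, ℂ)) : q ∈ closure (coordAlgebra : Set C(USp6, ℂ)) := by
  let A : StarSubalgebra ℂ C(USp6, ℂ) :=
    { coordAlgebra with star_mem' := coordAlgebra_star_mem }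
  have hA : A.SeparatesPoints := by
    intro g h hgh
    have h1 : ∃ i j, umat g i j ≠ umat h i j := by
      by_contra! hc
      exact hgh (USp6.mat_injective (Matrix.ext hc))
    obtain ⟨i, j, hij⟩ := h1
    exact ⟨coordFun i j, ⟨coordFun i j, coordFun_mem i j, rfl⟩, hij⟩
  have h := ContinuousMap.starSubalgebra_topologicalClosure_eq_top_of_separatesPoints A hA
  have h2 : q ∈ A.topologicalClosure := by
    rw [h]
    trivial
  exact h2

open MeasureTheory in
/-- The matrix coefficients of a continuous finite-dimensional representation of `USp(6)` extend
to holomorphic functions of the matrix entries. -/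
theorem matrixCoeff_extendsHolomorphically {V : Type*} [AddCommGroup V] [Module ℂ V]
    [FiniteDimensional ℂ V] (ρ : Representation ℂ USp6 V) (hcont : IsContinuousRep ρ)
    (ψ : Module.Dual ℂ V) (w : V) : ExtendsHolomorphically fun g => ψ (ρ g w) := by
  -- The good functionals form a subspace W of the dual. It suffices that every vector v0
  -- annihilated by W is zero.
  let W : Submodule ℂ (Module.Dual ℂ V) :=
    { carrier := {ψ | ∀ w, ExtendsHolomorphically fun g => ψ (ρ g w)}
      zero_mem' := fun w => ⟨fun _ => 0, differentiable_const _, fun g => rfl⟩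
      add_mem' := fun {ψ φ} h1 h2 w => by
        obtain ⟨F, hF, h3⟩ := h1 w
        obtain ⟨F', hF', h4⟩ := h2 w
        exact ⟨fun A => F A + F' A, hF.add hF', fun g => by simp [h3, h4]⟩
      smul_mem' := fun c ψ h w => by
        obtain ⟨F, hF, h3⟩ := h w
        exact ⟨fun A => c * F A, hF.const_mul c, fun g => by simp [h3]⟩ }
  suffices hW : W = ⊤ by
    have h : ψ ∈ W := by rw [hW]; trivial
    exact h w
  rw [← Subspace.dualCoannihilator_dualAnnihilator_eq (W := W)]
  rw [eq_top_iff]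
  intro φ _
  rw [Submodule.mem_dualAnnihilator]
  intro v0 hv0
  rw [Submodule.mem_dualCoannihilator] at hv0
  suffices h0 : v0 = 0 by rw [h0, map_zero]
  refine eq_of_forall_dual_eq fun ℓ => ?_
  let _ : MeasurableSpace USp6 := borel USp6
  have : BorelSpace USp6 := ⟨rfl⟩
  let m : Measure USp6 := Measure.haarMeasure ⊤
  have : IsProbabilityMeasure m := ⟨by
    simpa using Measure.haarMeasure_self (G := USp6) (K₀ := ⊤)⟩
  have hint : ∀ {f : USp6 → ℂ}, Continuous f → Integrable f m := fun hf =>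
    hf.integrable_of_hasCompactSupport (HasCompactSupport.of_compactSpace _)
  have hc' : ∀ w, Continuous fun h => ℓ (ρ h⁻¹ w) := fun w => (hcont ℓ w).comp continuous_inv
  -- Smoothing ℓ by a polynomial function p puts it in W: after substituting xh for h, the
  -- dependence on x sits entirely in p(xh), which splits into polynomial functions of x.
  have key : ∀ p ∈ coordAlgebra, ∫ h, p h * ℓ (ρ h⁻¹ v0) ∂m = 0 := by
    intro p hp
    obtain ⟨P, hP⟩ := exists_weak_integral m (fun h => p h • ρ h⁻¹) fun φ w => by
      simp only [LinearMap.smul_apply, map_smul, smul_eq_mul]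
      exact p.continuous.mul ((hcont φ w).comp continuous_inv)
    have hmem : ℓ ∘ₗ P ∈ W := by
      intro w
      obtain ⟨ι, _, p1, q, hp1, hpq⟩ := exists_decomposition_of_mem hp
      have h1 : ∀ x, (ℓ ∘ₗ P) (ρ x w) = ∑ i, (∫ h, q i h * ℓ (ρ h⁻¹ w) ∂m) * p1 i x := by
        intro x
        rw [LinearMap.comp_apply, hP]
        rw [← integral_mul_left_eq_self (fun h => ℓ ((p h • ρ h⁻¹) (ρ x w))) x]
        have h2 : ∀ h, ℓ ((p (x * h) • ρ (x * h)⁻¹) (ρ x w))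
            = ∑ i, q i h * ℓ (ρ h⁻¹ w) * p1 i x := by
          intro h
          rw [LinearMap.smul_apply, map_smul, ← Module.End.mul_apply, ← map_mul, hpq,
            mul_inv_rev, inv_mul_cancel_right, smul_eq_mul, Finset.sum_mul]
          exact Finset.sum_congr rfl fun i _ => by ring
        simp only [h2]
        have h3 : ∀ i, Integrable (fun h => q i h * ℓ (ρ h⁻¹ w) * p1 i x) m := fun i =>
          hint (((q i).continuous.mul (hc' w)).mul continuous_const)
        rw [integral_finsetSum _ fun i _ => h3 i]
        simp only [integral_mul_const]
      choose F hF hF' using fun i => extendsHolomorphically_of_mem (hp1 i)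
      refine ⟨fun A => ∑ i, (∫ h, q i h * ℓ (ρ h⁻¹ w) ∂m) * F i A,
        Differentiable.fun_sum fun i _ => (hF i).const_mul _, fun g => ?_⟩
      refine (h1 g).trans ?_
      simp only [hF']
    have h2 := hv0 _ hmem
    rw [LinearMap.comp_apply, hP] at h2
    simpa using h2
  let f : C(USp6, ℂ) := ⟨fun h => ℓ (ρ h⁻¹ v0), hc' v0⟩
  -- The function f is orthogonal to all polynomial functions; approximating its conjugate by them
  -- gives ∫|f|² = 0, hence f(1) = ℓ(v0) = 0.
  have h0 : ∫ h, (star f) h * f h ∂m = 0 := by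
    by_contra hne
    have hpos : 0 < ‖∫ h, (star f) h * f h ∂m‖ := norm_pos_iff.2 hne
    have hd : 0 < ‖f‖ + 1 := by positivity
    obtain ⟨p, hp, hpd⟩ := Metric.mem_closure_iff.1 (coordAlgebra_dense (star f))
      (‖∫ h, (star f) h * f h ∂m‖ / (‖f‖ + 1)) (by positivity)
    have h1 : ∫ h, (star f) h * f h ∂m = ∫ h, (star f - p) h * f h ∂m := by
      have h2 : ∀ h, (star f - p) h * f h = (star f) h * f h - p h * f h := fun h => by
        rw [ContinuousMap.sub_apply, sub_mul]
      simp only [h2]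
      have h5 : Integrable (fun h => (star f) h * f h) m :=
        hint ((star f).continuous.mul f.continuous)
      have h6 : Integrable (fun h => p h * f h) m := hint (p.continuous.mul f.continuous)
      have h3 : ∫ h, p h * f h ∂m = 0 := key p hp
      rw [integral_sub h5 h6]
      rw [h3, sub_zero]
    have h4 : ‖∫ h, (star f - p) h * f h ∂m‖ ≤ ‖star f - p‖ * ‖f‖ := by
      refine (norm_integral_le_of_norm_le_const (C := ‖star f - p‖ * ‖f‖)
        (Filter.Eventually.of_forall fun h => ?_)).trans (by simp)
      rw [norm_mul]
      exact mul_le_mul (ContinuousMap.norm_coe_le_norm _ h) (ContinuousMap.norm_coe_le_norm _ h)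
        (norm_nonneg _) (norm_nonneg _)
    rw [dist_eq_norm, lt_div_iff₀ hd] at hpd
    rw [← h1] at h4
    nlinarith [norm_nonneg (star f - p), norm_nonneg f]
  rw [map_zero]
  by_contra hne
  have h1 : ∀ h, (star f) h * f h = ((‖f h‖ ^ 2 : ℝ) : ℂ) := fun h => by
    rw [ContinuousMap.star_apply, Complex.star_def, mul_comm, Complex.mul_conj,
      Complex.normSq_eq_norm_sq]
  simp only [h1] at h0
  rw [integral_complex_ofReal] at h0
  have hpos : 0 < ∫ h, ‖f h‖ ^ 2 ∂m := by
    refine Continuous.integral_pos_of_hasCompactSupport_nonneg_nonzero (x := 1)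
      (f.continuous.norm.pow 2) (HasCompactSupport.of_compactSpace _)
      (fun h => by positivity) ?_
    have : f 1 = ℓ v0 := by
      change ℓ (ρ 1⁻¹ v0) = ℓ v0
      simp
    rw [this]
    simpa using hne
  exact hpos.ne' (by exact_mod_cast h0)

end

/-! ### The Lie algebra sp(6, ℂ), its compact form and the exponential. -/

noncomputable section
open NormedSpace

/-- The complex symplectic Lie algebra `sp(6, ℂ)`, as a space of matrices. -/
def sp6 : Submodule ℂ Mat6 where
  carrier := {X | X * Matrix.J (Fin 3) ℂ + Matrix.J (Fin 3) ℂ * X.transpose = 0}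
  zero_mem' := by simp
  add_mem' := by
    intro X Y hX hY
    simp only [Set.mem_ofPred_eq] at *
    rw [Matrix.transpose_add, add_mul, mul_add, add_add_add_comm, hX, hY, add_zero]
  smul_mem' := by
    intro c X hX
    simp only [Set.mem_ofPred_eq] at *
    rw [Matrix.transpose_smul, Matrix.smul_mul, Matrix.mul_smul, ← smul_add, hX, smul_zero]

theorem mem_sp6_iff {X : Mat6} :
    X ∈ sp6 ↔ X * Matrix.J (Fin 3) ℂ + Matrix.J (Fin 3) ℂ * X.transpose = 0 := Iff.rfl

theorem mem_sp6_iff' {X : Mat6} :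
    X ∈ sp6 ↔ X.transpose = Matrix.J (Fin 3) ℂ * X * Matrix.J (Fin 3) ℂ := by
  rw [mem_sp6_iff]
  constructor
  · intro h
    have h1 := congrArg (fun M => Matrix.J (Fin 3) ℂ * M) h
    simp only [mul_add, mul_zero, ← mul_assoc, J_mul_J, neg_mul, one_mul] at h1
    rw [add_neg_eq_zero] at h1
    exact h1.symm
  · intro h
    rw [h]
    simp only [← mul_assoc, J_mul_J, neg_mul, one_mul, add_neg_cancel]

theorem fromBlocks_mem_sp6 {A B C D : Matrix (Fin 3) (Fin 3) ℂ} (hB : B.transpose = B)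
    (hC : C.transpose = C) (hD : D = -A.transpose) : Matrix.fromBlocks A B C D ∈ sp6 := by
  rw [mem_sp6_iff, Matrix.J, Matrix.fromBlocks_transpose, Matrix.fromBlocks_multiply,
    Matrix.fromBlocks_multiply, Matrix.fromBlocks_add, hB, hC, hD]
  simp

theorem blocks_of_mem_sp6 {X : Mat6} (hX : X ∈ sp6) :
    X.toBlocks₁₂.transpose = X.toBlocks₁₂ ∧ X.toBlocks₂₁.transpose = X.toBlocks₂₁ ∧
      X.toBlocks₂₂ = -X.toBlocks₁₁.transpose := by
  rw [← Matrix.fromBlocks_toBlocks X, mem_sp6_iff, Matrix.J, Matrix.fromBlocks_transpose,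
    Matrix.fromBlocks_multiply, Matrix.fromBlocks_multiply, Matrix.fromBlocks_add,
    ← Matrix.fromBlocks_zero, Matrix.fromBlocks_inj] at hX
  simp only [mul_zero, mul_one, zero_add, zero_mul, mul_neg, neg_mul, one_mul, add_zero] at hX
  obtain ⟨h1, h2, h3, h4⟩ := hX
  refine ⟨?_, ?_, ?_⟩
  · rw [add_neg_eq_zero] at h1
    exact h1.symm
  · rw [neg_add_eq_zero] at h4
    exact h4.symm
  · exact eq_neg_of_add_eq_zero_left h3

theorem star_mem_sp6 {X : Mat6} (hX : X ∈ sp6) : star X ∈ sp6 := by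
  rw [mem_sp6_iff'] at *
  have h := congrArg (fun M : Mat6 => M.map star) hX
  have hJ : (Matrix.J (Fin 3) ℂ).map star = Matrix.J (Fin 3) ℂ := by
    ext i j
    rcases i with i | i <;> rcases j with j | j <;> by_cases h : i = j <;>
      simp [Matrix.J, h]
  have hm : ∀ A B : Mat6, (A * B).map star = A.map star * B.map star := fun A B =>
    Matrix.map_mul (f := starRingEnd ℂ)
  simp only [hm, hJ] at h
  have h2 : star X = Matrix.J (Fin 3) ℂ * (star X).transpose * Matrix.J (Fin 3) ℂ := h
  calc (star X).transpose
      = (Matrix.J (Fin 3) ℂ * Matrix.J (Fin 3) ℂ) * (star X).transpose *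
          (Matrix.J (Fin 3) ℂ * Matrix.J (Fin 3) ℂ) := by rw [J_mul_J]; simp
    _ = Matrix.J (Fin 3) ℂ * (Matrix.J (Fin 3) ℂ * (star X).transpose * Matrix.J (Fin 3) ℂ) *
          Matrix.J (Fin 3) ℂ := by simp only [mul_assoc]
    _ = _ := by rw [← h2]

theorem commutator_mem_sp6 {X Y : Mat6} (hX : X ∈ sp6) (hY : Y ∈ sp6) :
    X * Y - Y * X ∈ sp6 := by
  rw [mem_sp6_iff'] at *
  rw [Matrix.transpose_sub, Matrix.transpose_mul, Matrix.transpose_mul, hX, hY]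
  have h : ∀ A B : Mat6, Matrix.J (Fin 3) ℂ * A * Matrix.J (Fin 3) ℂ *
      (Matrix.J (Fin 3) ℂ * B * Matrix.J (Fin 3) ℂ) =
      -(Matrix.J (Fin 3) ℂ * (A * B) * Matrix.J (Fin 3) ℂ) := fun A B => by
    calc _ = Matrix.J (Fin 3) ℂ * A * (Matrix.J (Fin 3) ℂ * Matrix.J (Fin 3) ℂ) *
        (B * Matrix.J (Fin 3) ℂ) := by simp only [mul_assoc]
      _ = _ := by rw [J_mul_J]; simp only [mul_assoc, mul_neg, neg_mul, one_mul]
  rw [h, h, mul_sub, sub_mul]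
  abel

/-- The skew-Hermitian part of `sp(6, ℂ)`, the Lie algebra of `USp(6)`. -/
def IsCompactLie (X : Mat6) : Prop := X ∈ sp6 ∧ star X = -X

/-- The splitting into skew-Hermitian and Hermitian parts stays inside sp(6, ℂ). It lets
complex-linear identities be checked on the compact form alone, where exponentials lie in USp(6). -/
theorem exists_compact_decomposition {X : Mat6} (hX : X ∈ sp6) :
    ∃ Y Z, IsCompactLie Y ∧ IsCompactLie Z ∧ X = Y + Complex.I • Z := by
  refine ⟨(1 / 2 : ℂ) • (X - star X), (-Complex.I / 2) • (X + star X), ⟨?_, ?_⟩, ⟨?_, ?_⟩, ?_⟩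
  · exact sp6.smul_mem _ (sp6.sub_mem hX (star_mem_sp6 hX))
  · rw [star_smul, star_sub, star_star, ← smul_neg, neg_sub]
    simp
  · exact sp6.smul_mem _ (sp6.add_mem hX (star_mem_sp6 hX))
  · rw [star_smul, star_add, star_star, add_comm (star X), ← neg_smul]
    congr 1
    simp [neg_div]
  · rw [smul_smul]
    have h : Complex.I * (-Complex.I / 2) = 1 / 2 := by
      rw [mul_div_assoc', mul_neg, Complex.I_mul_I]
      norm_num
    rw [h, ← smul_add]
    have h2 : X - star X + (X + star X) = (2 : ℂ) • X := by
      rw [two_smul]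
      abel
    rw [h2, smul_smul]
    norm_num

theorem IsCompactLie.smul {X : Mat6} (hX : IsCompactLie X) (r : ℝ) :
    IsCompactLie (r • X) := by
  have h : r • X = (r : ℂ) • X := by
    ext i j
    simp
  refine ⟨?_, ?_⟩
  · rw [h]
    exact sp6.smul_mem _ hX.1
  · rw [star_smul, hX.2, smul_neg]
    simp

theorem IsCompactLie.neg {X : Mat6} (hX : IsCompactLie X) : IsCompactLie (-X) := by
  have h := hX.smul (-1)
  rwa [neg_smul, one_smul] at h

attribute [local instance] Matrix.linftyOpNormedRing Matrix.linftyOpNormedAlgebra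

theorem matrix_exp_mul_exp_neg (X : Mat6) : exp X * exp (-X) = 1 := by
  rw [← Matrix.exp_add_of_commute _ _ ((Commute.refl X).neg_right), add_neg_cancel, exp_zero]

/-- The exponential of an element of the Lie algebra of `USp(6)`. -/
def expUSp6 (X : Mat6) (hX : IsCompactLie X) : USp6 :=
  USp6.ofMat (exp X)
    (by
      rw [Matrix.star_eq_conjTranspose, ← Matrix.exp_conjTranspose,
        ← Matrix.star_eq_conjTranspose, hX.2, matrix_exp_mul_exp_neg])
    (by
      have hJ : IsUnit (Matrix.J (Fin 3) ℂ) :=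
        IsUnit.of_mul_eq_one (-Matrix.J (Fin 3) ℂ) (by rw [mul_neg, J_mul_J, neg_neg])
      have hJi : (Matrix.J (Fin 3) ℂ)⁻¹ = -Matrix.J (Fin 3) ℂ :=
        Matrix.inv_eq_right_inv (by rw [mul_neg, J_mul_J, neg_neg])
      have h1 : X.transpose = Matrix.J (Fin 3) ℂ * (-X) * (Matrix.J (Fin 3) ℂ)⁻¹ := by
        rw [mem_sp6_iff'.1 hX.1, hJi, mul_neg, mul_neg, neg_mul, neg_neg]
      rw [← Matrix.exp_transpose, h1, Matrix.exp_conj _ _ hJ, hJi]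
      calc exp X * Matrix.J (Fin 3) ℂ * (Matrix.J (Fin 3) ℂ * exp (-X) * -Matrix.J (Fin 3) ℂ)
          = exp X * (Matrix.J (Fin 3) ℂ * Matrix.J (Fin 3) ℂ) * exp (-X) * -Matrix.J (Fin 3) ℂ := by
            simp only [mul_assoc]
        _ = exp X * exp (-X) * Matrix.J (Fin 3) ℂ := by
            rw [J_mul_J]
            simp only [mul_neg, neg_mul, neg_neg, mul_one]
        _ = _ := by rw [matrix_exp_mul_exp_neg, one_mul])

theorem umat_expUSp6 (X : Mat6) (hX : IsCompactLie X) : umat (expUSp6 X hX) = exp X := rfl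

theorem exp_mulVec_of_eigenvector {A : Mat6} {u : Fin 3 ⊕ Fin 3 → ℂ} {μ : ℂ}
    (h : A.mulVec u = μ • u) : (exp A).mulVec u = Complex.exp μ • u := by
  have h1 : ∀ n : ℕ, (A ^ n).mulVec u = μ ^ n • u := by
    intro n
    induction n with
    | zero => simp
    | succ n ih =>
      rw [pow_succ, ← Matrix.mulVec_mulVec, h, Matrix.mulVec_smul, ih, smul_smul, pow_succ,
        mul_comm]
  have h2 := (exp_series_hasSum_exp' (𝕂 := ℂ) A).map
    (LinearMap.flip (Matrix.mulVecBilin ℂ ℂ) u : Mat6 →ₗ[ℂ] _)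
    (LinearMap.continuous_of_finiteDimensional _)
  have h3 := (exp_series_hasSum_exp' (𝕂 := ℂ) μ).smul_const u
  rw [Complex.exp_eq_exp_ℂ]
  refine h2.unique ?_
  convert h3 using 1
  funext n
  simp [h1, smul_smul]

theorem hasDerivAt_exp_smul_zero (X : Mat6) :
    HasDerivAt (fun s : ℝ => exp (s • X)) X 0 := by
  have h := hasDerivAt_exp_smul_const (𝕂 := ℝ) X 0
  simp only [zero_smul, exp_zero, one_mul] at h
  exact h

end

/-! ### USp(6) is generated by exponentials. -/

noncomputable section
open NormedSpace Matrix

theorem mulVec_dotProduct_star {g : USp6} (u w : Fin 3 ⊕ Fin 3 → ℂ) :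
    star (umat g *ᵥ u) ⬝ᵥ (umat g *ᵥ w) = star u ⬝ᵥ w := by
  rw [star_mulVec, ← dotProduct_mulVec, mulVec_mulVec]
  have h := USp6.star_mul_mat g
  rw [star_eq_conjTranspose] at h
  rw [h, one_mulVec]

theorem star_J_mulVec (x : Fin 3 ⊕ Fin 3 → ℂ) :
    star (Matrix.J (Fin 3) ℂ *ᵥ star x) = Matrix.J (Fin 3) ℂ *ᵥ x := by
  ext i
  rcases i with i | i <;>
    simp [Matrix.J, fromBlocks_mulVec, neg_mulVec]

theorem J_mulVec_dotProduct_self (x : Fin 3 ⊕ Fin 3 → ℂ) :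
    (Matrix.J (Fin 3) ℂ *ᵥ x) ⬝ᵥ x = 0 := by
  have h : (Matrix.J (Fin 3) ℂ *ᵥ x) ⬝ᵥ x = -((Matrix.J (Fin 3) ℂ *ᵥ x) ⬝ᵥ x) := by
    conv_lhs => rw [dotProduct_comm, dotProduct_mulVec, ← mulVec_transpose, transpose_J,
      neg_mulVec, neg_dotProduct]
  exact self_eq_neg.1 h

/-- The infinitesimal rotation attached to a vector `x`, acting by `i` on `x` and by `-i`
on `J x̄`. -/
def rotationGenerator (x : Fin 3 ⊕ Fin 3 → ℂ) : Mat6 :=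
  Complex.I • (vecMulVec x (star x) -
    vecMulVec (Matrix.J (Fin 3) ℂ *ᵥ star x) (Matrix.J (Fin 3) ℂ *ᵥ x))

theorem rotationGenerator_isCompactLie (x : Fin 3 ⊕ Fin 3 → ℂ) :
    IsCompactLie (rotationGenerator x) := by
  have hJJ : ∀ z : Fin 3 ⊕ Fin 3 → ℂ, Matrix.J (Fin 3) ℂ *ᵥ (Matrix.J (Fin 3) ℂ *ᵥ z) = -z := by
    intro z
    rw [mulVec_mulVec, J_mul_J, neg_mulVec, one_mulVec]
  constructor
  · refine sp6.smul_mem _ ?_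
    rw [mem_sp6_iff, transpose_sub, transpose_vecMulVec, transpose_vecMulVec, sub_mul, mul_sub,
      vecMulVec_mul, vecMulVec_mul, mul_vecMulVec, mul_vecMulVec]
    have h : ∀ z : Fin 3 ⊕ Fin 3 → ℂ, z ᵥ* Matrix.J (Fin 3) ℂ = -(Matrix.J (Fin 3) ℂ *ᵥ z) := by
      intro z
      rw [← mulVec_transpose, transpose_J, neg_mulVec]
    rw [h, h, hJJ]
    simp only [vecMulVec_neg, neg_vecMulVec, neg_neg]
    abel
  · rw [rotationGenerator, star_smul, star_sub, star_eq_conjTranspose, star_eq_conjTranspose,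
      conjTranspose_vecMulVec, conjTranspose_vecMulVec, star_star, star_J_mulVec]
    rw [← star_J_mulVec x, star_star]
    rw [← neg_smul]
    simp

theorem rotationGenerator_mulVec (x z : Fin 3 ⊕ Fin 3 → ℂ) :
    rotationGenerator x *ᵥ z = Complex.I • ((star x ⬝ᵥ z) • x -
      ((Matrix.J (Fin 3) ℂ *ᵥ x) ⬝ᵥ z) • (Matrix.J (Fin 3) ℂ *ᵥ star x)) := by
  rw [rotationGenerator, smul_mulVec, sub_mulVec, vecMulVec_mulVec, vecMulVec_mulVec]
  simp

/-- The space of vectors fixed by an element of `USp(6)`. -/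
def fixedSpace (g : USp6) : Submodule ℂ (Fin 3 ⊕ Fin 3 → ℂ) where
  carrier := {z | umat g *ᵥ z = z}
  zero_mem' := mulVec_zero _
  add_mem' := fun {a b} ha hb => by
    simp only [Set.mem_ofPred_eq] at *
    rw [mulVec_add, ha, hb]
  smul_mem' := fun c a ha => by
    simp only [Set.mem_ofPred_eq] at *
    rw [mulVec_smul, ha]

theorem mem_fixedSpace {g : USp6} {z : Fin 3 ⊕ Fin 3 → ℂ} :
    z ∈ fixedSpace g ↔ umat g *ᵥ z = z := Iff.rfl

-- For unitary g the range of g − 1 is stable under g and orthogonal to the fixed vectors, so an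
-- eigenvector found inside it cannot have eigenvalue 1.
open scoped ComplexOrder in
theorem exists_eigenvector_of_ne_one {g : USp6} (hg : g ≠ 1) :
    ∃ (x : Fin 3 ⊕ Fin 3 → ℂ) (μ : ℂ), x ≠ 0 ∧ μ ≠ 1 ∧ umat g *ᵥ x = μ • x := by
  let T : (Fin 3 ⊕ Fin 3 → ℂ) →ₗ[ℂ] (Fin 3 ⊕ Fin 3 → ℂ) := Matrix.toLin' (umat g)
  let R := LinearMap.range (T - 1)
  have hT : ∀ z, T z = umat g *ᵥ z := fun z => Matrix.toLin'_apply _ _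
  have hR : ∀ z ∈ R, T z ∈ R := by
    rintro _ ⟨y, rfl⟩
    exact ⟨T y, by simp⟩
  have hne : Nontrivial R := by
    rw [Submodule.nontrivial_iff_ne_bot]
    intro h
    rw [LinearMap.range_eq_bot, sub_eq_zero] at h
    refine hg (USp6.mat_injective ?_)
    have h2 : Matrix.toLin' (umat g) = Matrix.toLin' (1 : Mat6) := by
      rw [Matrix.toLin'_one]
      exact h
    exact Matrix.toLin'.injective h2
  obtain ⟨μ, hμ⟩ := Module.End.exists_eigenvalue (LinearMap.restrict T hR)
  obtain ⟨⟨x, hx⟩, hx1⟩ := hμ.exists_hasEigenvector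
  have hxe : umat g *ᵥ x = μ • x := by
    have h := congrArg Subtype.val hx1.apply_eq_smul
    simpa [hT] using h
  have hx0 : x ≠ 0 := fun h => hx1.2 (Subtype.ext h)
  refine ⟨x, μ, hx0, ?_, hxe⟩
  rintro rfl
  rw [one_smul] at hxe
  obtain ⟨y, hy⟩ := hx
  have hy' : umat g *ᵥ y - y = x := by
    rw [← hT]
    simpa using hy
  apply hx0
  have h0 : star x ⬝ᵥ x = 0 := by
    have h1 : star x ⬝ᵥ x = star x ⬝ᵥ (umat g *ᵥ y - y) := by rw [hy']
    rw [h1, dotProduct_sub, sub_eq_zero, ← mulVec_dotProduct_star (g := g) x y, hxe]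
  exact dotProduct_star_self_eq_zero.1 h0

theorem finrank_fixedSpace_le (g : USp6) : Module.finrank ℂ (fixedSpace g) ≤ 6 := by
  refine (Submodule.finrank_le _).trans ?_
  simp

/-- `USp(6)` is generated by the exponentials of its Lie algebra. -/
theorem closure_exp_eq_top :
    Subgroup.closure {g : USp6 | ∃ X, ∃ hX : IsCompactLie X, g = expUSp6 X hX} = ⊤ := by
  -- Induction on the codimension of the fixed space: multiplying g by one suitable exponential
  -- enlarges that space.
  suffices h : ∀ n : ℕ, ∀ g : USp6, 6 - Module.finrank ℂ (fixedSpace g) ≤ n →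
      g ∈ Subgroup.closure {g : USp6 | ∃ X, ∃ hX : IsCompactLie X, g = expUSp6 X hX} by
    rw [Subgroup.eq_top_iff']
    exact fun g => h _ g le_rfl
  intro n
  induction n with
  | zero =>
    intro g hg
    have h6 : Module.finrank ℂ (fixedSpace g) = 6 := by
      have := finrank_fixedSpace_le g
      omega
    have htop : fixedSpace g = ⊤ := Submodule.eq_top_of_finrank_eq (by rw [h6]; simp)
    by_cases h1 : g = 1
    · rw [h1]
      exact Subgroup.one_mem _
    · exfalso
      obtain ⟨x, μ, hx, hμ, he⟩ := exists_eigenvector_of_ne_one h1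
      have hx2 : x ∈ fixedSpace g := by rw [htop]; trivial
      rw [mem_fixedSpace, he] at hx2
      have h3 : (μ - 1) • x = 0 := by rw [sub_smul, hx2, one_smul, sub_self]
      rcases smul_eq_zero.1 h3 with h3 | h3
      · exact hμ (sub_eq_zero.1 h3)
      · exact hx h3
  | succ n ih =>
    intro g hg
    by_cases h1 : g = 1
    · rw [h1]
      exact Subgroup.one_mem _
    obtain ⟨x, μ, hx, hμ, he⟩ := exists_eigenvector_of_ne_one h1
    have hpos : ∃ r : ℝ, r ≠ 0 ∧ star x ⬝ᵥ x = r := by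
      refine ⟨∑ i, ‖x i‖ ^ 2, ?_, ?_⟩
      · intro h0
        rw [Finset.sum_eq_zero_iff_of_nonneg fun i _ => by positivity] at h0
        exact hx (funext fun i => by simpa using h0 i (Finset.mem_univ i))
      · simp only [dotProduct, Pi.star_apply, Complex.star_def, Complex.conj_mul']
        push_cast
        rfl
    obtain ⟨r, hr, hxr⟩ := hpos
    have hμ1 : star μ * μ = 1 := by
      have h := mulVec_dotProduct_star (g := g) x x
      rw [he, star_smul, smul_dotProduct, dotProduct_smul, hxr, smul_eq_mul, smul_eq_mul,
        ← mul_assoc] at h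
      exact mul_right_cancel₀ (by exact_mod_cast hr) (h.trans (one_mul _).symm)
    have hnorm : ‖μ‖ = 1 := by
      have h : ((‖μ‖ ^ 2 : ℝ) : ℂ) = 1 := by
        rw [Complex.star_def, Complex.conj_mul'] at hμ1
        exact_mod_cast hμ1
      have h2 : ‖μ‖ ^ 2 = 1 := by exact_mod_cast h
      nlinarith [norm_nonneg μ]
    obtain ⟨θ, hθ⟩ := (Complex.norm_eq_one_iff μ).1 hnorm
    -- The generator sends x to i r x with r = |x|², so this multiple sends x to −iθx and its
    -- exponential undoes the eigenvalue μ = e^{iθ}.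
    let Y : Mat6 := (-θ / r) • rotationGenerator x
    have hY : IsCompactLie Y := (rotationGenerator_isCompactLie x).smul _
    have hYv : ∀ z, Y *ᵥ z = ((-θ / r : ℝ) : ℂ) • rotationGenerator x *ᵥ z := by
      intro z
      rw [← smul_mulVec]
      congr 1
    have hYx : Y *ᵥ x = (-(θ * Complex.I)) • x := by
      rw [hYv, rotationGenerator_mulVec, hxr, J_mulVec_dotProduct_self, zero_smul, sub_zero,
        smul_smul, smul_smul]
      congr 1
      push_cast
      have : (r : ℂ) ≠ 0 := by exact_mod_cast hr
      field_simp
    have hYz : ∀ z ∈ fixedSpace g, Y *ᵥ z = (0 : ℂ) • z := by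
      intro z hz
      rw [mem_fixedSpace] at hz
      have ho : ∀ (u : Fin 3 ⊕ Fin 3 → ℂ) (ν : ℂ), ν ≠ 1 → umat g *ᵥ u = ν • u →
          star u ⬝ᵥ z = 0 := by
        intro u ν hν hu
        have h := mulVec_dotProduct_star (g := g) u z
        rw [hu, hz, star_smul, smul_dotProduct, smul_eq_mul] at h
        have h2 : (star ν - 1) * (star u ⬝ᵥ z) = 0 := by rw [sub_mul, h, one_mul, sub_self]
        rcases mul_eq_zero.1 h2 with h2 | h2
        · exact absurd (star_injective (by rw [sub_eq_zero.1 h2, star_one])) hν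
        · exact h2
      -- The quaternionic partner of x is an eigenvector with eigenvalue μ̄ ≠ 1. Fixed vectors of g
      -- are thus orthogonal to both x and its partner, and Y kills them.
      have hgy : umat g *ᵥ (Matrix.J (Fin 3) ℂ *ᵥ star x) =
          star μ • (Matrix.J (Fin 3) ℂ *ᵥ star x) := by
        have h1 : umat g * Matrix.J (Fin 3) ℂ = Matrix.J (Fin 3) ℂ * (umat g).map star := by
          rw [USp6.map_star_mat, mul_neg, ← mul_assoc, ← mul_assoc, J_mul_J]
          simp
        have h2 : (umat g).map star *ᵥ star x = star μ • star x := by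
          rw [← star_smul, ← he]
          ext i
          simp [mulVec, dotProduct]
        rw [mulVec_mulVec, h1, ← mulVec_mulVec, h2, mulVec_smul]
      have hz1 := ho x μ hμ he
      have hz2 := ho (Matrix.J (Fin 3) ℂ *ᵥ star x) (star μ)
        (fun h => hμ (star_injective (by rw [h, star_one]))) hgy
      rw [star_J_mulVec] at hz2
      rw [hYv, rotationGenerator_mulVec, hz1, hz2]
      simp
    have hfix : fixedSpace g < fixedSpace (g * expUSp6 Y hY) := by
      rw [SetLike.lt_iff_le_and_exists]
      refine ⟨fun z hz => ?_, x, ?_, fun hxg => ?_⟩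
      · rw [mem_fixedSpace, USp6.mat_mul, umat_expUSp6, ← mulVec_mulVec,
          exp_mulVec_of_eigenvector (hYz z hz), Complex.exp_zero, one_smul]
        exact hz
      · rw [mem_fixedSpace, USp6.mat_mul, umat_expUSp6, ← mulVec_mulVec,
          exp_mulVec_of_eigenvector hYx, mulVec_smul, he, smul_smul, ← hθ, ← Complex.exp_add]
        simp
      · rw [mem_fixedSpace, he] at hxg
        have h3 : (μ - 1) • x = 0 := by rw [sub_smul, hxg, one_smul, sub_self]
        rcases smul_eq_zero.1 h3 with h3 | h3
        · exact hμ (sub_eq_zero.1 h3)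
        · exact hx h3
    have hlt := Submodule.finrank_lt_finrank_of_lt hfix
    have h6 := finrank_fixedSpace_le (g * expUSp6 Y hY)
    have hmem := ih (g * expUSp6 Y hY) (by omega)
    have h2 : expUSp6 Y hY ∈ Subgroup.closure
        {g : USp6 | ∃ X, ∃ hX : IsCompactLie X, g = expUSp6 X hX} :=
      Subgroup.subset_closure ⟨Y, hY, rfl⟩
    have h3 := Subgroup.mul_mem _ hmem (Subgroup.inv_mem _ h2)
    rwa [mul_inv_cancel_right] at h3

end

/-! ### The derivative of a representation. -/

noncomputable section
open NormedSpace

attribute [local instance] Matrix.linftyOpNormedRing Matrix.linftyOpNormedAlgebra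

theorem hasDerivAt_comp_curve {F : Mat6 → ℂ} (hF : Differentiable ℂ F) {γ : ℝ → Mat6} {X : Mat6}
    {s : ℝ} (hγ : HasDerivAt γ X s) :
    HasDerivAt (fun s => F (γ s)) (fderiv ℂ F (γ s) X) s :=
  HasFDerivAt.comp_hasDerivAt (F := Mat6) s
    ((hF (γ s)).hasFDerivAt.restrictScalars ℝ) hγ

theorem hasDerivAt_linear_comp_curve (φ : Mat6 →ₗ[ℂ] ℂ) {γ : ℝ → Mat6} {X : Mat6} {s : ℝ}
    (hγ : HasDerivAt γ X s) : HasDerivAt (fun s => φ (γ s)) (φ X) s := by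
  have h : Differentiable ℂ (fun A => φ A) :=
    (LinearMap.toContinuousLinearMap φ).differentiable
  have h2 := hasDerivAt_comp_curve h hγ
  have h3 : fderiv ℂ (fun A => φ A) (γ s) = LinearMap.toContinuousLinearMap φ :=
    (LinearMap.toContinuousLinearMap φ).fderiv
  rw [h3] at h2
  exact h2

theorem hasDerivAt_mul_curve_mul (A B : Mat6) {γ : ℝ → Mat6} {X : Mat6} {s : ℝ}
    (hγ : HasDerivAt γ X s) : HasDerivAt (fun s => A * γ s * B) (A * X * B) s :=
  (hγ.const_mul A).mul_const B

theorem hasDerivAt_exp_conj (Y X : Mat6) :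
    HasDerivAt (fun s : ℝ => exp (s • Y) * X * exp (-(s • Y))) (Y * X - X * Y) 0 := by
  have h1 : HasDerivAt (fun s : ℝ => exp (s • Y)) Y 0 := hasDerivAt_exp_smul_zero Y
  have h2 : HasDerivAt (fun s : ℝ => exp (s • (-Y))) (-Y) 0 := hasDerivAt_exp_smul_zero (-Y)
  have h3 := (h1.mul_const X).mul h2
  simp only [zero_smul, exp_zero, one_mul, mul_one, mul_neg, ← sub_eq_add_neg, smul_neg,
    neg_zero] at h3
  exact h3

variable {V : Type*} [AddCommGroup V] [Module ℂ V]

/-- `L` is the complexified derivative at the identity of the representation `ρ`. -/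
def IsInfinitesimal (ρ : Representation ℂ USp6 V) (L : Mat6 →ₗ[ℂ] Module.End ℂ V) : Prop :=
  ∀ (γ : ℝ → USp6) (X : Mat6), γ 0 = 1 → HasDerivAt (fun s => umat (γ s)) X 0 →
    ∀ (ψ : Module.Dual ℂ V) (w : V), HasDerivAt (fun s => ψ (ρ (γ s) w)) (ψ (L X w)) 0

/-- The complex derivatives at 1 of holomorphic extensions of the matrix coefficients assemble to L.
This makes L complex-linear on all matrices from the start; its values off sp(6, ℂ) depend on the
chosen extensions and are irrelevant. -/
theorem exists_isInfinitesimal [FiniteDimensional ℂ V] (ρ : Representation ℂ USp6 V)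
    (hcont : IsContinuousRep ρ) : ∃ L, IsInfinitesimal ρ L := by
  let b := Module.finBasis ℂ V
  choose F hF hFρ using fun i j =>
    matrixCoeff_extendsHolomorphically ρ hcont (b.coord i) (b j)
  refine ⟨∑ i, ∑ j, (fderiv ℂ (F i j) 1).toLinearMap.smulRight
    ((b.coord j).smulRight (b i)), fun γ X hγ0 hγ ψ w => ?_⟩
  have h1 : ∀ g, ψ (ρ g w) = ∑ i, ∑ j, F i j (umat g) * (b.coord j w * ψ (b i)) := by
    intro g
    have h2 : ρ g w = ∑ j, b.coord j w • ρ g (b j) := by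
      conv_lhs => rw [← b.sum_repr w]
      simp only [map_sum, map_smul, Module.Basis.coord_apply]
    have h3 : ∀ j, ψ (ρ g (b j)) = ∑ i, F i j (umat g) * ψ (b i) := by
      intro j
      conv_lhs => rw [← b.sum_repr (ρ g (b j))]
      simp only [map_sum, map_smul, smul_eq_mul, ← hFρ, Module.Basis.coord_apply]
    rw [h2, map_sum, Finset.sum_comm]
    refine Finset.sum_congr rfl fun j _ => ?_
    rw [map_smul, h3, smul_eq_mul, Finset.mul_sum]
    exact Finset.sum_congr rfl fun i _ => by ring
  simp only [h1]
  have h4 : ∀ i j, HasDerivAt (fun s => F i j (umat (γ s)) * (b.coord j w * ψ (b i)))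
      (fderiv ℂ (F i j) 1 X * (b.coord j w * ψ (b i))) 0 := by
    intro i j
    have h := hasDerivAt_comp_curve (hF i j) hγ
    rw [hγ0] at h
    exact h.mul_const _
  have h5 := HasDerivAt.fun_sum (u := Finset.univ) fun i _ =>
    HasDerivAt.fun_sum (u := Finset.univ) fun j _ => h4 i j
  have h6 : ψ ((∑ i, ∑ j, (fderiv ℂ (F i j) 1).toLinearMap.smulRight
      ((b.coord j).smulRight (b i))) X w) =
      ∑ i, ∑ j, fderiv ℂ (F i j) 1 X * (b.coord j w * ψ (b i)) := by
    simp [LinearMap.sum_apply, map_sum]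
  rw [h6]
  exact h5

namespace IsInfinitesimal

variable {ρ : Representation ℂ USp6 V} {L : Mat6 →ₗ[ℂ] Module.End ℂ V}

theorem hasDerivAt_exp (h : IsInfinitesimal ρ L) {X : Mat6} (hX : IsCompactLie X)
    (ψ : Module.Dual ℂ V) (w : V) :
    HasDerivAt (fun s : ℝ => ψ (ρ (expUSp6 (s • X) (hX.smul s)) w)) (ψ (L X w)) 0 := by
  refine h (fun s => expUSp6 (s • X) (hX.smul s)) X ?_ (hasDerivAt_exp_smul_zero X) ψ w
  refine USp6.mat_injective ?_
  change exp ((0 : ℝ) • X) = 1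
  rw [zero_smul, exp_zero]

/-- Two linear maps on `sp(6, ℂ)` that agree on the compact form agree. -/
theorem eqOn_sp6 {E : Type*} [AddCommGroup E] [Module ℂ E] {S T : Mat6 →ₗ[ℂ] E}
    (h : ∀ X, IsCompactLie X → S X = T X) {X : Mat6} (hX : X ∈ sp6) : S X = T X := by
  obtain ⟨Y, Z, hY, hZ, rfl⟩ := exists_compact_decomposition hX
  rw [map_add, map_add, map_smul, map_smul, h Y hY, h Z hZ]

/-- Equivariance of the derivative under the adjoint action. -/
theorem conj_apply (h : IsInfinitesimal ρ L) (g : USp6) {X : Mat6} (hX : X ∈ sp6) (w : V) :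
    ρ g (L X (ρ g⁻¹ w)) = L (umat g * X * umat g⁻¹) w := by
  let S : Mat6 →ₗ[ℂ] V := ρ g ∘ₗ (LinearMap.applyₗ (ρ g⁻¹ w)) ∘ₗ L
  let T : Mat6 →ₗ[ℂ] V := (LinearMap.applyₗ w) ∘ₗ L ∘ₗ
    (LinearMap.mulRight ℂ (umat g⁻¹)) ∘ₗ (LinearMap.mulLeft ℂ (umat g))
  refine eqOn_sp6 (S := S) (T := T) (fun X hX => ?_) hX
  refine eq_of_forall_dual_eq fun ψ => ?_
  have h1 := h.hasDerivAt_exp hX (ψ ∘ₗ ρ g) (ρ g⁻¹ w)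
  have h2 := h (fun s => g * expUSp6 (s • X) (hX.smul s) * g⁻¹) (umat g * X * umat g⁻¹)
    (by
      have : expUSp6 ((0 : ℝ) • X) (hX.smul 0) = 1 := USp6.mat_injective (by
        change exp ((0 : ℝ) • X) = 1
        rw [zero_smul, exp_zero])
      change g * expUSp6 ((0 : ℝ) • X) (hX.smul 0) * g⁻¹ = 1
      rw [this, mul_one, mul_inv_cancel])
    (hasDerivAt_mul_curve_mul (umat g) (umat g⁻¹) (hasDerivAt_exp_smul_zero X)) ψ w
  simp only [map_mul, Module.End.mul_apply] at h2
  exact h1.unique h2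

theorem apply_comm (h : IsInfinitesimal ρ L) (g : USp6) {X : Mat6} (hX : X ∈ sp6) (w : V) :
    ρ g (L X w) = L (umat g * X * umat g⁻¹) (ρ g w) := by
  rw [← h.conj_apply g hX, ← Module.End.mul_apply (ρ g⁻¹), ← map_mul]
  simp

/-- For Y in the compact form, both sides are the derivative at s = 0 of L(Ad(exp sY)X) = ρ(exp sY)
L(X) ρ(exp sY)⁻¹, the right side being differentiated by the product rule in a basis. Linearity in Y
gives the rest. -/
theorem map_commutator [FiniteDimensional ℂ V] (h : IsInfinitesimal ρ L) {X Y : Mat6}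
    (hX : X ∈ sp6) (hY : Y ∈ sp6) (w : V) : L (Y * X - X * Y) w = L Y (L X w) - L X (L Y w) := by
  let S : Mat6 →ₗ[ℂ] V := (LinearMap.applyₗ w) ∘ₗ L ∘ₗ
    (LinearMap.mulRight ℂ X - LinearMap.mulLeft ℂ X)
  let T : Mat6 →ₗ[ℂ] V := (LinearMap.applyₗ (L X w)) ∘ₗ L - (L X) ∘ₗ (LinearMap.applyₗ w) ∘ₗ L
  refine eqOn_sp6 (S := S) (T := T) (fun Y hY => ?_) hY
  change L (Y * X - X * Y) w = L Y (L X w) - L X (L Y w)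
  refine eq_of_forall_dual_eq fun ψ => ?_
  have h1 := hasDerivAt_linear_comp_curve (ψ ∘ₗ (LinearMap.applyₗ w) ∘ₗ L)
    (hasDerivAt_exp_conj Y X)
  let b := Module.finBasis ℂ V
  let e : ℝ → USp6 := fun s => expUSp6 (s • Y) (hY.smul s)
  have he0 : e 0 = 1 := USp6.mat_injective (by
    change exp ((0 : ℝ) • Y) = 1
    rw [zero_smul, exp_zero])
  have hei : ∀ s : ℝ, (e s)⁻¹ = expUSp6 (s • (-Y)) (hY.neg.smul s) := by
    intro s
    rw [inv_eq_iff_mul_eq_one]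
    refine USp6.mat_injective ?_
    change exp (s • Y) * exp (s • (-Y)) = 1
    rw [smul_neg, matrix_exp_mul_exp_neg]
  have h2 : ∀ s, ψ (L (exp (s • Y) * X * exp (-(s • Y))) w) =
      ∑ i, b.coord i (ρ (e s)⁻¹ w) * ψ (ρ (e s) (L X (b i))) := by
    intro s
    have h3 : L (exp (s • Y) * X * exp (-(s • Y))) w = ρ (e s) (L X (ρ (e s)⁻¹ w)) := by
      rw [h.conj_apply (e s) hX, hei]
      change _ = L (exp (s • Y) * X * exp (s • (-Y))) w
      rw [smul_neg]
    rw [h3]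
    conv_lhs => rw [← b.sum_repr (ρ (e s)⁻¹ w)]
    simp only [map_sum, map_smul, smul_eq_mul, Module.Basis.coord_apply]
  have h4 : ∀ i, HasDerivAt (fun s => b.coord i (ρ (e s)⁻¹ w) * ψ (ρ (e s) (L X (b i))))
      (b.coord i (L (-Y) w) * ψ (L X (b i)) + b.coord i w * ψ (L Y (L X (b i)))) 0 := by
    intro i
    have h5 := h.hasDerivAt_exp hY.neg (b.coord i) w
    simp only [← hei] at h5
    have h6 := h5.mul (h.hasDerivAt_exp hY ψ (L X (b i)))
    have h7 : ρ (expUSp6 ((0 : ℝ) • Y) (hY.smul 0)) = 1 := by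
      change ρ (e 0) = 1
      rw [he0, map_one]
    rw [he0, inv_one, map_one, h7] at h6
    exact h6
  have h8 := HasDerivAt.fun_sum (u := Finset.univ) fun i _ => h4 i
  simp only [← h2] at h8
  have h9 := h1.unique h8
  have h10 : ∑ i, (b.coord i (L (-Y) w) * ψ (L X (b i)) + b.coord i w * ψ (L Y (L X (b i)))) =
      ψ (L X (L (-Y) w)) + ψ (L Y (L X w)) := by
    have h12 : ∀ (φ : Module.Dual ℂ V) (u : V), φ u = ∑ i, b.coord i u * φ (b i) := by
      intro φ u
      conv_lhs => rw [← b.sum_repr u]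
      simp only [map_sum, map_smul, smul_eq_mul, Module.Basis.coord_apply]
    rw [Finset.sum_add_distrib]
    exact congrArg₂ (· + ·) (h12 (ψ ∘ₗ L X) _).symm (h12 (ψ ∘ₗ L Y ∘ₗ L X) _).symm
  rw [h10] at h9
  have h11 : ψ (L (Y * X - X * Y) w) = ψ (L X (L (-Y) w)) + ψ (L Y (L X w)) := h9
  rw [h11, map_neg, LinearMap.neg_apply, map_neg, map_neg, map_sub]
  ring

end IsInfinitesimal
end

/-! ### From Lie algebra invariance to group invariance, and the vanishing criterion. -/

noncomputable section
open NormedSpace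

attribute [local instance] Matrix.linftyOpNormedRing Matrix.linftyOpNormedAlgebra

theorem expUSp6_inv {X : Mat6} (hX : IsCompactLie X) :
    (expUSp6 X hX)⁻¹ = expUSp6 (-X) hX.neg := by
  rw [inv_eq_iff_mul_eq_one]
  refine USp6.mat_injective ?_
  change exp X * exp (-X) = 1
  rw [matrix_exp_mul_exp_neg]

theorem expUSp6_add_smul {X : Mat6} (hX : IsCompactLie X) (s t : ℝ) :
    expUSp6 ((s + t) • X) (hX.smul _) =
      expUSp6 (s • X) (hX.smul _) * expUSp6 (t • X) (hX.smul _) := by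
  refine USp6.mat_injective ?_
  change exp ((s + t) • X) = exp (s • X) * exp (t • X)
  rw [add_smul, Matrix.exp_add_of_commute]
  exact ((Commute.refl X).smul_left s).smul_right t

theorem expUSp6_zero_smul {X : Mat6} (hX : IsCompactLie X) :
    expUSp6 ((0 : ℝ) • X) (hX.smul _) = 1 := by
  refine USp6.mat_injective ?_
  change exp ((0 : ℝ) • X) = 1
  rw [zero_smul, exp_zero]

/-- A one-parameter group of matrices is the exponential of its derivative. -/
theorem eq_exp_of_hasDerivAt {n : Type*} [Fintype n] [DecidableEq n] {R : ℝ → Matrix n n ℂ}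
    {A : Matrix n n ℂ} (h0 : R 0 = 1) (hadd : ∀ s t, R (s + t) = R s * R t)
    (hd : ∀ i j, HasDerivAt (fun s => R s i j) (A i j) 0) : R 1 = exp A := by
  have h1 : HasDerivAt R A 0 := hasDerivAt_pi.2 fun i => hasDerivAt_pi.2 fun j => hd i j
  have h2 : ∀ s, HasDerivAt R (R s * A) s := by
    intro s
    have h3 : HasDerivAt (fun t => R s * R (t - s)) (R s * A) s := by
      have h4 : HasDerivAt (fun t => R (t - s)) A s := by
        have h5 : HasDerivAt R A (s - s) := by rwa [sub_self]
        exact HasDerivAt.comp_sub_const s s h5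
      exact h4.const_mul (R s)
    have h6 : (fun t => R s * R (t - s)) = R := by
      funext t
      rw [← hadd, add_sub_cancel]
    rwa [h6] at h3
  have h7 : ∀ s, HasDerivAt (fun s => R s * exp (s • (-A))) 0 s := by
    intro s
    have h8 := (h2 s).mul (hasDerivAt_exp_smul_const' (𝕂 := ℝ) (-A) s)
    have h9 : R s * A * exp (s • (-A)) + R s * (-A * exp (s • (-A))) = 0 := by
      rw [neg_mul, mul_neg, mul_assoc, add_neg_cancel]
    rw [← h9]
    exact h8
  have h10 := is_const_of_deriv_eq_zero (𝕜 := ℝ) (f := fun s => R s * exp (s • (-A)))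
    (fun s => (h7 s).differentiableAt) (fun s => (h7 s).deriv) 1 0
  simp only [one_smul, zero_smul, exp_zero, h0, mul_one] at h10
  have h11 : exp (-A) * exp A = 1 := by
    rw [← Matrix.exp_add_of_commute _ _ ((Commute.refl A).neg_left), neg_add_cancel, exp_zero]
  calc R 1 = R 1 * (exp (-A) * exp A) := by rw [h11, mul_one]
    _ = exp A := by rw [← mul_assoc, h10, one_mul]

variable {V : Type*} [AddCommGroup V] [Module ℂ V]

/-- The one-parameter group of X acts by exp(L X), a limit of polynomials in L X, and a
finite-dimensional W is closed. Since exponentials generate the group, this suffices. -/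
theorem IsInfinitesimal.invariant_of_invariant [FiniteDimensional ℂ V]
    {ρ : Representation ℂ USp6 V} {L : Mat6 →ₗ[ℂ] Module.End ℂ V} (h : IsInfinitesimal ρ L)
    (W : Submodule ℂ V) (hW : ∀ X ∈ sp6, ∀ w ∈ W, L X w ∈ W) (g : USp6) :
    ∀ w ∈ W, ρ g w ∈ W := by
  have hexp : ∀ X (hX : IsCompactLie X), ∀ w ∈ W, ρ (expUSp6 X hX) w ∈ W := by
    intro X hX
    let b := Module.finBasis ℂ V
    let R : ℝ → Matrix _ _ ℂ := fun s => LinearMap.toMatrix b b (ρ (expUSp6 (s • X) (hX.smul s)))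
    let A := LinearMap.toMatrix b b (L X)
    have hR : R 1 = exp A := by
      refine eq_exp_of_hasDerivAt ?_ (fun s t => ?_) (fun i j => ?_)
      · simp only [R]
        rw [expUSp6_zero_smul hX, map_one, LinearMap.toMatrix_one]
      · simp only [R]
        rw [expUSp6_add_smul hX, map_mul, LinearMap.toMatrix_mul]
      · have h1 := h.hasDerivAt_exp hX (b.coord i) (b j)
        simpa [R, A, LinearMap.toMatrix_apply] using h1
    let S : Submodule ℂ (Matrix (Fin (Module.finrank ℂ V)) (Fin (Module.finrank ℂ V)) ℂ) :=
      { carrier := {M | ∀ w ∈ W, Matrix.toLin b b M w ∈ W}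
        zero_mem' := fun w _ => by simp
        add_mem' := fun {M N} hM hN w hw => by
          rw [map_add, LinearMap.add_apply]
          exact W.add_mem (hM w hw) (hN w hw)
        smul_mem' := fun c M hM w hw => by
          rw [map_smul, LinearMap.smul_apply]
          exact W.smul_mem _ (hM w hw) }
    have hpow : ∀ n : ℕ, A ^ n ∈ S := by
      intro n
      induction n with
      | zero => exact fun w hw => by simpa using hw
      | succ n ih =>
        intro w hw
        rw [pow_succ, Matrix.toLin_mul b b b, LinearMap.comp_apply, Matrix.toLin_toMatrix]
        exact ih _ (hW X hX.1 w hw)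
    have hmem : exp A ∈ S := by
      have hs := exp_series_hasSum_exp' (𝕂 := ℂ) A
      have hc : IsClosed (S : Set (Matrix (Fin (Module.finrank ℂ V))
          (Fin (Module.finrank ℂ V)) ℂ)) := S.closed_of_finiteDimensional
      exact hc.mem_of_tendsto hs (Filter.Eventually.of_forall fun t =>
        S.sum_mem fun n _ => S.smul_mem _ (hpow n))
    intro w hw
    have h2 := hmem w hw
    rw [← hR] at h2
    simp only [R, Matrix.toLin_toMatrix, one_smul] at h2
    exact h2
  have hg : g ∈ Subgroup.closure {g : USp6 | ∃ X, ∃ hX : IsCompactLie X, g = expUSp6 X hX} := by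
    rw [closure_exp_eq_top]
    trivial
  suffices hh : ∀ w ∈ W, ρ g w ∈ W ∧ ρ g⁻¹ w ∈ W from fun w hw => (hh w hw).1
  induction hg using Subgroup.closure_induction with
  | mem x hx =>
    obtain ⟨X, hX, rfl⟩ := hx
    rw [expUSp6_inv]
    exact fun w hw => ⟨hexp _ _ w hw, hexp _ _ w hw⟩
  | one => exact fun w hw => by simpa using hw
  | mul x y _ _ hx hy =>
    intro w hw
    rw [mul_inv_rev, map_mul, map_mul]
    exact ⟨(hx _ (hy w hw).1).1, (hy _ (hx w hw).2).2⟩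
  | inv x _ hx =>
    intro w hw
    rw [inv_inv]
    exact (hx w hw).symm

/-- If `sp(6, ℂ) = 𝔨 + 𝔟` where `𝔨` annihilates the functional `φ` and `𝔟` stabilizes the line
of `x`, then `φ x = 0` implies that `φ` vanishes on the orbit of `x`. -/
theorem IsInfinitesimal.apply_eq_zero [FiniteDimensional ℂ V]
    {ρ : Representation ℂ USp6 V} {L : Mat6 →ₗ[ℂ] Module.End ℂ V} (h : IsInfinitesimal ρ L)
    (φ : Module.Dual ℂ V) (x : V)
    (hdec : ∀ X ∈ sp6, ∃ K B, X = K + B ∧ B ∈ sp6 ∧ (∀ w, φ (L K w) = 0) ∧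
      ∃ μ : ℂ, L B x = μ • x)
    (hx : φ x = 0) (g : USp6) : φ (ρ g x) = 0 := by
  -- F n is spanned by x and the vectors obtained from it by at most n Lie algebra operators; this
  -- plays the role of the filtered enveloping algebra.
  let F : ℕ → Submodule ℂ V := fun n => n.rec (Submodule.span ℂ {x})
    fun _ W => W ⊔ Submodule.span ℂ {v | ∃ X ∈ sp6, ∃ w ∈ W, v = L X w}
  have hF0 : F 0 = Submodule.span ℂ {x} := rfl
  have hFs : ∀ n, F (n + 1) = F n ⊔ Submodule.span ℂ {v | ∃ X ∈ sp6, ∃ w ∈ F n, v = L X w} :=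
    fun n => rfl
  have hmono : Monotone F := monotone_nat_of_le_succ fun n => by
    rw [hFs]
    exact le_sup_left
  have hB : ∀ n, ∀ B ∈ sp6, (∃ μ : ℂ, L B x = μ • x) → ∀ w ∈ F n, L B w ∈ F n := by
    intro n
    induction n with
    | zero =>
      rintro B - ⟨μ, hμ⟩ w hw
      rw [hF0, Submodule.mem_span_singleton] at hw
      obtain ⟨c, rfl⟩ := hw
      rw [map_smul, hμ, hF0]
      exact Submodule.smul_mem _ _ (Submodule.smul_mem _ _ (Submodule.mem_span_singleton_self x))
    | succ n ih =>
      intro B hB hBx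
      suffices hle : F (n + 1) ≤ (F (n + 1)).comap (L B) from fun w hw => hle hw
      conv_lhs => rw [hFs]
      rw [sup_le_iff]
      refine ⟨fun w hw => hmono (Nat.le_succ n) (ih B hB hBx w hw), ?_⟩
      rw [Submodule.span_le]
      rintro _ ⟨X, hX, w, hw, rfl⟩
      have h1 := h.map_commutator hX hB w
      -- Moving B past X costs a commutator, which is one single operator applied to F n; so B does
      -- not raise the filtration degree.
      have h2 : L B (L X w) = L (B * X - X * B) w + L X (L B w) := by
        rw [h1, sub_add_cancel]
      change L B (L X w) ∈ F (n + 1)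
      rw [h2, hFs]
      refine Submodule.mem_sup_right (Submodule.add_mem _ ?_ ?_)
      · exact Submodule.subset_span ⟨_, commutator_mem_sp6 hB hX, w, hw, rfl⟩
      · exact Submodule.subset_span ⟨X, hX, _, ih B hB hBx w hw, rfl⟩
  have hφ : ∀ n, F n ≤ LinearMap.ker φ := by
    intro n
    induction n with
    | zero =>
      rw [hF0, Submodule.span_le, Set.singleton_subset_iff]
      exact hx
    | succ n ih =>
      rw [hFs, sup_le_iff]
      refine ⟨ih, ?_⟩
      rw [Submodule.span_le]
      rintro _ ⟨X, hX, w, hw, rfl⟩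
      -- The outermost operator is the one that is split: its K part dies under φ, and its B part
      -- keeps w in F n, where φ already vanishes.
      obtain ⟨K, B, rfl, hBs, hK, hBx⟩ := hdec X hX
      change φ (L (K + B) w) = 0
      rw [map_add, LinearMap.add_apply, map_add, hK, zero_add]
      exact ih (hB n B hBs hBx w hw)
  have hmem : ∀ w, w ∈ ⨆ n, F n ↔ ∃ n, w ∈ F n := fun w =>
    Submodule.mem_iSup_of_directed F hmono.directed_le
  have hinv := h.invariant_of_invariant (⨆ n, F n) (fun X hX w hw => by
    rw [hmem] at hw ⊢
    obtain ⟨n, hn⟩ := hw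
    refine ⟨n + 1, ?_⟩
    rw [hFs]
    exact Submodule.mem_sup_right (Submodule.subset_span ⟨X, hX, w, hn, rfl⟩)) g x
    ((hmem x).2 ⟨0, by rw [hF0]; exact Submodule.mem_span_singleton_self x⟩)
  obtain ⟨n, hn⟩ := (hmem _).1 hinv
  exact hφ n hn

end

/-! ### The torus, weights and root vectors. -/

noncomputable section

attribute [local instance] Matrix.linftyOpNormedRing Matrix.linftyOpNormedAlgebra

theorem umat_torusElt (t : Fin 3 → Circle) :
    umat (torusElt t) = Matrix.fromBlocks (Matrix.diagonal fun i => (t i : ℂ)) 0 0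
      (Matrix.diagonal fun i => ((t i)⁻¹ : ℂ)) := by
  change conjBlock (Matrix.diagonal fun i => (t i : ℂ)) = _
  rw [conjBlock, Matrix.diagonal_map (star_zero _)]
  congr 2
  funext i
  rw [← Circle.coe_inv, Circle.coe_inv_eq_conj]
  rfl

theorem torusElt_mul (s t : Fin 3 → Circle) : torusElt (s * t) = torusElt s * torusElt t := by
  refine USp6.mat_injective ?_
  change umat _ = umat _ * umat _
  rw [umat_torusElt, umat_torusElt, umat_torusElt, Matrix.fromBlocks_multiply]
  simp [mul_comm]

theorem torusElt_one : torusElt 1 = 1 := by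
  refine USp6.mat_injective ?_
  change umat _ = 1
  rw [umat_torusElt]
  simp

/-- The standard maximal torus as a homomorphism. -/
def torusHom : (Fin 3 → Circle) →* USp6 where
  toFun := torusElt
  map_one' := torusElt_one
  map_mul' := torusElt_mul

theorem umat_torusElt_inv (t : Fin 3 → Circle) :
    umat (torusElt t)⁻¹ = Matrix.fromBlocks (Matrix.diagonal fun i => ((t i)⁻¹ : ℂ)) 0 0
      (Matrix.diagonal fun i => (t i : ℂ)) := by
  have h : (torusElt t)⁻¹ = torusElt t⁻¹ := (map_inv torusHom t).symm
  rw [h, umat_torusElt]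
  simp

theorem continuous_circle_coe : Continuous fun z : Circle => (z : ℂ) := continuous_subtype_val

theorem continuous_torusElt : Continuous torusElt := by
  refine Continuous.subtype_mk (Continuous.subtype_mk ?_ _) _
  have h : (fun t => umat (torusElt t)) = fun t : Fin 3 → Circle =>
      Matrix.fromBlocks (Matrix.diagonal fun i => (t i : ℂ)) 0 0
      (Matrix.diagonal fun i => ((t i)⁻¹ : ℂ)) := funext umat_torusElt
  change Continuous fun t => umat (torusElt t)
  rw [h]
  refine Continuous.matrix_fromBlocks (Continuous.matrix_diagonal ?_) continuous_const
    continuous_const (Continuous.matrix_diagonal ?_)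
  · exact continuous_pi fun i => continuous_circle_coe.comp (continuous_apply i)
  · exact continuous_pi fun i =>
      (continuous_circle_coe.comp (continuous_apply i)).inv₀ fun t => (t i).coe_ne_zero

/-- The character of the torus attached to a weight. -/
def torusChar (μ : Fin 3 → ℤ) : (Fin 3 → Circle) →* ℂˣ where
  toFun t := ∏ i, (Circle.toUnits (t i)) ^ μ i
  map_one' := by simp
  map_mul' s t := by
    simp only [Pi.mul_apply, map_mul, mul_zpow, Finset.prod_mul_distrib]

theorem coe_torusChar (μ : Fin 3 → ℤ) (t : Fin 3 → Circle) :
    (torusChar μ t : ℂ) = ∏ i, (t i : ℂ) ^ μ i := by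
  simp [torusChar]

theorem torusChar_add (μ ν : Fin 3 → ℤ) (t : Fin 3 → Circle) :
    (torusChar (μ + ν) t : ℂ) = torusChar μ t * torusChar ν t := by
  rw [coe_torusChar, coe_torusChar, coe_torusChar, ← Finset.prod_mul_distrib]
  exact Finset.prod_congr rfl fun i _ => by rw [Pi.add_apply, zpow_add₀ (t i).coe_ne_zero]

theorem torusChar_neg (μ : Fin 3 → ℤ) (t : Fin 3 → Circle) :
    (torusChar (-μ) t : ℂ) = (torusChar μ t : ℂ)⁻¹ := by
  rw [coe_torusChar, coe_torusChar, ← Finset.prod_inv_distrib]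
  exact Finset.prod_congr rfl fun i _ => by rw [Pi.neg_apply, zpow_neg]

theorem torusChar_single (i : Fin 3) (t : Fin 3 → Circle) :
    (torusChar (Pi.single i 1) t : ℂ) = t i := by
  rw [coe_torusChar, Finset.prod_eq_single i]
  · simp
  · intro j _ hj
    simp [Pi.single_eq_of_ne hj]
  · simp

theorem continuous_torusChar (μ : Fin 3 → ℤ) : Continuous fun t => (torusChar μ t : ℂ) := by
  simp only [coe_torusChar]
  refine continuous_finsetProd _ fun i _ => ?_
  exact (continuous_circle_coe.comp (continuous_apply i)).zpow₀ (μ i) fun t =>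
    Or.inl (t i).coe_ne_zero

/-- The matrix with diagonal blocks `E i j` and `-E j i`. -/
def rootX (i j : Fin 3) : Mat6 :=
  Matrix.fromBlocks (Matrix.single i j 1) 0 0 (-(Matrix.single i j (1 : ℂ)).transpose)

/-- The matrix with upper right block `E i j + E j i`. -/
def rootY (i j : Fin 3) : Mat6 :=
  Matrix.fromBlocks 0 (Matrix.single i j 1 + Matrix.single j i 1) 0 0

/-- The matrix with lower left block `E i j + E j i`. -/
def rootZ (i j : Fin 3) : Mat6 :=
  Matrix.fromBlocks 0 0 (Matrix.single i j 1 + Matrix.single j i 1) 0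

theorem rootX_mem (i j : Fin 3) : rootX i j ∈ sp6 :=
  fromBlocks_mem_sp6 Matrix.transpose_zero Matrix.transpose_zero rfl

theorem rootY_mem (i j : Fin 3) : rootY i j ∈ sp6 :=
  fromBlocks_mem_sp6 (by simp [add_comm]) Matrix.transpose_zero (by simp)

theorem rootZ_mem (i j : Fin 3) : rootZ i j ∈ sp6 :=
  fromBlocks_mem_sp6 Matrix.transpose_zero (by simp [add_comm]) (by simp)

theorem diagonal_mul_single_mul_diagonal (d e : Fin 3 → ℂ) (i j : Fin 3) :
    Matrix.diagonal d * Matrix.single i j 1 * Matrix.diagonal e =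
      (d i * e j) • Matrix.single i j (1 : ℂ) := by
  ext k l
  rw [Matrix.mul_diagonal, Matrix.diagonal_mul, Matrix.smul_apply, Matrix.single_apply]
  split_ifs with h
  · rw [← h.1, ← h.2, smul_eq_mul]
    ring
  · simp

theorem torusElt_conj_rootX (t : Fin 3 → Circle) (i j : Fin 3) :
    umat (torusElt t) * rootX i j * umat (torusElt t)⁻¹ =
      (torusChar (Pi.single i 1 - Pi.single j 1) t : ℂ) • rootX i j := by
  rw [sub_eq_add_neg, torusChar_add, torusChar_neg, torusChar_single, torusChar_single,
    umat_torusElt, umat_torusElt_inv, rootX, Matrix.fromBlocks_multiply,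
    Matrix.fromBlocks_multiply, Matrix.fromBlocks_smul]
  simp only [zero_mul, mul_zero, add_zero, zero_add, smul_zero, Matrix.transpose_single, mul_neg,
    neg_mul, diagonal_mul_single_mul_diagonal, smul_neg, neg_zero, mul_comm ((t j : ℂ)⁻¹)]

theorem torusElt_conj_rootY (t : Fin 3 → Circle) (i j : Fin 3) :
    umat (torusElt t) * rootY i j * umat (torusElt t)⁻¹ =
      (torusChar (Pi.single i 1 + Pi.single j 1) t : ℂ) • rootY i j := by
  rw [torusChar_add, torusChar_single, torusChar_single,
    umat_torusElt, umat_torusElt_inv, rootY, Matrix.fromBlocks_multiply,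
    Matrix.fromBlocks_multiply, Matrix.fromBlocks_smul]
  simp only [zero_mul, mul_zero, add_zero, zero_add, smul_zero, mul_add, add_mul,
    diagonal_mul_single_mul_diagonal, smul_add, mul_comm (t j : ℂ)]

theorem torusElt_conj_rootZ (t : Fin 3 → Circle) (i j : Fin 3) :
    umat (torusElt t) * rootZ i j * umat (torusElt t)⁻¹ =
      (torusChar (-(Pi.single i 1 + Pi.single j 1)) t : ℂ) • rootZ i j := by
  rw [torusChar_neg, torusChar_add, torusChar_single, torusChar_single,
    umat_torusElt, umat_torusElt_inv, rootZ, Matrix.fromBlocks_multiply,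
    Matrix.fromBlocks_multiply, Matrix.fromBlocks_smul]
  simp only [zero_mul, mul_zero, add_zero, zero_add, smul_zero, mul_add, add_mul,
    diagonal_mul_single_mul_diagonal, smul_add, mul_inv, mul_comm ((t j : ℂ)⁻¹)]

variable {V : Type*} [AddCommGroup V] [Module ℂ V]

/-- The vector `v` is a weight vector (possibly zero) of weight `μ`. -/
def IsWeightVector (ρ : Representation ℂ USp6 V) (μ : Fin 3 → ℤ) (v : V) : Prop :=
  ∀ t, ρ (torusElt t) v = (torusChar μ t : ℂ) • v

/-- The functional `φ` is a weight vector (possibly zero) of weight `μ` for the right action. -/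
def IsWeightFunctional (ρ : Representation ℂ USp6 V) (μ : Fin 3 → ℤ) (φ : Module.Dual ℂ V) :
    Prop :=
  ∀ t w, φ (ρ (torusElt t) w) = (torusChar μ t : ℂ) * φ w

theorem isWeight_iff (ρ : Representation ℂ USp6 V) (μ : Fin 3 → ℤ) :
    IsWeight ρ μ ↔ ∃ v, v ≠ 0 ∧ IsWeightVector ρ μ v := by
  simp only [IsWeight, IsWeightVector, coe_torusChar]

theorem exists_torus_averaging [FiniteDimensional ℂ V] (ρ : Representation ℂ USp6 V)
    (hcont : IsContinuousRep ρ) (μ : Fin 3 → ℤ) :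
    ∃ P : V →ₗ[ℂ] V, (∀ w, IsWeightVector ρ μ (P w)) ∧ (∀ φ, IsWeightFunctional ρ μ (φ ∘ₗ P)) ∧
      (∀ w, IsWeightVector ρ μ w → P w = w) ∧
      ∀ φ, IsWeightFunctional ρ μ φ → ∀ w, φ (P w) = φ w := by
  obtain ⟨P, h1, h2, h3, h4⟩ := exists_averaging_char (ρ.comp torusHom)
    (fun ψ w => (hcont ψ w).comp continuous_torusElt) (torusChar μ) (continuous_torusChar μ)
  refine ⟨P, fun w t => h1 t w, fun φ t w => ?_, fun w hw => h3 w hw, fun φ hφ w => h4 φ hφ w⟩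
  have h := congrArg φ (h2 t w)
  rw [map_smul, smul_eq_mul] at h
  exact h

/-- A functional of weight μ is unchanged by composition with the projection onto the μ-weight
space, so a nonzero value would exhibit a weight vector. -/
theorem IsWeightFunctional.eq_zero_of_not_isWeight [FiniteDimensional ℂ V]
    {ρ : Representation ℂ USp6 V} (hcont : IsContinuousRep ρ) {μ : Fin 3 → ℤ}
    {φ : Module.Dual ℂ V} (hφ : IsWeightFunctional ρ μ φ) (hμ : ¬ IsWeight ρ μ) (w : V) :
    φ w = 0 := by
  obtain ⟨P, h1, -, -, h4⟩ := exists_torus_averaging ρ hcont μ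
  by_contra hw
  refine hμ ((isWeight_iff ρ μ).2 ⟨P w, fun h => hw ?_, h1 w⟩)
  rw [← h4 φ hφ, h, map_zero]

namespace IsInfinitesimal

variable {ρ : Representation ℂ USp6 V} {L : Mat6 →ₗ[ℂ] Module.End ℂ V}

theorem isWeightVector_apply (h : IsInfinitesimal ρ L) {E : Mat6} (hE : E ∈ sp6)
    {α μ : Fin 3 → ℤ}
    (hα : ∀ t, umat (torusElt t) * E * umat (torusElt t)⁻¹ = (torusChar α t : ℂ) • E)
    {v : V} (hv : IsWeightVector ρ μ v) : IsWeightVector ρ (μ + α) (L E v) := by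
  intro t
  rw [h.apply_comm _ hE, hα, hv t, map_smul, map_smul, LinearMap.smul_apply, smul_smul,
    torusChar_add]

/-- Precomposition is the transposed action, hence the root is subtracted: negative root vectors
raise the weight of a functional. -/
theorem isWeightFunctional_comp (h : IsInfinitesimal ρ L) {E : Mat6} (hE : E ∈ sp6)
    {α μ : Fin 3 → ℤ}
    (hα : ∀ t, umat (torusElt t) * E * umat (torusElt t)⁻¹ = (torusChar α t : ℂ) • E)
    {φ : Module.Dual ℂ V} (hφ : IsWeightFunctional ρ μ φ) :
    IsWeightFunctional ρ (μ - α) (φ ∘ₗ L E) := by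
  intro t w
  have h1 := hφ t (L E w)
  rw [h.apply_comm _ hE, hα, map_smul, LinearMap.smul_apply, map_smul, smul_eq_mul] at h1
  rw [sub_eq_add_neg, torusChar_add, torusChar_neg, LinearMap.comp_apply, LinearMap.comp_apply,
    mul_right_comm, ← h1]
  field_simp

/-- The diagonal torus generators act on weight vectors by the weight. -/
theorem rootX_diag_apply (h : IsInfinitesimal ρ L) {μ : Fin 3 → ℤ} {v : V}
    (hv : IsWeightVector ρ μ v) (i : Fin 3) : L (rootX i i) v = (μ i : ℂ) • v := by
  -- The matrix `rootX i i` is Hermitian; the tangent vector of the torus curve in direction i is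
  -- `Complex.I` times it.
  have h1 : Complex.I • L (rootX i i) v = Complex.I • ((μ i : ℂ) • v) := by
    rw [← LinearMap.smul_apply, ← map_smul]
    refine eq_of_forall_dual_eq fun ψ => ?_
    let γ : ℝ → Fin 3 → Circle := fun s => Pi.mulSingle i (Circle.exp s)
    have hd : HasDerivAt (fun s : ℝ => Complex.exp (s * Complex.I)) Complex.I 0 := by
      have := ((Complex.ofRealCLM.hasDerivAt (x := 0)).mul_const Complex.I).cexp
      simpa using this
    have hd2 : HasDerivAt (fun s : ℝ => (Complex.exp (s * Complex.I))⁻¹) (-Complex.I) 0 := by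
      have h3 : (fun s : ℝ => (Complex.exp (s * Complex.I))⁻¹) =
          fun s : ℝ => Complex.exp (s * -Complex.I) := by
        funext s
        rw [← Complex.exp_neg, mul_neg]
      rw [h3]
      have := ((Complex.ofRealCLM.hasDerivAt (x := 0)).mul_const (-Complex.I)).cexp
      simpa using this
    have hγ : HasDerivAt (fun s => umat (torusElt (γ s))) (Complex.I • rootX i i) 0 := by
      refine hasDerivAt_pi.2 fun k => hasDerivAt_pi.2 fun l => ?_
      simp only [umat_torusElt, γ, rootX]
      rcases k with k | k <;> rcases l with l | l
      · by_cases hkl : k = l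
        · subst hkl
          by_cases hki : k = i
          · subst hki
            simpa [Circle.coe_exp] using hd
          · simpa [hki, Matrix.single_apply, Ne.symm hki] using hasDerivAt_const (0 : ℝ) (1 : ℂ)
        · have : ¬ (i = k ∧ i = l) := fun h => hkl (h.1.symm.trans h.2)
          simpa [hkl, Matrix.single_apply, this] using hasDerivAt_const (0 : ℝ) (0 : ℂ)
      · simpa using hasDerivAt_const (0 : ℝ) (0 : ℂ)
      · simpa using hasDerivAt_const (0 : ℝ) (0 : ℂ)
      · by_cases hkl : k = l
        · subst hkl
          by_cases hki : k = i
          · subst hki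
            simpa [Circle.coe_exp] using hd2
          · simpa [hki, Matrix.single_apply, Ne.symm hki] using hasDerivAt_const (0 : ℝ) (1 : ℂ)
        · have : ¬ (i = l ∧ i = k) := fun h => hkl (h.2.symm.trans h.1)
          have h' : ¬ (i = k ∧ i = l) := fun h => this h.symm
          simpa [hkl, Matrix.single_apply, this, h'] using hasDerivAt_const (0 : ℝ) (0 : ℂ)
    have h2 := h (fun s => torusElt (γ s)) _ (by
      simp only [γ, Circle.exp_zero, Pi.mulSingle_one]
      exact torusElt_one) hγ ψ v
    have h3 : ∀ s, ψ (ρ (torusElt (γ s)) v) = Complex.exp (s * Complex.I) ^ (μ i) * ψ v := by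
      intro s
      rw [hv, map_smul, smul_eq_mul, coe_torusChar, Finset.prod_eq_single i]
      · simp [γ, Circle.coe_exp]
      · intro j _ hj
        simp [γ, hj]
      · simp
    simp only [h3] at h2
    have h4 : HasDerivAt (fun s : ℝ => Complex.exp (s * Complex.I) ^ (μ i) * ψ v)
        (Complex.I * μ i * ψ v) 0 := by
      have h5 : ∀ s : ℝ, Complex.exp (s * Complex.I) ^ (μ i) =
          Complex.exp (s * (Complex.I * μ i)) := by
        intro s
        rw [← Complex.exp_int_mul]
        congr 1
        ring
      simp only [h5]
      have := ((Complex.ofRealCLM.hasDerivAt (x := 0)).mul_const (Complex.I * μ i)).cexp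
      refine HasDerivAt.mul_const ?_ _
      simpa using this
    rw [h2.unique h4]
    simp only [map_smul, smul_eq_mul]
    ring
  exact smul_right_injective V Complex.I_ne_zero h1

end IsInfinitesimal

end

/-! ### Highest weight vectors and their matrix coefficients. -/

noncomputable section

variable {V : Type*} [AddCommGroup V] [Module ℂ V]

/-- The vector `v` has weight `μ` for the diagonal generators and is annihilated by the positive
root vectors. -/
structure IsHighestVector (L : Mat6 →ₗ[ℂ] Module.End ℂ V) (μ : Fin 3 → ℤ) (v : V) : Prop where
  diag : ∀ i, L (rootX i i) v = (μ i : ℂ) • v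
  rootX : ∀ i j, i < j → L (rootX i j) v = 0
  rootY : ∀ i j, L (rootY i j) v = 0

/-- The functional `φ` vanishes on the image of the negative root vectors. -/
structure IsLowestFunctional (L : Mat6 →ₗ[ℂ] Module.End ℂ V) (φ : Module.Dual ℂ V) : Prop where
  rootX : ∀ i j, j < i → ∀ w, φ (L (rootX i j) w) = 0
  rootZ : ∀ i j w, φ (L (rootZ i j) w) = 0

theorem fromBlocks_diag_eq_sum (U : Matrix (Fin 3) (Fin 3) ℂ) :
    (Matrix.fromBlocks U 0 0 (-U.transpose) : Mat6) = ∑ i, ∑ j, U i j • rootX i j := by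
  let f : Matrix (Fin 3) (Fin 3) ℂ →ₗ[ℂ] Mat6 :=
    { toFun := fun U => Matrix.fromBlocks U 0 0 (-U.transpose)
      map_add' := fun A B => by
        rw [Matrix.fromBlocks_add, Matrix.transpose_add, neg_add, add_zero]
      map_smul' := fun c A => by
        rw [RingHom.id_apply, Matrix.fromBlocks_smul, Matrix.transpose_smul, smul_neg, smul_zero] }
  change f U = _
  conv_lhs => rw [Matrix.matrix_eq_sum_single U]
  simp only [map_sum]
  refine Finset.sum_congr rfl fun i _ => Finset.sum_congr rfl fun j _ => ?_
  have h : Matrix.single i j (U i j) = U i j • Matrix.single i j (1 : ℂ) := by simp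
  rw [h, map_smul]
  rfl

theorem sum_smul_single_add_single {B : Matrix (Fin 3) (Fin 3) ℂ} (hB : B.transpose = B) :
    ∑ i, ∑ j, (B i j / 2) • (Matrix.single i j (1 : ℂ) + Matrix.single j i 1) = B := by
  have h1 : ∀ A : Matrix (Fin 3) (Fin 3) ℂ, A = ∑ i, ∑ j, A i j • Matrix.single i j (1 : ℂ) := by
    intro A
    conv_lhs => rw [Matrix.matrix_eq_sum_single A]
    simp
  have h2 : ∀ i j, B j i = B i j := fun i j => congrFun (congrFun hB i) j
  calc _ = ∑ i, ∑ j, (B i j / 2) • Matrix.single i j (1 : ℂ) +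
        ∑ i, ∑ j, (B j i / 2) • Matrix.single j i (1 : ℂ) := by
        simp only [smul_add, Finset.sum_add_distrib, h2]
    _ = ∑ i, ∑ j, (B i j / 2) • Matrix.single i j (1 : ℂ) +
        ∑ i, ∑ j, (B i j / 2) • Matrix.single i j (1 : ℂ) := by
        congr 1
        rw [Finset.sum_comm]
    _ = ∑ i, ∑ j, B i j • Matrix.single i j (1 : ℂ) := by
        simp only [← Finset.sum_add_distrib, ← add_smul, add_halves]
    _ = B := (h1 B).symm

theorem fromBlocks_upper_eq_sum {B : Matrix (Fin 3) (Fin 3) ℂ} (hB : B.transpose = B) :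
    (Matrix.fromBlocks 0 B 0 0 : Mat6) = ∑ i, ∑ j, (B i j / 2) • rootY i j := by
  let f : Matrix (Fin 3) (Fin 3) ℂ →ₗ[ℂ] Mat6 :=
    { toFun := fun B => Matrix.fromBlocks 0 B 0 0
      map_add' := fun A B => by simp [Matrix.fromBlocks_add]
      map_smul' := fun c A => by simp [Matrix.fromBlocks_smul] }
  change f B = _
  conv_lhs => rw [← sum_smul_single_add_single hB]
  simp only [map_sum, map_smul]
  rfl

theorem fromBlocks_lower_eq_sum {B : Matrix (Fin 3) (Fin 3) ℂ} (hB : B.transpose = B) :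
    (Matrix.fromBlocks 0 0 B 0 : Mat6) = ∑ i, ∑ j, (B i j / 2) • rootZ i j := by
  let f : Matrix (Fin 3) (Fin 3) ℂ →ₗ[ℂ] Mat6 :=
    { toFun := fun B => Matrix.fromBlocks 0 0 B 0
      map_add' := fun A B => by simp [Matrix.fromBlocks_add]
      map_smul' := fun c A => by simp [Matrix.fromBlocks_smul] }
  change f B = _
  conv_lhs => rw [← sum_smul_single_add_single hB]
  simp only [map_sum, map_smul]
  rfl

theorem IsHighestVector.apply_borel {L : Mat6 →ₗ[ℂ] Module.End ℂ V} {μ : Fin 3 → ℤ} {v : V}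
    (hv : IsHighestVector L μ v) {U B : Matrix (Fin 3) (Fin 3) ℂ} (hU : ∀ i j, j < i → U i j = 0)
    (hB : B.transpose = B) :
    L (Matrix.fromBlocks U B 0 (-U.transpose)) v = (∑ i, U i i * μ i) • v := by
  have h : (Matrix.fromBlocks U B 0 (-U.transpose) : Mat6) =
      Matrix.fromBlocks U 0 0 (-U.transpose) + Matrix.fromBlocks 0 B 0 0 := by
    rw [Matrix.fromBlocks_add]
    simp
  rw [h, fromBlocks_diag_eq_sum, fromBlocks_upper_eq_sum hB]
  simp only [map_add, map_sum, map_smul, LinearMap.add_apply, LinearMap.sum_apply,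
    LinearMap.smul_apply, hv.rootY, smul_zero, Finset.sum_const_zero, add_zero]
  rw [Finset.sum_smul]
  refine Finset.sum_congr rfl fun i _ => ?_
  rw [Finset.sum_eq_single i, hv.diag, smul_smul]
  · intro j _ hj
    rcases lt_or_gt_of_ne hj with h | h
    · rw [hU i j h, zero_smul]
    · rw [hv.rootX i j h, smul_zero]
  · simp

theorem IsLowestFunctional.apply_lower {L : Mat6 →ₗ[ℂ] Module.End ℂ V} {φ : Module.Dual ℂ V}
    (hφ : IsLowestFunctional L φ) {N C : Matrix (Fin 3) (Fin 3) ℂ} (hN : ∀ i j, i ≤ j → N i j = 0)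
    (hC : C.transpose = C) (w : V) :
    φ (L (Matrix.fromBlocks N 0 C (-N.transpose)) w) = 0 := by
  have h : (Matrix.fromBlocks N 0 C (-N.transpose) : Mat6) =
      Matrix.fromBlocks N 0 0 (-N.transpose) + Matrix.fromBlocks 0 0 C 0 := by
    rw [Matrix.fromBlocks_add]
    simp
  rw [h, fromBlocks_diag_eq_sum, fromBlocks_lower_eq_sum hC]
  simp only [map_add, map_sum, map_smul, LinearMap.add_apply, LinearMap.sum_apply,
    LinearMap.smul_apply, hφ.rootZ, smul_zero, Finset.sum_const_zero, add_zero]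
  refine Finset.sum_eq_zero fun i _ => Finset.sum_eq_zero fun j _ => ?_
  rcases le_or_gt i j with h | h
  · rw [hN i j h, zero_smul]
  · rw [hφ.rootX i j h, smul_zero]

/-- A matrix coefficient between a functional killed by the negative root vectors and a highest
weight vector vanishes identically if it vanishes at the identity. -/
theorem IsInfinitesimal.coeff_eq_zero [FiniteDimensional ℂ V] {ρ : Representation ℂ USp6 V}
    {L : Mat6 →ₗ[ℂ] Module.End ℂ V} (h : IsInfinitesimal ρ L) {μ : Fin 3 → ℤ} {v : V}
    (hv : IsHighestVector L μ v) {φ : Module.Dual ℂ V} (hφ : IsLowestFunctional L φ)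
    (h0 : φ v = 0) (g : USp6) : φ (ρ g v) = 0 := by
  refine h.apply_eq_zero φ v (fun X hX => ?_) h0 g
  obtain ⟨hB, hC, hD⟩ := blocks_of_mem_sp6 hX
  let A := X.toBlocks₁₁
  -- The strictly lower triangular part of the first block goes with the lower left block; what
  -- remains lies in the Borel subalgebra.
  let N : Matrix (Fin 3) (Fin 3) ℂ := Matrix.of fun i j => if i ≤ j then 0 else A i j
  refine ⟨Matrix.fromBlocks N 0 X.toBlocks₂₁ (-N.transpose),
    Matrix.fromBlocks (A - N) X.toBlocks₁₂ 0 (-(A - N).transpose), ?_, ?_, ?_, ?_⟩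
  · rw [Matrix.fromBlocks_add]
    conv_lhs => rw [← Matrix.fromBlocks_toBlocks X, hD]
    congr 1 <;> simp [A]
    abel
  · exact fromBlocks_mem_sp6 hB Matrix.transpose_zero rfl
  · exact hφ.apply_lower (fun i j hij => by simp [N, hij]) hC
  · exact ⟨_, hv.apply_borel (fun i j hij => by simp [N, not_le.2 hij]) hB⟩

/-- A nonnegative combination of simple roots has nonnegative partial coordinate sums, while the
negative of a positive root has a negative one. -/
theorem not_isWeight_add_rootX {ρ : Representation ℂ USp6 V} {μ : Fin 3 → ℤ}
    (h : HasHighestWeight ρ μ) {i j : Fin 3} (hij : i < j) :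
    ¬ IsWeight ρ (μ + (Pi.single i 1 - Pi.single j 1)) := by
  intro hw
  obtain ⟨n₁, n₂, n₃, hn⟩ := h.2 _ hw
  have h0 := congrFun hn 0
  have h1 := congrFun hn 1
  have h2 := congrFun hn 2
  fin_cases i <;> fin_cases j <;> simp at hij h0 h1 h2 <;> omega

theorem not_isWeight_add_rootY {ρ : Representation ℂ USp6 V} {μ : Fin 3 → ℤ}
    (h : HasHighestWeight ρ μ) (i j : Fin 3) :
    ¬ IsWeight ρ (μ + (Pi.single i 1 + Pi.single j 1)) := by
  intro hw
  obtain ⟨n₁, n₂, n₃, hn⟩ := h.2 _ hw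
  have h0 := congrFun hn 0
  have h1 := congrFun hn 1
  have h2 := congrFun hn 2
  fin_cases i <;> fin_cases j <;> simp at h0 h1 h2 <;> omega

theorem IsWeightVector.isHighestVector {ρ : Representation ℂ USp6 V}
    {L : Mat6 →ₗ[ℂ] Module.End ℂ V} (hL : IsInfinitesimal ρ L) {μ : Fin 3 → ℤ}
    (h : HasHighestWeight ρ μ) {v : V} (hv : IsWeightVector ρ μ v) : IsHighestVector L μ v where
  diag := hL.rootX_diag_apply hv
  rootX i j hij := by
    by_contra h0
    exact not_isWeight_add_rootX h hij ((isWeight_iff _ _).2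
      ⟨_, h0, hL.isWeightVector_apply (rootX_mem i j) (fun t => torusElt_conj_rootX t i j) hv⟩)
  rootY i j := by
    by_contra h0
    exact not_isWeight_add_rootY h i j ((isWeight_iff _ _).2
      ⟨_, h0, hL.isWeightVector_apply (rootY_mem i j) (fun t => torusElt_conj_rootY t i j) hv⟩)

/-- Composing φ with a negative root vector produces a functional of weight μ plus a positive root,
and the highest weight condition leaves no room for it. -/
theorem IsWeightFunctional.isLowestFunctional [FiniteDimensional ℂ V]
    {ρ : Representation ℂ USp6 V} (hcont : IsContinuousRep ρ)
    {L : Mat6 →ₗ[ℂ] Module.End ℂ V} (hL : IsInfinitesimal ρ L) {μ : Fin 3 → ℤ}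
    (h : HasHighestWeight ρ μ) {φ : Module.Dual ℂ V} (hφ : IsWeightFunctional ρ μ φ) :
    IsLowestFunctional L φ where
  rootX i j hij w := by
    have h1 := hL.isWeightFunctional_comp (rootX_mem i j) (fun t => torusElt_conj_rootX t i j) hφ
    refine h1.eq_zero_of_not_isWeight hcont ?_ w
    have h2 := not_isWeight_add_rootX h hij
    rwa [← neg_sub, ← sub_eq_add_neg] at h2
  rootZ i j w := by
    have h1 := hL.isWeightFunctional_comp (rootZ_mem i j) (fun t => torusElt_conj_rootZ t i j) hφ
    refine h1.eq_zero_of_not_isWeight hcont ?_ w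
    rw [sub_neg_eq_add]
    exact not_isWeight_add_rootY h i j

end

/-! ### Products of leading principal minors. -/

noncomputable section

attribute [local instance] Matrix.linftyOpNormedRing Matrix.linftyOpNormedAlgebra

/-- The determinant of the upper left `3 × 3` block, written out. -/
def minorThree (A : Mat6) : ℂ :=
  A (Sum.inl 0) (Sum.inl 0) * (A (Sum.inl 1) (Sum.inl 1) * A (Sum.inl 2) (Sum.inl 2) -
      A (Sum.inl 1) (Sum.inl 2) * A (Sum.inl 2) (Sum.inl 1)) -
    A (Sum.inl 0) (Sum.inl 1) * (A (Sum.inl 1) (Sum.inl 0) * A (Sum.inl 2) (Sum.inl 2) -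
      A (Sum.inl 1) (Sum.inl 2) * A (Sum.inl 2) (Sum.inl 0)) +
    A (Sum.inl 0) (Sum.inl 2) * (A (Sum.inl 1) (Sum.inl 0) * A (Sum.inl 2) (Sum.inl 1) -
      A (Sum.inl 1) (Sum.inl 1) * A (Sum.inl 2) (Sum.inl 0))

/-- The product of powers of the first three leading principal minors. -/
def minorProd (p q r : ℕ) (A : Mat6) : ℂ :=
  A (Sum.inl 0) (Sum.inl 0) ^ p *
    (A (Sum.inl 0) (Sum.inl 0) * A (Sum.inl 1) (Sum.inl 1) -
      A (Sum.inl 0) (Sum.inl 1) * A (Sum.inl 1) (Sum.inl 0)) ^ q * minorThree A ^ r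

theorem differentiable_minorProd (p q r : ℕ) : Differentiable ℂ (minorProd p q r) := by
  have h := differentiable_entry
  unfold minorProd minorThree
  refine (((h _ _).pow p).mul ((((h _ _).mul (h _ _)).sub ((h _ _).mul (h _ _))).pow q)).mul
    (Differentiable.pow ?_ r)
  have h2 : ∀ i j k l, Differentiable ℂ fun A : Mat6 => A i j * A k l := fun i j k l =>
    (h i j).mul (h k l)
  exact (((h _ _).mul ((h2 _ _ _ _).sub (h2 _ _ _ _))).sub
    ((h _ _).mul ((h2 _ _ _ _).sub (h2 _ _ _ _)))).add
    ((h _ _).mul ((h2 _ _ _ _).sub (h2 _ _ _ _)))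

theorem minorProd_one (p q r : ℕ) : minorProd p q r 1 = 1 := by
  simp [minorProd, minorThree]

theorem minorProd_congr {p q r : ℕ} {A B : Mat6}
    (h : ∀ i j : Fin 3, A (Sum.inl i) (Sum.inl j) = B (Sum.inl i) (Sum.inl j)) :
    minorProd p q r A = minorProd p q r B := by
  simp only [minorProd, minorThree, h]

/-- A leading minor that involves the later column also involves the earlier one, so this is a
determinant-preserving column operation in each minor it touches. It yields invariance under the
upper unipotent group on the right. -/
theorem minorProd_add_column {p q r : ℕ} {A B : Mat6} {i j : Fin 3} (hij : i < j) {z : ℂ}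
    (h : ∀ k l : Fin 3, B (Sum.inl k) (Sum.inl l) = A (Sum.inl k) (Sum.inl l) +
      if j = l then z * A (Sum.inl k) (Sum.inl i) else 0) :
    minorProd p q r B = minorProd p q r A := by
  simp only [minorProd, minorThree, h]
  congr 1
  · congr 1
    · fin_cases i <;> fin_cases j <;> simp at hij ⊢
    · congr 1
      fin_cases i <;> fin_cases j <;> simp at hij ⊢ <;> ring
  · congr 1
    fin_cases i <;> fin_cases j <;> simp at hij ⊢ <;> ring

/-- The row version, which gives invariance under the lower unipotent group on the left. -/
theorem minorProd_add_row {p q r : ℕ} {A B : Mat6} {i j : Fin 3} (hij : j < i) {z : ℂ}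
    (h : ∀ k l : Fin 3, B (Sum.inl k) (Sum.inl l) = A (Sum.inl k) (Sum.inl l) +
      if i = k then z * A (Sum.inl j) (Sum.inl l) else 0) :
    minorProd p q r B = minorProd p q r A := by
  simp only [minorProd, minorThree, h]
  congr 1
  · congr 1
    · fin_cases i <;> fin_cases j <;> simp at hij ⊢
    · congr 1
      fin_cases i <;> fin_cases j <;> simp at hij ⊢ <;> ring
  · congr 1
    fin_cases i <;> fin_cases j <;> simp at hij ⊢ <;> ring

/-- Scaling the columns multiplies the k-th leading minor by t₁⋯tₖ, which explains the exponents
p+q+r, q+r, r. -/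
theorem minorProd_mul_torusElt (p q r : ℕ) (A : Mat6) (t : Fin 3 → Circle) :
    minorProd p q r (A * umat (torusElt t)) =
      torusChar ![(p + q + r : ℕ), (q + r : ℕ), (r : ℕ)] t * minorProd p q r A := by
  have h : ∀ i j : Fin 3, (A * umat (torusElt t)) (Sum.inl i) (Sum.inl j) =
      A (Sum.inl i) (Sum.inl j) * t j := by
    intro i j
    rw [umat_torusElt, Matrix.mul_apply, Fintype.sum_sum_type]
    simp [Matrix.diagonal_apply]
  rw [coe_torusChar, Fin.prod_univ_three]
  simp only [minorProd, minorThree, h]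
  simp only [Matrix.cons_val, zpow_natCast, pow_add]
  have h2 : ∀ x y z w u v : ℂ, x * u * (y * v) - z * v * (w * u) = (u * v) * (x * y - z * w) :=
    fun x y z w u v => by ring
  rw [h2]
  have h3 : minorThree (A * umat (torusElt t)) =
      (t 0 * t 1 * t 2 : ℂ) * minorThree A := by
    simp only [minorThree, h]
    ring
  simp only [minorThree, h] at h3
  rw [h3]
  simp only [mul_pow]
  ring

theorem mul_rootX_apply (A : Mat6) (i j k l : Fin 3) :
    (A * rootX i j) (Sum.inl k) (Sum.inl l) = if j = l then A (Sum.inl k) (Sum.inl i) else 0 := by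
  rw [rootX, Matrix.mul_apply, Fintype.sum_sum_type]
  simp [Matrix.single_apply, ite_and]

theorem mul_rootY_apply (A : Mat6) (i j k l : Fin 3) :
    (A * rootY i j) (Sum.inl k) (Sum.inl l) = 0 := by
  rw [rootY, Matrix.mul_apply, Fintype.sum_sum_type]
  simp

theorem rootX_mul_apply (A : Mat6) (i j k l : Fin 3) :
    (rootX i j * A) (Sum.inl k) (Sum.inl l) = if i = k then A (Sum.inl j) (Sum.inl l) else 0 := by
  rw [rootX, Matrix.mul_apply, Fintype.sum_sum_type]
  simp [Matrix.single_apply, ite_and]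

theorem rootZ_mul_apply (A : Mat6) (i j k l : Fin 3) :
    (rootZ i j * A) (Sum.inl k) (Sum.inl l) = 0 := by
  rw [rootZ, Matrix.mul_apply, Fintype.sum_sum_type]
  simp

theorem fderiv_eq_zero_of_line_const {F : Mat6 → ℂ} (hF : Differentiable ℂ F) {x d : Mat6}
    (h : ∀ z : ℂ, F (x + z • d) = F x) : fderiv ℂ F x d = 0 := by
  have h1 := (hF x).hasFDerivAt.hasLineDerivAt d
  have h2 : HasDerivAt (fun z : ℂ => F (x + z • d)) 0 0 := by
    simp only [h]
    exact hasDerivAt_const _ _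
  exact HasDerivAt.unique h1 h2

theorem fderiv_minorProd_mul_rootX (p q r : ℕ) (A : Mat6) {i j : Fin 3} (hij : i < j) :
    fderiv ℂ (minorProd p q r) A (A * rootX i j) = 0 := by
  refine fderiv_eq_zero_of_line_const (differentiable_minorProd p q r) fun z => ?_
  refine minorProd_add_column hij (z := z) fun k l => ?_
  rw [Matrix.add_apply, Matrix.smul_apply, mul_rootX_apply]
  split_ifs <;> simp

theorem fderiv_minorProd_mul_rootY (p q r : ℕ) (A : Mat6) (i j : Fin 3) :
    fderiv ℂ (minorProd p q r) A (A * rootY i j) = 0 := by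
  refine fderiv_eq_zero_of_line_const (differentiable_minorProd p q r) fun z => ?_
  refine minorProd_congr fun k l => ?_
  rw [Matrix.add_apply, Matrix.smul_apply, mul_rootY_apply]
  simp

theorem fderiv_minorProd_rootX_mul (p q r : ℕ) (A : Mat6) {i j : Fin 3} (hij : j < i) :
    fderiv ℂ (minorProd p q r) A (rootX i j * A) = 0 := by
  refine fderiv_eq_zero_of_line_const (differentiable_minorProd p q r) fun z => ?_
  refine minorProd_add_row hij (z := z) fun k l => ?_
  rw [Matrix.add_apply, Matrix.smul_apply, rootX_mul_apply]
  split_ifs <;> simp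

theorem fderiv_minorProd_rootZ_mul (p q r : ℕ) (A : Mat6) (i j : Fin 3) :
    fderiv ℂ (minorProd p q r) A (rootZ i j * A) = 0 := by
  refine fderiv_eq_zero_of_line_const (differentiable_minorProd p q r) fun z => ?_
  refine minorProd_congr fun k l => ?_
  rw [Matrix.add_apply, Matrix.smul_apply, rootZ_mul_apply]
  simp

end

/-! ### A model of the highest weight coefficient inside functions on USp(6). -/

noncomputable section

attribute [local instance] Matrix.linftyOpNormedRing Matrix.linftyOpNormedAlgebra

section

variable {V W : Type*} [AddCommGroup V] [Module ℂ V] [AddCommGroup W] [Module ℂ W]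

/-- Intertwining operators commute with the derivatives. -/
theorem IsInfinitesimal.map_apply {ρ : Representation ℂ USp6 V}
    {L : Mat6 →ₗ[ℂ] Module.End ℂ V} {σ : Representation ℂ USp6 W} {K : Mat6 →ₗ[ℂ] Module.End ℂ W}
    (hL : IsInfinitesimal ρ L) (hK : IsInfinitesimal σ K) (T : V →ₗ[ℂ] W)
    (hT : ∀ g v, T (ρ g v) = σ g (T v)) {X : Mat6} (hX : X ∈ sp6) (v : V) :
    T (L X v) = K X (T v) := by
  refine IsInfinitesimal.eqOn_sp6 (S := T ∘ₗ LinearMap.applyₗ v ∘ₗ L)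
    (T := LinearMap.applyₗ (T v) ∘ₗ K) (fun X hX => ?_) hX
  refine eq_of_forall_dual_eq fun ψ => ?_
  have h1 := hL.hasDerivAt_exp hX (ψ ∘ₗ T) v
  have h2 := hK.hasDerivAt_exp hX ψ (T v)
  simp only [← hT] at h2
  exact h1.unique h2

theorem IsContinuousRep.prod {ρ : Representation ℂ USp6 V} {σ : Representation ℂ USp6 W}
    (hρ : IsContinuousRep ρ) (hσ : IsContinuousRep σ) : IsContinuousRep (ρ.prod σ) := by
  intro ψ w
  have h := (hρ (ψ ∘ₗ LinearMap.inl ℂ _ _) w.1).add (hσ (ψ ∘ₗ LinearMap.inr ℂ _ _) w.2)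
  refine h.congr fun g => ?_
  change ψ (ρ g w.1, 0) + ψ (0, σ g w.2) = ψ (ρ g w.1, σ g w.2)
  rw [← map_add, Prod.mk_add_mk, add_zero, zero_add]

theorem IsInfinitesimal.prod_apply {ρ : Representation ℂ USp6 V} {σ : Representation ℂ USp6 W}
    {L : Mat6 →ₗ[ℂ] Module.End ℂ V} {M : Mat6 →ₗ[ℂ] Module.End ℂ W}
    {K : Mat6 →ₗ[ℂ] Module.End ℂ (V × W)} (hL : IsInfinitesimal ρ L) (hM : IsInfinitesimal σ M)
    (hK : IsInfinitesimal (ρ.prod σ) K) {X : Mat6} (hX : X ∈ sp6) (w : V × W) :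
    K X w = (L X w.1, M X w.2) :=
  Prod.ext (hK.map_apply hL (LinearMap.fst ℂ _ _) (fun _ _ => rfl) hX w)
    (hK.map_apply hM (LinearMap.snd ℂ _ _) (fun _ _ => rfl) hX w)

/-- Matrix coefficients of highest weight vectors of the same weight against functionals killed
by the negative root vectors agree as soon as they agree at the identity. -/
theorem coeff_eq_coeff [FiniteDimensional ℂ V] [FiniteDimensional ℂ W]
    {ρ : Representation ℂ USp6 V} {σ : Representation ℂ USp6 W}
    (hρ : IsContinuousRep ρ) (hσ : IsContinuousRep σ)
    {L : Mat6 →ₗ[ℂ] Module.End ℂ V} {M : Mat6 →ₗ[ℂ] Module.End ℂ W}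
    (hL : IsInfinitesimal ρ L) (hM : IsInfinitesimal σ M) {μ : Fin 3 → ℤ} {v : V} {w : W}
    (hv : IsHighestVector L μ v) (hw : IsHighestVector M μ w)
    {φ : Module.Dual ℂ V} {ψ : Module.Dual ℂ W}
    (hφ : IsLowestFunctional L φ) (hψ : IsLowestFunctional M ψ) (h0 : φ v = ψ w) (g : USp6) :
    φ (ρ g v) = ψ (σ g w) := by
  -- In the direct sum, (v, w) is again a highest weight vector, and the difference of the two
  -- functionals vanishes on it.
  obtain ⟨K, hK⟩ := exists_isInfinitesimal (ρ.prod σ) (hρ.prod hσ)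
  have hK' : ∀ X ∈ sp6, ∀ x, K X x = (L X x.1, M X x.2) := fun X hX x =>
    hL.prod_apply hM hK hX x
  have hx : IsHighestVector K μ (v, w) := by
    refine ⟨fun i => ?_, fun i j hij => ?_, fun i j => ?_⟩
    · rw [hK' _ (rootX_mem i i), hv.diag, hw.diag]
      rfl
    · rw [hK' _ (rootX_mem i j), hv.rootX i j hij, hw.rootX i j hij]
      rfl
    · rw [hK' _ (rootY_mem i j), hv.rootY, hw.rootY]
      rfl
  let Φ : Module.Dual ℂ (V × W) := φ ∘ₗ LinearMap.fst ℂ _ _ - ψ ∘ₗ LinearMap.snd ℂ _ _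
  have hΦ : ∀ x, Φ x = φ x.1 - ψ x.2 := fun x => rfl
  have hΦL : IsLowestFunctional K Φ := by
    refine ⟨fun i j hij x => ?_, fun i j x => ?_⟩
    · rw [hK' _ (rootX_mem i j), hΦ, hφ.rootX i j hij, hψ.rootX i j hij, sub_zero]
    · rw [hK' _ (rootZ_mem i j), hΦ, hφ.rootZ, hψ.rootZ, sub_zero]
  have h2 := hK.coeff_eq_zero hx hΦL (by rw [hΦ, h0, sub_self]) g
  exact sub_eq_zero.1 h2

end

/-- Right translation of functions on `USp(6)`. -/
def rightTranslation : Representation ℂ USp6 (USp6 → ℂ) where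
  toFun h := LinearMap.funLeft ℂ ℂ fun g => g * h
  map_one' := by
    ext f g
    simp [LinearMap.funLeft]
  map_mul' h k := by
    ext f g
    simp [LinearMap.funLeft, mul_assoc]

theorem rightTranslation_apply (h g : USp6) (f : USp6 → ℂ) :
    rightTranslation h f g = f (g * h) := rfl

/-- The right translate by `h` of the product of minors, as a function on `USp(6)`. -/
def minorFun (p q r : ℕ) (h : USp6) : USp6 → ℂ := fun g => minorProd p q r (umat g * umat h)

/-- The space spanned by the right translates of the product of minors. -/
def minorSpace (p q r : ℕ) : Submodule ℂ (USp6 → ℂ) :=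
  Submodule.span ℂ (Set.range (minorFun p q r))

theorem minorFun_mem (p q r : ℕ) (h : USp6) : minorFun p q r h ∈ minorSpace p q r :=
  Submodule.subset_span ⟨h, rfl⟩

theorem rightTranslation_minorFun (p q r : ℕ) (h k : USp6) :
    rightTranslation k (minorFun p q r h) = minorFun p q r (k * h) := by
  funext g
  rw [rightTranslation_apply, minorFun, minorFun, USp6.mat_mul, USp6.mat_mul, mul_assoc]

theorem rightTranslation_mem (p q r : ℕ) (k : USp6) (f : USp6 → ℂ)
    (hf : f ∈ minorSpace p q r) : rightTranslation k f ∈ minorSpace p q r := by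
  suffices h : minorSpace p q r ≤ (minorSpace p q r).comap (rightTranslation k) from h hf
  rw [minorSpace, Submodule.span_le]
  rintro _ ⟨h, rfl⟩
  rw [SetLike.mem_coe, Submodule.mem_comap, rightTranslation_minorFun]
  exact minorFun_mem p q r _

/-- The span of the coordinate functions. -/
def coordSpan : Submodule ℂ (USp6 → ℂ) :=
  Submodule.span ℂ (Set.range fun p : (Fin 3 ⊕ Fin 3) × (Fin 3 ⊕ Fin 3) =>
    fun g : USp6 => umat g p.1 p.2)

theorem entry_mul_mem_coordSpan (h : USp6) (i j : Fin 3 ⊕ Fin 3) :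
    (fun g : USp6 => (umat g * umat h) i j) ∈ coordSpan := by
  have h1 : (fun g : USp6 => (umat g * umat h) i j) =
      ∑ k, umat h k j • fun g : USp6 => umat g i k := by
    funext g
    simp [Matrix.mul_apply, mul_comm]
  rw [h1]
  exact Submodule.sum_mem _ fun k _ => Submodule.smul_mem _ _ (Submodule.subset_span ⟨(i, k), rfl⟩)

/-- All translates are polynomials in the entries of g of the same degree: each lies in a fixed
product of powers of the span of the coordinates. -/
instance minorSpace_finiteDimensional (p q r : ℕ) : FiniteDimensional ℂ (minorSpace p q r) := by
  have hfg : coordSpan.FG := Submodule.fg_span (Set.finite_range _)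
  let N : Submodule ℂ (USp6 → ℂ) :=
    coordSpan ^ p * (coordSpan * coordSpan) ^ q * (coordSpan * (coordSpan * coordSpan)) ^ r
  have hN : N.FG := ((hfg.pow p).mul ((hfg.mul hfg).pow q)).mul ((hfg.mul (hfg.mul hfg)).pow r)
  have : FiniteDimensional ℂ N := Module.Finite.iff_fg.2 hN
  refine Submodule.finiteDimensional_of_le (S₂ := N) ?_
  rw [minorSpace, Submodule.span_le]
  rintro _ ⟨h, rfl⟩
  have he := entry_mul_mem_coordSpan h
  have h2 : ∀ i j k l, (fun g : USp6 => (umat g * umat h) i j * (umat g * umat h) k l) ∈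
      coordSpan * coordSpan := fun i j k l => Submodule.mul_mem_mul (he i j) (he k l)
  have h3 : (fun g : USp6 => minorThree (umat g * umat h)) ∈
      coordSpan * (coordSpan * coordSpan) := by
    unfold minorThree
    exact Submodule.add_mem _ (Submodule.sub_mem _
      (Submodule.mul_mem_mul (he _ _) (Submodule.sub_mem _ (h2 _ _ _ _) (h2 _ _ _ _)))
      (Submodule.mul_mem_mul (he _ _) (Submodule.sub_mem _ (h2 _ _ _ _) (h2 _ _ _ _))))
      (Submodule.mul_mem_mul (he _ _) (Submodule.sub_mem _ (h2 _ _ _ _) (h2 _ _ _ _)))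
  exact Submodule.mul_mem_mul (Submodule.mul_mem_mul (Submodule.pow_mem_pow _ (he _ _) p)
    (Submodule.pow_mem_pow _ (Submodule.sub_mem _ (h2 _ _ _ _) (h2 _ _ _ _)) q))
    (Submodule.pow_mem_pow _ h3 r)

/-- The representation of `USp(6)` on the span of the translates of the product of minors. -/
def minorRep (p q r : ℕ) : Representation ℂ USp6 (minorSpace p q r) where
  toFun k := (rightTranslation k).restrict (rightTranslation_mem p q r k)
  map_one' := by
    ext f g
    simp
  map_mul' h k := by
    ext f g
    simp

/-- Evaluation at a group element, as a functional on the space of translates. -/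
def evalFunctional (p q r : ℕ) (g : USp6) : Module.Dual ℂ (minorSpace p q r) :=
  (LinearMap.proj g : (USp6 → ℂ) →ₗ[ℂ] ℂ) ∘ₗ (minorSpace p q r).subtype

theorem continuous_of_mem_minorSpace {p q r : ℕ} {f : USp6 → ℂ} (hf : f ∈ minorSpace p q r) :
    Continuous f := by
  refine Submodule.span_induction ?_ continuous_zero (fun _ _ _ _ hx hy => hx.add hy)
    (fun c _ _ hx => hx.const_smul c) hf
  rintro _ ⟨h, rfl⟩
  exact (differentiable_minorProd p q r).continuous.comp
    (USp6.continuous_mat.matrix_mul continuous_const)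

/-- Evaluations separate the functions, so they span the finite-dimensional dual; for an evaluation
the coefficient is a translate of a continuous function. -/
theorem minorRep_continuous (p q r : ℕ) : IsContinuousRep (minorRep p q r) := by
  intro ψ f
  let S : Submodule ℂ (Module.Dual ℂ (minorSpace p q r)) :=
    Submodule.span ℂ (Set.range (evalFunctional p q r))
  have hS : S = ⊤ := by
    rw [← Subspace.dualCoannihilator_dualAnnihilator_eq (W := S), eq_top_iff]
    intro φ _
    rw [Submodule.mem_dualAnnihilator]
    intro u hu
    rw [Submodule.mem_dualCoannihilator] at hu
    have h0 : u = 0 := by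
      refine Subtype.ext (funext fun g => ?_)
      exact hu _ (Submodule.subset_span ⟨g, rfl⟩)
    rw [h0, map_zero]
  have hψ : ψ ∈ S := by
    rw [hS]
    trivial
  refine Submodule.span_induction (p := fun ψ _ => Continuous fun k => ψ (minorRep p q r k f))
    ?_ ?_ ?_ ?_ hψ
  · rintro _ ⟨g, rfl⟩
    exact (continuous_of_mem_minorSpace f.2).comp (continuous_const.mul continuous_id)
  · exact continuous_const
  · exact fun _ _ _ _ hx hy => hx.add hy
  · exact fun c _ _ hx => hx.const_smul c

theorem minorRep_infinitesimal_apply {p q r : ℕ}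
    {K : Mat6 →ₗ[ℂ] Module.End ℂ (minorSpace p q r)} (hK : IsInfinitesimal (minorRep p q r) K)
    {X : Mat6} (hX : X ∈ sp6) (h g : USp6) :
    (K X ⟨minorFun p q r h, minorFun_mem p q r h⟩ : USp6 → ℂ) g =
      fderiv ℂ (minorProd p q r) (umat g * umat h) (umat g * X * umat h) := by
  refine IsInfinitesimal.eqOn_sp6
    (S := evalFunctional p q r g ∘ₗ LinearMap.applyₗ
      (⟨minorFun p q r h, minorFun_mem p q r h⟩ : minorSpace p q r) ∘ₗ K)
    (T := (fderiv ℂ (minorProd p q r) (umat g * umat h)).toLinearMap ∘ₗ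
      LinearMap.mulRight ℂ (umat h) ∘ₗ LinearMap.mulLeft ℂ (umat g)) (fun X hX => ?_) hX
  have h1 := hK.hasDerivAt_exp hX (evalFunctional p q r g)
    ⟨minorFun p q r h, minorFun_mem p q r h⟩
  have h2 := hasDerivAt_comp_curve (differentiable_minorProd p q r)
    (hasDerivAt_mul_curve_mul (umat g) (umat h) (hasDerivAt_exp_smul_zero X))
  simp only [zero_smul, NormedSpace.exp_zero, mul_one] at h2
  exact h1.unique h2

/-- At the identity, infinitesimal right translation of a translated minor product becomes
infinitesimal left multiplication of its argument, so left invariance makes evaluation at 1 a lowest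
functional. -/
theorem minorRep_infinitesimal_apply_one {p q r : ℕ}
    {K : Mat6 →ₗ[ℂ] Module.End ℂ (minorSpace p q r)} (hK : IsInfinitesimal (minorRep p q r) K)
    {X : Mat6} (hX : X ∈ sp6) (hA : ∀ A, fderiv ℂ (minorProd p q r) A (X * A) = 0)
    (f : minorSpace p q r) : (K X f : USp6 → ℂ) 1 = 0 := by
  obtain ⟨f, hf⟩ := f
  induction hf using Submodule.span_induction with
  | mem f hf =>
    obtain ⟨h, rfl⟩ := hf
    refine (minorRep_infinitesimal_apply hK hX h 1).trans ?_
    rw [USp6.mat_one, one_mul, one_mul, hA]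
  | zero =>
    have h0 : (⟨0, Submodule.zero_mem _⟩ : minorSpace p q r) = 0 := rfl
    rw [h0, map_zero]
    rfl
  | add x y hx hy h1 h2 =>
    have h0 : (⟨x + y, Submodule.add_mem _ hx hy⟩ : minorSpace p q r) = ⟨x, hx⟩ + ⟨y, hy⟩ := rfl
    rw [h0, map_add, Submodule.coe_add, Pi.add_apply, h1, h2, add_zero]
  | smul c x hx h1 =>
    have h0 : (⟨c • x, Submodule.smul_mem _ c hx⟩ : minorSpace p q r) = c • ⟨x, hx⟩ := rfl
    rw [h0, map_smul, Submodule.coe_smul, Pi.smul_apply, h1, smul_zero]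

variable {V : Type*} [AddCommGroup V] [Module ℂ V] [FiniteDimensional ℂ V]

theorem minorRep_isHighestVector {p q r : ℕ}
    {K : Mat6 →ₗ[ℂ] Module.End ℂ (minorSpace p q r)} (hK : IsInfinitesimal (minorRep p q r) K) :
    IsHighestVector K ![(p + q + r : ℕ), (q + r : ℕ), (r : ℕ)]
      ⟨minorFun p q r 1, minorFun_mem p q r 1⟩ := by
  refine ⟨hK.rootX_diag_apply fun t => ?_, fun i j hij => ?_, fun i j => ?_⟩
  · refine Subtype.ext (funext fun g => ?_)
    change minorProd p q r (umat g * umat (torusElt t) * 1) = _ * minorProd p q r (umat g * 1)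
    rw [mul_one, mul_one]
    exact minorProd_mul_torusElt p q r _ t
  · refine Subtype.ext (funext fun g => ?_)
    rw [minorRep_infinitesimal_apply hK (rootX_mem i j), USp6.mat_one, mul_one, mul_one,
      fderiv_minorProd_mul_rootX p q r _ hij]
    rfl
  · refine Subtype.ext (funext fun g => ?_)
    rw [minorRep_infinitesimal_apply hK (rootY_mem i j), USp6.mat_one, mul_one, mul_one,
      fderiv_minorProd_mul_rootY p q r]
    rfl

theorem minorRep_isLowestFunctional {p q r : ℕ}
    {K : Mat6 →ₗ[ℂ] Module.End ℂ (minorSpace p q r)} (hK : IsInfinitesimal (minorRep p q r) K) :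
    IsLowestFunctional K (evalFunctional p q r 1) where
  rootX i j hij f := minorRep_infinitesimal_apply_one hK (rootX_mem i j)
    (fun A => fderiv_minorProd_rootX_mul p q r A hij) f
  rootZ i j f := minorRep_infinitesimal_apply_one hK (rootZ_mem i j)
    (fun A => fderiv_minorProd_rootZ_mul p q r A i j) f

/-- The matrix coefficient of the highest weight vector is a product of powers of minors. -/
theorem highest_coeff_eq_minorProd {ρ : Representation ℂ USp6 V} (hcont : IsContinuousRep ρ)
    {L : Mat6 →ₗ[ℂ] Module.End ℂ V} (hL : IsInfinitesimal ρ L) (p q r : ℕ) {v : V}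
    (hv : IsHighestVector L ![(p + q + r : ℕ), (q + r : ℕ), (r : ℕ)] v) {φ : Module.Dual ℂ V}
    (hφ : IsLowestFunctional L φ) (h1 : φ v = 1)
    (g : USp6) : φ (ρ g v) = minorProd p q r (umat g) := by
  obtain ⟨K, hK⟩ := exists_isInfinitesimal (minorRep p q r) (minorRep_continuous p q r)
  have h := coeff_eq_coeff hcont (minorRep_continuous p q r) hL hK hv
    (minorRep_isHighestVector hK) hφ (minorRep_isLowestFunctional hK)
    (by
      rw [h1]
      change 1 = minorProd p q r (1 * 1)
      rw [one_mul, minorProd_one]) g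
  rw [h]
  change minorProd p q r (1 * umat g * 1) = _
  rw [one_mul, mul_one]

end

/-! ### The normalizer of U(3). -/

noncomputable section
open Matrix

/-- The matrix `J` as an element of `USp(6)`. -/
def elementJ : USp6 :=
  USp6.ofMat (Matrix.J (Fin 3) ℂ)
    (by
      have h : star (Matrix.J (Fin 3) ℂ) = -Matrix.J (Fin 3) ℂ := by
        rw [star_eq_conjTranspose, Matrix.J, fromBlocks_conjTranspose, fromBlocks_neg]
        simp
      rw [h, mul_neg, J_mul_J, neg_neg])
    (by rw [transpose_J, mul_neg, J_mul_J, neg_mul, one_mul, neg_neg])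

theorem umat_elementJ : umat elementJ = Matrix.J (Fin 3) ℂ := rfl

theorem umat_elementJ_inv : umat elementJ⁻¹ = -Matrix.J (Fin 3) ℂ := by
  change star (Matrix.J (Fin 3) ℂ) = _
  rw [star_eq_conjTranspose, Matrix.J, fromBlocks_conjTranspose, fromBlocks_neg]
  simp

theorem umat_embedU3 (u : unitaryGroup (Fin 3) ℂ) :
    umat (embedU3 u) = fromBlocks u.1 0 0 (u.1.map star) := rfl

theorem embedU3_mem (u : unitaryGroup (Fin 3) ℂ) : embedU3 u ∈ U3 := ⟨u, rfl⟩

/-- The entrywise conjugate of a unitary matrix. -/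
def conjUnitary (u : unitaryGroup (Fin 3) ℂ) : unitaryGroup (Fin 3) ℂ :=
  ⟨u.1.map star, by
    have h := mem_unitaryGroup_iff.1 u.2
    rw [mem_unitaryGroup_iff]
    have h2 := congrArg (fun M : Matrix (Fin 3) (Fin 3) ℂ => M.map star) h
    have hm : ∀ A B : Matrix (Fin 3) (Fin 3) ℂ, (A * B).map star = A.map star * B.map star :=
      fun A B => Matrix.map_mul (f := starRingEnd ℂ)
    simp only [hm] at h2
    rw [Matrix.map_one star (star_zero ℂ) (star_one ℂ)] at h2
    exact h2⟩

theorem elementJ_conj_embedU3 (u : unitaryGroup (Fin 3) ℂ) :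
    elementJ * embedU3 u * elementJ⁻¹ = embedU3 (conjUnitary u) := by
  refine USp6.mat_injective ?_
  change umat elementJ * umat (embedU3 u) * umat elementJ⁻¹ = umat (embedU3 (conjUnitary u))
  rw [umat_elementJ, umat_elementJ_inv, umat_embedU3, umat_embedU3, Matrix.J, fromBlocks_neg,
    fromBlocks_multiply, fromBlocks_multiply]
  congr 1
  · simp [conjUnitary]
  · simp
  · simp
  · ext i j
    simp [conjUnitary]

theorem elementJ_inv_conj (x : USp6) :
    elementJ⁻¹ * x * elementJ = elementJ * x * elementJ⁻¹ := by
  refine USp6.mat_injective ?_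
  change umat elementJ⁻¹ * umat x * umat elementJ = umat elementJ * umat x * umat elementJ⁻¹
  rw [umat_elementJ, umat_elementJ_inv]
  simp

theorem elementJ_mem_NU3 : elementJ ∈ NU3 := by
  rw [NU3, Subgroup.mem_normalizer_iff]
  intro x
  constructor
  · rintro ⟨u, rfl⟩
    rw [elementJ_conj_embedU3]
    exact embedU3_mem _
  · rintro ⟨u, hu⟩
    have h : x = elementJ⁻¹ * (elementJ * x * elementJ⁻¹) * elementJ := by group
    rw [h, ← hu, elementJ_inv_conj, elementJ_conj_embedU3]
    exact embedU3_mem _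

/-- The imaginary unit as a point of the circle. -/
def circleI : Circle := ⟨Complex.I, mem_sphere_zero_iff_norm.2 Complex.norm_I⟩

theorem coe_circleI : (circleI : ℂ) = Complex.I := rfl

/-- The scalar `i` in the center of `U(3)`. -/
def centralI : USp6 := torusElt fun _ => circleI

theorem umat_centralI :
    umat centralI = fromBlocks (Complex.I • 1) 0 0 (-(Complex.I • 1)) := by
  rw [centralI, umat_torusElt]
  congr 1
  · ext i j
    by_cases h : i = j <;> simp [h, coe_circleI]
  · ext i j
    by_cases h : i = j <;> simp [h, coe_circleI]

theorem centralI_mem : centralI ∈ U3 := embedU3_mem _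

/-- Commuting with diag(i, −i) kills the off-diagonal blocks; unitarity and symplecticity then force
the second diagonal block to be the conjugate of the first. -/
theorem mem_U3_of_commute {g : USp6} (h : g * centralI = centralI * g) : g ∈ U3 := by
  have h1 : umat g * umat centralI = umat centralI * umat g := congrArg umat h
  rw [umat_centralI, ← fromBlocks_toBlocks (umat g), fromBlocks_multiply, fromBlocks_multiply,
    fromBlocks_inj] at h1
  obtain ⟨-, h12, h21, -⟩ := h1
  simp only [mul_zero, mul_neg, zero_add, zero_mul, add_zero, mul_smul_comm, mul_one,
    smul_mul_assoc, one_mul, neg_mul] at h12 h21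
  have hz : ∀ M : Matrix (Fin 3) (Fin 3) ℂ, -(Complex.I • M) = Complex.I • M → M = 0 := by
    intro M hM
    ext i j
    have h1 : -(Complex.I * M i j) = Complex.I * M i j := congrFun (congrFun hM i) j
    have h2 : Complex.I * M i j = 0 := self_eq_neg.1 h1.symm
    simpa using h2
  have hB := hz _ h12
  have hC := hz _ h21.symm
  have hg : umat g = fromBlocks (umat g).toBlocks₁₁ 0 0 (umat g).toBlocks₂₂ := by
    conv_lhs => rw [← fromBlocks_toBlocks (umat g), hB, hC]
  have hu := USp6.mat_mul_star g
  rw [hg, star_eq_conjTranspose, fromBlocks_conjTranspose, fromBlocks_multiply, ← fromBlocks_one,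
    fromBlocks_inj] at hu
  have hA : (umat g).toBlocks₁₁ * (umat g).toBlocks₁₁ᴴ = 1 := by simpa using hu.1
  have hs := USp6.mat_J g
  rw [hg, fromBlocks_transpose, Matrix.J, fromBlocks_multiply, fromBlocks_multiply,
    fromBlocks_inj] at hs
  have hAD : (umat g).toBlocks₁₁ * (umat g).toBlocks₂₂ᵀ = 1 := by simpa using hs.2.1
  have hD : (umat g).toBlocks₂₂ = (umat g).toBlocks₁₁.map star := by
    have hD1 : (umat g).toBlocks₂₂ᵀ = (umat g).toBlocks₁₁ᴴ :=
      left_inv_eq_right_inv (mul_eq_one_comm.1 hAD) hA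
    have := congrArg transpose hD1
    rw [transpose_transpose] at this
    exact this
  refine ⟨⟨(umat g).toBlocks₁₁, mem_unitaryGroup_iff.2 hA⟩, USp6.mat_injective ?_⟩
  change fromBlocks (umat g).toBlocks₁₁ 0 0 ((umat g).toBlocks₁₁.map star) = umat g
  rw [← hD, ← hg]

/-- A matrix commuting with all unitary matrices is a scalar. -/
theorem exists_scalar_of_commute {B : Matrix (Fin 3) (Fin 3) ℂ}
    (h : ∀ u : unitaryGroup (Fin 3) ℂ, B * u.1 = u.1 * B) : ∃ β : ℂ, B = β • 1 := by
  have hdiag : ∀ i j, i ≠ j → B i j = 0 := by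
    intro i j hij
    have h1 : (B * diagonal fun k => ((Pi.mulSingle i circleI : Fin 3 → Circle) k : ℂ)) i j =
        ((diagonal fun k => ((Pi.mulSingle i circleI : Fin 3 → Circle) k : ℂ)) * B) i j :=
      congrFun (congrFun (h (diagU3 (Pi.mulSingle i circleI))) i) j
    rw [mul_diagonal, diagonal_mul, Pi.mulSingle_eq_same, Pi.mulSingle_eq_of_ne hij.symm] at h1
    have h2 : (1 - Complex.I) * B i j = 0 := by
      have h3 : B i j * 1 = Complex.I * B i j := h1
      rw [sub_mul, one_mul, ← h3, mul_one, sub_self]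
    rcases mul_eq_zero.1 h2 with h3 | h3
    · exfalso
      have := congrArg Complex.im h3
      simp at this
    · exact h3
  have hperm : ∀ i j, B i i = B j j := by
    intro i j
    let σ := Equiv.swap i j
    have hσ : σ.permMatrix ℂ ∈ unitaryGroup (Fin 3) ℂ := by
      rw [mem_unitaryGroup_iff, star_eq_conjTranspose, conjTranspose_permMatrix,
        ← permMatrix_mul]
      simp
    have h1 : (B * (σ.toPEquiv.toMatrix : Matrix (Fin 3) (Fin 3) ℂ)) i j =
        ((σ.toPEquiv.toMatrix : Matrix (Fin 3) (Fin 3) ℂ) * B) i j :=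
      congrFun (congrFun (h ⟨_, hσ⟩) i) j
    rw [PEquiv.mul_toMatrix_toPEquiv, PEquiv.toMatrix_toPEquiv_mul] at h1
    simpa [σ] using h1
  refine ⟨B 0 0, ?_⟩
  ext i j
  by_cases hij : i = j
  · subst hij
    simp [hperm i 0]
  · simp [hij, hdiag i j hij]

/-- The normalizer of `U(3)` is the union of `U(3)` and the coset of `J`. -/
theorem mem_NU3_iff (g : USp6) : g ∈ NU3 ↔ g ∈ U3 ∨ elementJ⁻¹ * g ∈ U3 := by
  constructor
  · intro hg
    have hg1 := hg
    rw [NU3, Subgroup.mem_normalizer_iff] at hg1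
    -- Conjugation by g preserves the center of U(3), so this central element goes to a scalar β of
    -- U(3) with β² = −1. The two values of β separate the two cosets.
    obtain ⟨B, hB⟩ := (hg1 centralI).1 centralI_mem
    have hcomm : ∀ u : unitaryGroup (Fin 3) ℂ, B.1 * u.1 = u.1 * B.1 := by
      intro u
      have h1 := (hg1 (g⁻¹ * embedU3 u * g)).2 (by
        have : g * (g⁻¹ * embedU3 u * g) * g⁻¹ = embedU3 u := by group
        rw [this]
        exact embedU3_mem u)
      obtain ⟨u', hu'⟩ := h1
      have hz : embedU3 u' * centralI = centralI * embedU3 u' := by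
        refine USp6.mat_injective ?_
        change umat (embedU3 u') * umat centralI = umat centralI * umat (embedU3 u')
        rw [umat_centralI, umat_embedU3, fromBlocks_multiply, fromBlocks_multiply]
        simp
      have h2 : embedU3 B * embedU3 u = embedU3 u * embedU3 B := by
        have h3 : embedU3 u = g * embedU3 u' * g⁻¹ := by
          rw [hu']
          group
        rw [hB, h3]
        calc g * centralI * g⁻¹ * (g * embedU3 u' * g⁻¹)
            = g * (centralI * embedU3 u') * g⁻¹ := by group
          _ = g * (embedU3 u' * centralI) * g⁻¹ := by rw [hz]
          _ = _ := by group
      have h4 : umat (embedU3 B) * umat (embedU3 u) = umat (embedU3 u) * umat (embedU3 B) :=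
        congrArg umat h2
      rw [umat_embedU3, umat_embedU3, fromBlocks_multiply, fromBlocks_multiply,
        fromBlocks_inj] at h4
      simpa using h4.1
    obtain ⟨β, hβ⟩ := exists_scalar_of_commute hcomm
    have hsq : β * β = -1 := by
      have h1 : umat (embedU3 B) * umat (embedU3 B) = -1 := by
        have h2 : embedU3 B * embedU3 B = g * (centralI * centralI) * g⁻¹ := by
          rw [hB]
          group
        have h3 : umat (centralI * centralI) = -1 := by
          rw [USp6.mat_mul, umat_centralI, fromBlocks_multiply, ← fromBlocks_one, fromBlocks_neg]
          simp [smul_smul]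
        have h4 : umat (embedU3 B * embedU3 B) = umat g * umat (centralI * centralI) * umat g⁻¹ :=
          congrArg umat h2
        rw [h3, mul_neg, mul_one, neg_mul, ← USp6.mat_mul, mul_inv_cancel] at h4
        exact h4
      rw [umat_embedU3, fromBlocks_multiply, ← fromBlocks_one, fromBlocks_neg,
        fromBlocks_inj] at h1
      have h5 := congrFun (congrFun h1.1 0) 0
      rw [hβ] at h5
      simpa using h5
    have hor : β = Complex.I ∨ β = -Complex.I := by
      have h1 : (β - Complex.I) * (β + Complex.I) = 0 := by
        linear_combination hsq - Complex.I_mul_I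
      rcases mul_eq_zero.1 h1 with h | h
      · exact Or.inl (sub_eq_zero.1 h)
      · exact Or.inr (eq_neg_of_add_eq_zero_left h)
    have hBm : umat (embedU3 B) = fromBlocks (β • 1) 0 0 (star β • 1) := by
      rw [umat_embedU3, hβ]
      congr 1
      ext i j
      by_cases h : i = j <;> simp [h]
    have hgz : umat g * umat centralI = umat (embedU3 B) * umat g := by
      have h1 : g * centralI = embedU3 B * g := by
        rw [hB]
        group
      exact congrArg umat h1
    rcases hor with rfl | rfl
    · left
      refine mem_U3_of_commute (USp6.mat_injective ?_)
      change umat g * umat centralI = umat centralI * umat g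
      rw [hgz, hBm, umat_centralI]
      congr 2
      simp
    -- When β = −i, conjugation by J exchanges i and −i, so J⁻¹g commutes with the central element.
    · right
      refine mem_U3_of_commute (USp6.mat_injective ?_)
      change umat elementJ⁻¹ * umat g * umat centralI = umat centralI * (umat elementJ⁻¹ * umat g)
      rw [mul_assoc, hgz, ← mul_assoc, ← mul_assoc, hBm, umat_centralI, umat_elementJ_inv,
        Matrix.J, fromBlocks_neg, fromBlocks_multiply, fromBlocks_multiply]
      congr 2 <;> simp
  · have hU : U3 ≤ NU3 := Subgroup.le_normalizer
    rintro (h | h)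
    · exact hU h
    · have h1 := NU3.mul_mem elementJ_mem_NU3 (hU h)
      rwa [mul_inv_cancel_left] at h1

end

/-! ### The Cayley transform and the real form of U(3). -/

noncomputable section
open Matrix

attribute [local instance] Matrix.linftyOpNormedRing Matrix.linftyOpNormedAlgebra

/-- The real number `1 / √2`, as a complex number. -/
def invSqrtTwo : ℂ := ((√2)⁻¹ : ℝ)

theorem invSqrtTwo_mul_self : invSqrtTwo * invSqrtTwo = 1 / 2 := by
  rw [invSqrtTwo, ← Complex.ofReal_mul, ← mul_inv, Real.mul_self_sqrt (by norm_num)]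
  norm_num

theorem star_invSqrtTwo : star invSqrtTwo = invSqrtTwo := Complex.conj_ofReal _

/-- The matrix of the Cayley transform that turns `U(3)` into a group of real matrices. -/
def cayleyMat : Mat6 := invSqrtTwo • fromBlocks 1 (Complex.I • 1) (Complex.I • 1) 1

theorem star_cayleyMat :
    star cayleyMat = invSqrtTwo • fromBlocks 1 (-(Complex.I • 1)) (-(Complex.I • 1)) 1 := by
  rw [cayleyMat, star_smul, star_invSqrtTwo, star_eq_conjTranspose, fromBlocks_conjTranspose]
  simp

theorem transpose_cayleyMat : cayleyMatᵀ = cayleyMat := by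
  rw [cayleyMat, transpose_smul, fromBlocks_transpose]
  simp

theorem smul_mul_smul_invSqrtTwo (A B : Mat6) :
    (invSqrtTwo • A) * (invSqrtTwo • B) = (1 / 2 : ℂ) • (A * B) := by
  rw [smul_mul_smul_comm, invSqrtTwo_mul_self]

/-- The Cayley transform in `USp(6)`. -/
def cayley : USp6 :=
  USp6.ofMat cayleyMat
    (by
      rw [star_cayleyMat, cayleyMat, smul_mul_smul_invSqrtTwo, fromBlocks_multiply,
        fromBlocks_smul, ← fromBlocks_one]
      congr 1
      · simp [smul_smul, ← two_smul ℂ (1 : Matrix (Fin 3) (Fin 3) ℂ)]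
      · simp
      · simp
      · simp [smul_smul, ← two_smul ℂ (1 : Matrix (Fin 3) (Fin 3) ℂ)])
    (by
      rw [transpose_cayleyMat, cayleyMat, smul_mul_assoc, smul_mul_smul_invSqrtTwo, Matrix.J,
        fromBlocks_multiply, fromBlocks_multiply, fromBlocks_smul]
      congr 1
      · simp
      · ext i j
        by_cases h : i = j <;> simp [h]
        norm_num
      · simp [smul_smul, ← two_smul ℂ (1 : Matrix (Fin 3) (Fin 3) ℂ)]
      · simp)

theorem umat_cayley : umat cayley = cayleyMat := rfl

theorem umat_cayley_inv :
    umat cayley⁻¹ = invSqrtTwo • fromBlocks 1 (-(Complex.I • 1)) (-(Complex.I • 1)) 1 :=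
  star_cayleyMat

/-- The real matrix of the complex-linear map with matrix `B`. -/
def realMat (B : Matrix (Fin 3) (Fin 3) ℂ) : Mat6 :=
  fromBlocks (B.map fun z => (z.re : ℂ)) (B.map fun z => (z.im : ℂ))
    (-(B.map fun z => (z.im : ℂ))) (B.map fun z => (z.re : ℂ))

theorem cayley_conj_conjBlock (B : Matrix (Fin 3) (Fin 3) ℂ) :
    umat cayley * conjBlock B * umat cayley⁻¹ = realMat B := by
  rw [umat_cayley, umat_cayley_inv, cayleyMat, smul_mul_assoc, smul_mul_smul_invSqrtTwo, conjBlock,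
    fromBlocks_multiply, fromBlocks_multiply, fromBlocks_smul, realMat]
  have h : ∀ z : ℂ, z = z.re + z.im * Complex.I := fun z => (Complex.re_add_im z).symm
  have h' : ∀ z : ℂ, star z = z.re - z.im * Complex.I := fun z => by
    apply Complex.ext <;> simp
  congr 1 <;> ext i j <;>
    simp only [Matrix.smul_apply, Matrix.add_apply, one_mul, mul_one, mul_zero, zero_add, add_zero,
      Matrix.neg_apply, mul_neg, Matrix.smul_mul, Matrix.mul_smul, map_apply, smul_eq_mul,
      h']
  · linear_combination (1 / 2 : ℂ) * h (B i j) +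
      (-1 / 2 * ((B i j).re - (B i j).im * Complex.I)) * Complex.I_mul_I
  · linear_combination (-1 / 2 * Complex.I) * h (B i j) - ((B i j).im : ℂ) * Complex.I_mul_I
  · linear_combination (1 / 2 * Complex.I) * h (B i j) + ((B i j).im : ℂ) * Complex.I_mul_I
  · linear_combination (-1 / 2 * Complex.I ^ 2) * h (B i j) -
      (1 / 2 * ((B i j).re + (B i j).im * Complex.I)) * Complex.I_mul_I

/-- The conjugate of the embedding of `U(3)` by the Cayley transform; its image consists of real
matrices. -/
def realU3 : unitaryGroup (Fin 3) ℂ →* USp6 :=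
  (MulAut.conj cayley).toMonoidHom.comp embedU3

theorem realU3_apply (u : unitaryGroup (Fin 3) ℂ) :
    realU3 u = cayley * embedU3 u * cayley⁻¹ := rfl

theorem umat_realU3 (u : unitaryGroup (Fin 3) ℂ) : umat (realU3 u) = realMat u.1 :=
  cayley_conj_conjBlock u.1

theorem continuous_realU3 : Continuous realU3 := by
  refine Continuous.subtype_mk (Continuous.subtype_mk ?_ _) _
  have h : (fun u => umat (realU3 u)) = fun u : unitaryGroup (Fin 3) ℂ => realMat u.1 :=
    funext umat_realU3
  change Continuous fun u => umat (realU3 u)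
  rw [h]
  unfold realMat
  have hre : Continuous fun u : unitaryGroup (Fin 3) ℂ => u.1.map fun z => (z.re : ℂ) :=
    continuous_subtype_val.matrix_map (Complex.continuous_ofReal.comp Complex.continuous_re)
  have him : Continuous fun u : unitaryGroup (Fin 3) ℂ => u.1.map fun z => (z.im : ℂ) :=
    continuous_subtype_val.matrix_map (Complex.continuous_ofReal.comp Complex.continuous_im)
  exact Continuous.matrix_fromBlocks hre him him.neg hre

/-- Torus elements with tᵢ = ±1 are real and have two equal diagonal blocks, so they lie in the real
form of U(3) too. This is the source of the evenness condition. -/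
theorem torusElt_eq_realU3 (t : Fin 3 → Circle) (ht : ∀ i, ((t i : ℂ)).im = 0) :
    torusElt t = realU3 (diagU3 t) := by
  refine USp6.mat_injective ?_
  change umat (torusElt t) = umat (realU3 (diagU3 t))
  rw [umat_torusElt, umat_realU3, realMat, diagU3]
  have hre : ∀ i, (((t i : ℂ).re : ℝ) : ℂ) = t i := fun i =>
    Complex.ext (by simp) (by simp [ht i])
  have hinv : ∀ i, ((t i : ℂ))⁻¹ = t i := fun i => by
    rw [← Circle.coe_inv, Circle.coe_inv_eq_conj]
    exact Complex.conj_eq_iff_im.2 (ht i)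
  congr 1
  · ext i j
    by_cases h : i = j <;> simp [h, hre]
  · ext i j
    by_cases h : i = j <;> simp [h, ht]
  · ext i j
    by_cases h : i = j <;> simp [h, ht]
  · ext i j
    by_cases h : i = j <;> simp [h, hre, hinv]

/-- After the transform the nontrivial coset of the normalizer is represented by a torus element,
whose action on a weight vector is known. -/
theorem cayley_conj_elementJ : cayley * elementJ * cayley⁻¹ = centralI := by
  refine USp6.mat_injective ?_
  change umat cayley * umat elementJ * umat cayley⁻¹ = umat centralI
  rw [umat_cayley, umat_cayley_inv, cayleyMat, umat_elementJ, umat_centralI, smul_mul_assoc,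
    smul_mul_smul_invSqrtTwo, Matrix.J, fromBlocks_multiply, fromBlocks_multiply, fromBlocks_smul]
  congr 1
  · ext i j
    by_cases h : i = j <;> simp [h]
    ring
  · ext i j
    by_cases h : i = j <;> simp [h]
  · ext i j
    by_cases h : i = j <;> simp [h]
  · ext i j
    by_cases h : i = j <;> simp [h]
    ring

variable {V : Type*} [AddCommGroup V] [Module ℂ V]

/-- Derivative of the invariance of a functional under the real form of `U(3)`. -/
theorem apply_realMat_eq_zero {ρ : Representation ℂ USp6 V} {L : Mat6 →ₗ[ℂ] Module.End ℂ V}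
    (hL : IsInfinitesimal ρ L) {φ : Module.Dual ℂ V} (hφ : ∀ u w, φ (ρ (realU3 u) w) = φ w)
    {B : Matrix (Fin 3) (Fin 3) ℂ} (hB : star B = -B) (w : V) : φ (L (realMat B) w) = 0 := by
  have hmem : ∀ s : ℝ, NormedSpace.exp (s • B) ∈ unitaryGroup (Fin 3) ℂ := by
    intro s
    have h1 : star (s • B) = -(s • B) := by
      rw [star_smul, hB, smul_neg]
      simp
    rw [mem_unitaryGroup_iff, star_eq_conjTranspose, ← Matrix.exp_conjTranspose,
      ← star_eq_conjTranspose, h1,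
      ← Matrix.exp_add_of_commute _ _ ((Commute.refl (s • B)).neg_right), add_neg_cancel,
      NormedSpace.exp_zero]
  let γ : ℝ → unitaryGroup (Fin 3) ℂ := fun s => ⟨NormedSpace.exp (s • B), hmem s⟩
  have hγ0 : γ 0 = 1 := Subtype.ext (by simp [γ])
  have hd : HasDerivAt (fun s : ℝ => NormedSpace.exp (s • B)) B 0 := by
    have h := hasDerivAt_exp_smul_const (𝕂 := ℝ) B 0
    simp only [zero_smul, NormedSpace.exp_zero, one_mul] at h
    exact h
  have hd' : ∀ i j, HasDerivAt (fun s : ℝ => NormedSpace.exp (s • B) i j) (B i j) 0 := fun i j =>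
    hasDerivAt_pi.1 (hasDerivAt_pi.1 hd i) j
  have hc : HasDerivAt (fun s => conjBlock (γ s).1) (conjBlock B) 0 := by
    refine hasDerivAt_pi.2 fun i => hasDerivAt_pi.2 fun j => ?_
    rcases i with i | i <;> rcases j with j | j
    · exact hd' i j
    · exact hasDerivAt_const _ _
    · exact hasDerivAt_const _ _
    · exact (hd' i j).star
  have h1 := hL (fun s => realU3 (γ s)) (realMat B)
    (by rw [hγ0, map_one])
    (by
      rw [← cayley_conj_conjBlock]
      exact hasDerivAt_mul_curve_mul (umat cayley) (umat cayley⁻¹) hc) φ w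
  simp only [hφ] at h1
  exact h1.unique (hasDerivAt_const _ _)

/-- These block matrices form the complexified Lie algebra of the real form: real and imaginary
parts of the pair (A, S) each encode a skew-Hermitian matrix with real part from A and imaginary
part from S. -/
theorem apply_orthogonal_eq_zero {ρ : Representation ℂ USp6 V} {L : Mat6 →ₗ[ℂ] Module.End ℂ V}
    (hL : IsInfinitesimal ρ L) {φ : Module.Dual ℂ V} (hφ : ∀ u w, φ (ρ (realU3 u) w) = φ w)
    {A S : Matrix (Fin 3) (Fin 3) ℂ} (hA : Aᵀ = -A) (hS : Sᵀ = S) (w : V) :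
    φ (L (fromBlocks A S (-S) A) w) = 0 := by
  have hA' : ∀ i j, A j i = -A i j := fun i j => congrFun (congrFun hA i) j
  have hS' : ∀ i j, S j i = S i j := fun i j => congrFun (congrFun hS i) j
  let B₁ : Matrix (Fin 3) (Fin 3) ℂ := of fun i j => ⟨(A i j).re, (S i j).re⟩
  let B₂ : Matrix (Fin 3) (Fin 3) ℂ := of fun i j => ⟨(A i j).im, (S i j).im⟩
  have h1 : star B₁ = -B₁ := by
    ext i j
    change star (B₁ j i) = -(B₁ i j)
    apply Complex.ext <;> simp [B₁, hA' i j, hS' i j]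
  have h2 : star B₂ = -B₂ := by
    ext i j
    change star (B₂ j i) = -(B₂ i j)
    apply Complex.ext <;> simp [B₂, hA' i j, hS' i j]
  have h3 : (fromBlocks A S (-S) A : Mat6) = realMat B₁ + Complex.I • realMat B₂ := by
    rw [realMat, realMat, fromBlocks_smul, fromBlocks_add]
    congr 1 <;> ext i j <;> apply Complex.ext <;> simp [B₁, B₂]
  rw [h3, map_add, map_smul, LinearMap.add_apply, LinearMap.smul_apply, map_add, map_smul,
    apply_realMat_eq_zero hL hφ h1, apply_realMat_eq_zero hL hφ h2, smul_zero, add_zero]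

/-- A functional invariant under the real form of `U(3)` that vanishes at a highest weight vector
vanishes on its orbit. -/
theorem invariant_functional_eq_zero [FiniteDimensional ℂ V] {ρ : Representation ℂ USp6 V}
    {L : Mat6 →ₗ[ℂ] Module.End ℂ V} (hL : IsInfinitesimal ρ L) {φ : Module.Dual ℂ V}
    (hφ : ∀ u w, φ (ρ (realU3 u) w) = φ w) {μ : Fin 3 → ℤ} {v : V} (hv : IsHighestVector L μ v)
    (h0 : φ v = 0) (g : USp6) : φ (ρ g v) = 0 := by
  refine hL.apply_eq_zero φ v (fun X hX => ?_) h0 g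
  obtain ⟨hB, hC, hD⟩ := blocks_of_mem_sp6 hX
  let A := X.toBlocks₁₁
  let N : Matrix (Fin 3) (Fin 3) ℂ := of fun i j => if i ≤ j then 0 else A i j
  -- Iwasawa-type splitting: the lower left block and the strictly lower part N of the first block
  -- determine the 𝔨 component, and subtracting it leaves an element of the Borel subalgebra.
  refine ⟨fromBlocks (N - Nᵀ) (-X.toBlocks₂₁) (-(-X.toBlocks₂₁)) (N - Nᵀ),
    fromBlocks (A - (N - Nᵀ)) (X.toBlocks₁₂ + X.toBlocks₂₁) 0 (-(A - (N - Nᵀ))ᵀ), ?_, ?_, ?_, ?_⟩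
  · rw [fromBlocks_add]
    conv_lhs => rw [← fromBlocks_toBlocks X, hD]
    congr 1 <;> simp [A]
    abel
  · exact fromBlocks_mem_sp6 (by rw [transpose_add, hB, hC]) transpose_zero rfl
  · exact apply_orthogonal_eq_zero hL hφ (by simp) (by rw [transpose_neg, hC])
  · refine ⟨_, hv.apply_borel (fun i j hij => ?_) (by rw [transpose_add, hB, hC])⟩
    simp [N, not_le.2 hij, hij.le]

end

/-! ### The spherical vector and the multiplicities. -/

noncomputable section
open Matrix

attribute [local instance] Matrix.linftyOpNormedRing Matrix.linftyOpNormedAlgebra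

variable {V : Type*} [AddCommGroup V] [Module ℂ V]

/-- The orbit of a nonzero vector separates functionals on an irreducible representation. -/
theorem functional_eq_zero_of_orbit {ρ : Representation ℂ USp6 V} (hirr : ρ.IsIrreducible) {v : V}
    (hv : v ≠ 0) {φ : Module.Dual ℂ V} (h : ∀ g, φ (ρ g v) = 0) : φ = 0 := by
  let S : Subrepresentation ρ :=
    { toSubmodule := Submodule.span ℂ (Set.range fun g => ρ g v)
      apply_mem_toSubmodule := fun g w hw => by
        induction hw using Submodule.span_induction with
        | mem x hx =>
          obtain ⟨k, rfl⟩ := hx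
          refine Submodule.subset_span ⟨g * k, ?_⟩
          simp only [map_mul, Module.End.mul_apply]
        | zero => rw [map_zero]; exact Submodule.zero_mem _
        | add x y _ _ hx hy => rw [map_add]; exact Submodule.add_mem _ hx hy
        | smul c x _ hx => rw [map_smul]; exact Submodule.smul_mem _ c hx }
  have hvS : v ∈ S.toSubmodule := Submodule.subset_span ⟨1, by simp⟩
  have htop : S = ⊤ := by
    rcases hirr.eq_bot_or_eq_top S with h0 | h0
    · rw [h0] at hvS
      exact absurd ((Submodule.mem_bot ℂ).1 hvS) hv
    · exact h0
  ext w
  have hw : w ∈ S.toSubmodule := by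
    rw [htop]
    exact Submodule.mem_top
  induction hw using Submodule.span_induction with
  | mem x hx =>
    obtain ⟨k, rfl⟩ := hx
    exact h k
  | zero => rw [map_zero, map_zero]
  | add x y _ _ hx hy => rw [map_add, map_add, hx, hy]
  | smul c x _ hx => rw [map_smul, map_smul, hx]

/-- The leading minors of a real matrix are real, and even powers of reals are nonnegative. This
positivity keeps the average of the highest weight vector from vanishing. -/
theorem minorProd_realMat (p q r : ℕ) (hp : Even p) (hq : Even q) (hr : Even r)
    (B : Matrix (Fin 3) (Fin 3) ℂ) : ∃ s : ℝ, 0 ≤ s ∧ minorProd p q r (realMat B) = s := by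
  refine ⟨(B 0 0).re ^ p * ((B 0 0).re * (B 1 1).re - (B 0 1).re * (B 1 0).re) ^ q *
    ((B.map Complex.re).det) ^ r,
    mul_nonneg (mul_nonneg (hp.pow_nonneg _) (hq.pow_nonneg _)) (hr.pow_nonneg _), ?_⟩
  simp only [minorProd, minorThree, realMat, fromBlocks_apply₁₁, map_apply, det_fin_three]
  push_cast
  congr 2
  ring

/-- The character of the central element of `U(3)`. -/
theorem torusChar_circleI (p q r : ℕ) :
    (torusChar ![((p + q + r : ℕ) : ℤ), ((q + r : ℕ) : ℤ), ((r : ℕ) : ℤ)] fun _ => circleI : ℂ) =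
      Complex.I ^ (p + q + r + (q + r) + r) := by
  rw [coe_torusChar, Fin.prod_univ_three]
  simp only [cons_val_zero, cons_val_one, cons_val, zpow_natCast, coe_circleI, pow_add]

theorem even_of_neg_one_smul {n : ℕ} {v : V} (hv : v ≠ 0) (h : ((-1 : ℂ) ^ n) • v = v) :
    Even n := by
  by_contra hn
  rw [Nat.not_even_iff_odd] at hn
  have : Module ℚ V := Module.compHom V (algebraMap ℚ ℂ)
  have : IsAddTorsionFree V := .of_module_rat V
  rw [hn.neg_one_pow, neg_one_smul, neg_eq_self] at h
  exact hv h

theorem torusChar_mulSingle (μ : Fin 3 → ℤ) (i : Fin 3) (z : Circle) :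
    (torusChar μ (Pi.mulSingle i z) : ℂ) = (z : ℂ) ^ μ i := by
  rw [coe_torusChar, Finset.prod_eq_single i]
  · simp
  · intro j _ hj
    simp [hj]
  · simp

/-- The space of vectors fixed by the real form of `U(3)` is spanned by the average of a highest
weight vector, which is nonzero exactly for even weights. -/
theorem exists_realU3_spherical_vector [FiniteDimensional ℂ V] {ρ : Representation ℂ USp6 V}
    (hcont : IsContinuousRep ρ) (hirr : ρ.IsIrreducible) {p q r : ℕ}
    (hweight : HasHighestWeight ρ ![((p + q + r : ℕ) : ℤ), ((q + r : ℕ) : ℤ), ((r : ℕ) : ℤ)]) :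
    ∃ x : V, (∀ u, ρ (realU3 u) x = x) ∧
      (∀ w, (∀ u, ρ (realU3 u) w = w) → ∃ c : ℂ, c • x = w) ∧
      (x ≠ 0 ↔ Even p ∧ Even q ∧ Even r) ∧
      ρ centralI x = Complex.I ^ (p + q + r + (q + r) + r) • x := by
  obtain ⟨v, hv0, hv⟩ := (isWeight_iff _ _).1 hweight.1
  obtain ⟨L, hL⟩ := exists_isInfinitesimal ρ hcont
  have hhv := hv.isHighestVector hL hweight
  obtain ⟨P, hP1, hP2, hP3, hP4, hP5⟩ := exists_averaging (ρ.comp realU3)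
    fun ψ w => (hcont ψ w).comp continuous_realU3
  have hzero : ∀ φ : Module.Dual ℂ V, (∀ u w, φ (ρ (realU3 u) w) = φ w) → φ v = 0 → φ = 0 :=
    fun φ hφ h0 => functional_eq_zero_of_orbit hirr hv0
      (invariant_functional_eq_zero hL hφ hhv h0)
  have hPinv : ∀ (φ : Module.Dual ℂ V) u w, (φ ∘ₗ P) (ρ (realU3 u) w) = (φ ∘ₗ P) w :=
    fun φ u w => congrArg φ (hP2 u w)
  -- If w were off the line of Pv, some φ would vanish on Pv but not at w; yet φ ∘ P is invariant
  -- and vanishes at v, so it is zero, while it takes the value φ(w) at w.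
  have hspan : ∀ w, (∀ u, ρ (realU3 u) w = w) → ∃ c : ℂ, c • P v = w := by
    intro w hw
    rw [← Submodule.mem_span_singleton]
    by_contra hmem
    obtain ⟨φ, hφw, hφ⟩ := Submodule.exists_dual_map_eq_bot_of_notMem hmem inferInstance
    have h1 : φ (P v) = 0 := by
      have h2 : φ (P v) ∈ (Submodule.span ℂ {P v}).map φ :=
        Submodule.mem_map_of_mem (Submodule.mem_span_singleton_self _)
      rwa [hφ, Submodule.mem_bot] at h2
    have h2 := LinearMap.congr_fun (hzero (φ ∘ₗ P) (hPinv φ) h1) w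
    rw [LinearMap.comp_apply, hP3 w hw] at h2
    exact hφw h2
  refine ⟨P v, fun u => hP1 u v, hspan, ⟨fun hne => ?_, fun ⟨hp, hq, hr⟩ => ?_⟩, ?_⟩
  · have hev : ∀ (i : Fin 3) (n : ℕ), ![((p + q + r : ℕ) : ℤ), ((q + r : ℕ) : ℤ), ((r : ℕ) : ℤ)] i =
        n → Even n := by
      intro i n hn
      refine even_of_neg_one_smul hne ?_
      -- The averaging absorbs this element, while v is multiplied by (−1) to the i-th weight
      -- coordinate; so Pv equals that sign times Pv.
      have h1 : torusElt (Pi.mulSingle i (-1)) = realU3 (diagU3 (Pi.mulSingle i (-1))) := by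
        refine torusElt_eq_realU3 _ fun j => ?_
        by_cases hj : j = i
        · subst hj
          simp
        · simp [hj]
      have h2 := hP2 (diagU3 (Pi.mulSingle i (-1))) v
      rw [MonoidHom.comp_apply, ← h1, hv, map_smul, torusChar_mulSingle, hn, zpow_natCast] at h2
      simpa using h2
    have h0 := hev 0 _ rfl
    have h1 := hev 1 _ rfl
    have h2 := hev 2 _ rfl
    rw [Nat.even_add] at h1
    have hq : Even q := h1.2 h2
    rw [Nat.even_add, Nat.even_add] at h0
    exact ⟨(h0.2 h2).2 hq, hq, h2⟩
  · obtain ⟨Q, -, hQ2, hQ3, -⟩ := exists_torus_averaging ρ hcont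
      ![((p + q + r : ℕ) : ℤ), ((q + r : ℕ) : ℤ), ((r : ℕ) : ℤ)]
    obtain ⟨ψ, hψ⟩ : ∃ ψ : Module.Dual ℂ V, ψ v ≠ 0 := by
      by_contra! h
      exact hv0 ((Module.forall_dual_apply_eq_zero_iff ℂ v).1 h)
    -- Composing with the weight projection turns any ψ nonzero at v into a functional of the
    -- highest weight, normalized to 1 at v.
    let φ : Module.Dual ℂ V := ((ψ v)⁻¹ • ψ) ∘ₗ Q
    have hφv : φ v = 1 := by
      change (ψ v)⁻¹ * ψ (Q v) = 1
      rw [hQ3 v hv, inv_mul_cancel₀ hψ]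
    have hφ := (hQ2 ((ψ v)⁻¹ • ψ)).isLowestFunctional hcont hL hweight
    have hne := hP5 φ v (fun u => by
      rw [MonoidHom.comp_apply, highest_coeff_eq_minorProd hcont hL p q r hhv hφ hφv,
        umat_realU3]
      exact minorProd_realMat p q r hp hq hr _) (by rw [hφv]; exact one_ne_zero)
    intro h0
    rw [h0, map_zero] at hne
    exact hne rfl
  · have hconj : ∀ u, ∃ u', realU3 u * centralI = centralI * realU3 u' := by
      intro u
      refine ⟨conjUnitary u, ?_⟩
      rw [← cayley_conj_elementJ, realU3_apply, realU3_apply, ← elementJ_conj_embedU3,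
        ← elementJ_inv_conj]
      group
    have hconj' : ∀ u, ∃ u', centralI * realU3 u = realU3 u' * centralI := by
      intro u
      refine ⟨conjUnitary u, ?_⟩
      rw [← cayley_conj_elementJ, realU3_apply, realU3_apply, ← elementJ_conj_embedU3]
      group
    have hinv : ∀ u, ρ (realU3 u) (ρ centralI (P v)) = ρ centralI (P v) := by
      intro u
      obtain ⟨u', hu'⟩ := hconj u
      rw [← Module.End.mul_apply, ← map_mul, hu', map_mul, Module.End.mul_apply]
      exact congrArg _ (hP1 u' v)
    refine eq_of_forall_dual_eq fun ψ => ?_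
    -- The central element normalizes the real form, so this functional is invariant and takes equal
    -- values at Pv and at v. At v the weight supplies the power of i.
    have h1 := hP4 (ψ ∘ₗ P ∘ₗ ρ centralI) (fun u w => by
      obtain ⟨u', hu'⟩ := hconj' u
      change ψ (P (ρ centralI (ρ (realU3 u) w))) = ψ (P (ρ centralI w))
      rw [← Module.End.mul_apply (ρ centralI), ← map_mul, hu', map_mul, Module.End.mul_apply]
      exact congrArg ψ (hP2 u' _)) v
    rw [LinearMap.comp_apply, LinearMap.comp_apply, LinearMap.comp_apply, LinearMap.comp_apply,
      hP3 _ hinv] at h1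
    rw [h1, centralI, hv, torusChar_circleI, map_smul]

/-- The space of vectors fixed by `U(3)` is spanned by one vector, nonzero exactly for even
weights, on which `J` acts by a power of `i`. -/
theorem exists_spherical_vector [FiniteDimensional ℂ V] {ρ : Representation ℂ USp6 V}
    (hcont : IsContinuousRep ρ) (hirr : ρ.IsIrreducible) {p q r : ℕ}
    (hweight : HasHighestWeight ρ ![((p + q + r : ℕ) : ℤ), ((q + r : ℕ) : ℤ), ((r : ℕ) : ℤ)]) :
    ∃ x : V, (∀ w, (∀ u, ρ (embedU3 u) w = w) ↔ w ∈ Submodule.span ℂ {x}) ∧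
      (x ≠ 0 ↔ Even p ∧ Even q ∧ Even r) ∧
      ρ elementJ x = Complex.I ^ (p + q + r + (q + r) + r) • x := by
  obtain ⟨y, hy, hspan, hne, hI⟩ := exists_realU3_spherical_vector hcont hirr hweight
  have hact : ∀ g h w, ρ g (ρ h w) = ρ (g * h) w := fun g h w => by
    rw [map_mul, Module.End.mul_apply]
  have hinv : ∀ w, ρ cayley⁻¹ (ρ cayley w) = w := fun w => by
    rw [hact, inv_mul_cancel, map_one, Module.End.one_apply]
  have hemb : ∀ u, embedU3 u * cayley⁻¹ = cayley⁻¹ * realU3 u := fun u => by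
    rw [realU3_apply]
    group
  -- Undoing the Cayley transform carries the invariants of the real form to those of U(3) and the
  -- torus element back to J.
  refine ⟨ρ cayley⁻¹ y, fun w => ⟨fun hw => ?_, fun hw u => ?_⟩, ?_, ?_⟩
  · obtain ⟨c, hc⟩ := hspan (ρ cayley w) fun u => by
      rw [hact, realU3_apply, inv_mul_cancel_right, ← hact, hw u]
    exact Submodule.mem_span_singleton.2 ⟨c, by rw [← map_smul, hc, hinv]⟩
  · obtain ⟨c, rfl⟩ := Submodule.mem_span_singleton.1 hw
    rw [map_smul, hact, hemb, ← hact, hy u]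
  · rw [← hne, not_iff_not]
    refine ⟨fun h => ?_, fun h => by rw [h, map_zero]⟩
    have h1 := congrArg (ρ cayley) h
    rwa [hact, mul_inv_cancel, map_one, Module.End.one_apply, map_zero] at h1
  · have h : elementJ * cayley⁻¹ = cayley⁻¹ * centralI := by
      rw [← cayley_conj_elementJ]
      group
    rw [hact, h, ← hact, hI, map_smul]

theorem mem_invariants_U3_iff (ρ : Representation ℂ USp6 V) (w : V) :
    w ∈ Representation.invariants (ρ.comp U3.subtype) ↔ ∀ u, ρ (embedU3 u) w = w := by
  rw [Representation.mem_invariants]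
  exact ⟨fun h u => h ⟨_, embedU3_mem u⟩, fun h ⟨_, u, hu⟩ => hu ▸ h u⟩

theorem mem_invariants_NU3_iff (ρ : Representation ℂ USp6 V) (w : V) :
    w ∈ Representation.invariants (ρ.comp NU3.subtype) ↔
      (∀ u, ρ (embedU3 u) w = w) ∧ ρ elementJ w = w := by
  rw [Representation.mem_invariants]
  refine ⟨fun h => ⟨fun u => h ⟨_, (mem_NU3_iff _).2 (Or.inl (embedU3_mem u))⟩,
    h ⟨_, elementJ_mem_NU3⟩⟩, fun ⟨hU, hJ⟩ ⟨g, hg⟩ => ?_⟩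
  change ρ g w = w
  rcases (mem_NU3_iff g).1 hg with ⟨u, hu⟩ | ⟨u, hu⟩
  · rw [← hu, hU]
  · rw [← mul_inv_cancel_left elementJ g, ← hu, map_mul, Module.End.mul_apply, hU, hJ]

theorem I_pow_eq_one_iff (n : ℕ) : Complex.I ^ n = 1 ↔ n ≡ 0 [MOD 4] := by
  rw [Nat.modEq_zero_iff_dvd, ← Complex.isPrimitiveRoot_I.pow_eq_one_iff_dvd]

end

theorem mainTheorem8 (a b c : ℕ) (hba : b ≤ a) (hcb : c ≤ b)
    {V : Type*} [AddCommGroup V] [Module ℂ V] [FiniteDimensional ℂ V]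
    (ρ : Representation ℂ USp6 V) (hcont : IsContinuousRep ρ) (hirr : ρ.IsIrreducible)
    (hweight : HasHighestWeight ρ ![(a : ℤ), (b : ℤ), (c : ℤ)]) :
    trivialMultiplicity U3 ρ = (if Even a ∧ Even b ∧ Even c then 1 else 0) ∧
    trivialMultiplicity NU3 ρ =
      (if (Even a ∧ Even b ∧ Even c) ∧ a + b + c ≡ 0 [MOD 4] then 1 else 0) := by
  -- The differences a − b, b − c and c are the coordinates of λ in the fundamental weights, that
  -- is, the exponents of the minors.
  obtain ⟨q, rfl⟩ : ∃ q, b = q + c := ⟨b - c, by omega⟩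
  obtain ⟨p, rfl⟩ : ∃ p, a = p + q + c := ⟨a - (q + c), by omega⟩
  obtain ⟨x, hx, hne, hJ⟩ := exists_spherical_vector hcont hirr hweight
  have hpar : (Even (p + q + c) ∧ Even (q + c) ∧ Even c) ↔ (Even p ∧ Even q ∧ Even c) := by
    simp only [Nat.even_add]
    tauto
  have hev := hpar.trans hne.symm
  have hU : Representation.invariants (ρ.comp U3.subtype) = Submodule.span ℂ {x} := by
    ext w
    rw [mem_invariants_U3_iff, hx]
  -- J acts on the line of U(3)-invariants by a scalar, so the line survives entirely or not at all.
  have hN : Representation.invariants (ρ.comp NU3.subtype) =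
      if Complex.I ^ (p + q + c + (q + c) + c) = 1 then Submodule.span ℂ {x} else ⊥ := by
    ext w
    rw [mem_invariants_NU3_iff, hx]
    split_ifs with h
    · refine ⟨fun hw => hw.1, fun hw => ⟨hw, ?_⟩⟩
      obtain ⟨d, rfl⟩ := Submodule.mem_span_singleton.1 hw
      rw [map_smul, hJ, h, one_smul]
    · rw [Submodule.mem_bot]
      refine ⟨fun ⟨hw, hw'⟩ => ?_, fun hw => by simp [hw]⟩
      obtain ⟨d, rfl⟩ := Submodule.mem_span_singleton.1 hw
      rw [map_smul, hJ, smul_comm] at hw'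
      by_contra h0
      exact h (smul_left_injective ℂ h0 (hw'.trans (one_smul ℂ _).symm))
  rw [trivialMultiplicity, trivialMultiplicity, hU, hN]
  by_cases h0 : x = 0
  · have h1 : ¬ (Even (p + q + c) ∧ Even (q + c) ∧ Even c) := fun h => hev.1 h h0
    rw [if_neg h1, if_neg (fun h => h1 (And.left h)), h0, Submodule.span_zero_singleton, ite_self,
      finrank_bot]
    exact ⟨rfl, rfl⟩
  · have h1 := hev.2 h0
    rw [if_pos h1, finrank_span_singleton h0]
    refine ⟨rfl, ?_⟩
    by_cases h : Complex.I ^ (p + q + c + (q + c) + c) = 1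
    · rw [if_pos h, if_pos ⟨h1, (I_pow_eq_one_iff _).1 h⟩, finrank_span_singleton h0]
    · rw [if_neg h, if_neg fun h2 => h ((I_pow_eq_one_iff _).2 h2.2), finrank_bot]
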